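/- Let $X\subset\mathbb C^n$ be open, let $\mathcal J\subset\mathcal O_X$ be an ideal sheaf with zero locus $Z$, and let $$0\to\mathcal O(E_N)\xrightarrow{f_N}\cdots\xrightarrow{f_2}\mathcal O(E_1)\xrightarrow{f_1}\mathcal O(E_0)$$ be a resolution of $\mathcal O(E_0)/\mathcal J$, where the $E_k$ are holomorphic vector bundles over $X$ and $E_0$ is the trivial line bundle (so $\mathcal O(E_0)=\mathcal O_X$; put $E_k=0$ for $k>N$). Given smooth Hermitian metrics on the $E_k$, let, over $X\setminus Z$, $\sigma:E_k\to E_{k+1}$ be the minimal inverse of $f_{k+1}$: $\sigma y$ is the solution $\eta$ of $f_{k+1}\eta=y$ of minimal norm if $y\in\operatorname{Im}f_{k+1}$, and $\sigma y=0$ if $y\perp\operatorname{Im} f_{k+1}$. Let $\sigma$ act on $E$-valued forms as an odd operator, $\sigma(\alpha\otimes e)=(-1)^{\deg\alpha}\alpha\otimes\sigma e$, let $\bar\partial\sigma=\bar\partial\circ\sigma+\sigma\circ\bar\partial$, put $u=\sigma+\sigma(\bar\partial\sigma)+\sigma(\bar\partial\sigma)^2+\cdots$, and for $p\ge 1$ and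 a holomorphic section $\varphi$ of $E_0$ let $u_p\varphi=\sigma(\bar\partial\sigma)^{p-1}\varphi$ be the component of $u\varphi$ with values in $E_p$, an $E_p$-valued $(0,p-1)$-form on $X\setminus Z$. (i) Let $p\ge 1$, let $\xi$ be a holomorphic section of $E_p^*$ over $X$ with $f_{p+1}^*\xi=0$, and let $\varphi\in\mathcal O(X)$. Then for every choice of metrics $\xi u_p\varphi$ is a smooth $\bar\partial$-closed $(0,p-1)$-form on $X\setminus Z$, and its class $[\xi u_p\varphi]_{\bar\partial}\in H^{0,p-1}_{\bar\partial}(X\setminus Z)$ does not depend on the metrics. (ii) Let $\mathcal O(F_\bullet)$ be another such resolution of $\mathcal O_X/\mathcal J$, with $F_0$ the trivial line bundle, and let $x\in X$. Then there are an open neighbourhood $Y\subset X$ of $x$, Hermitian metrics on $E_\bullet$ and on $F_\bullet$ over $Y$, a holomorphic isomorphism $g_0:E_0\to F_0$ over $Y$ and, for every $p\ge1$, a holomorphic isomorphism $g_p$ over $Y$ from a holomorphic subbundle of $E_p$ to a holomorphic subbundle of $F_p$ such that, if $u$ and $v$ denote the endomorphisms associated with $E_\bullet$ and $F_\bullet$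 and these metrics, then for all $\varphi\in\mathcal O(Y)$ the forms $u_p\varphi$ and $v_pg_0\varphi$ take values in these subbundles and $$u_p\varphi=g_p^{-1}v_p\,g_0\varphi\qquad\text{on }Y\setminus Z .$$ -/

import Mathlib

open Filter Topology Matrix
open scoped ContDiff ComplexOrder

noncomputable section

namespace Residue

/-- Complex `n`-space. -/
abbrev Cn (n : ℕ) : Type := Fin n → ℂ

/-! ### Germs of holomorphic functions and ideals -/

/-- The ring of germs at `x` of holomorphic functions, as a subring of the ring of all germs at `x`
of complex valued functions. -/
def HolGerm {n : ℕ} (x : Cn n) : Subring (Germ (𝓝 x) ℂ) where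
  carrier := {g | ∃ φ : Cn n → ℂ, AnalyticAt ℂ φ x ∧ g = (φ : Germ (𝓝 x) ℂ)}
  mul_mem' := by
    rintro _ _ ⟨φ, hφ, rfl⟩ ⟨ψ, hψ, rfl⟩
    exact ⟨φ * ψ, hφ.mul hψ, rfl⟩
  one_mem' := ⟨1, analyticAt_const, rfl⟩
  add_mem' := by
    rintro _ _ ⟨φ, hφ, rfl⟩ ⟨ψ, hψ, rfl⟩
    exact ⟨φ + ψ, hφ.add hψ, rfl⟩
  zero_mem' := ⟨0, analyticAt_const, rfl⟩
  neg_mem' := by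
    rintro _ ⟨φ, hφ, rfl⟩
    exact ⟨-φ, hφ.neg, rfl⟩

/-- The germ at `x` of a function that is holomorphic near `x`. -/
def HolGerm.of {n : ℕ} {x : Cn n} (φ : Cn n → ℂ) (hφ : AnalyticAt ℂ φ x) : HolGerm x :=
  ⟨(φ : Germ (𝓝 x) ℂ), φ, hφ, rfl⟩

/-- The zero locus of a family of ideals (the stalks of an ideal sheaf): the points at which
all germs of the stalk vanish. -/
def zeroLocus {n : ℕ} (J : ∀ x : Cn n, Ideal (HolGerm x)) : Set (Cn n) :=
  {x | ∀ g ∈ J x, Germ.value (g : Germ (𝓝 x) ℂ) = 0}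

/-! ### Differential forms of bidegree `(0,q)` and Dolbeault cohomology -/

/-- Fields of `ℝ`-multilinear alternating `q`-forms on `ℂⁿ` with values in `F`. -/
abbrev Form (n q : ℕ) (F : Type) [NormedAddCommGroup F] [NormedSpace ℂ F] : Type :=
  Cn n → (Cn n) [⋀^Fin q]→L[ℝ] F

section Forms

variable {n q : ℕ} {F : Type} [NormedAddCommGroup F] [NormedSpace ℂ F]

/-- An alternating form has bidegree `(0,q)` if it is conjugate linear in each argument. -/
def IsAntiholType (α : (Cn n) [⋀^Fin q]→L[ℝ] F) : Prop :=
  ∀ (v : Fin q → Cn n) (a : Fin q),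
    α (Function.update v a (Complex.I • v a)) = -(Complex.I • α v)

/-- The conjugate linear part `v ↦ (L v + i L (i v)) / 2` of a real linear map `L`. -/
def conjLinearPart {W : Type} [NormedAddCommGroup W] [NormedSpace ℝ W] [Module ℂ W]
    [SMulCommClass ℝ ℂ W] [ContinuousConstSMul ℂ W] (L : Cn n →L[ℝ] W) : Cn n →L[ℝ] W :=
  (2⁻¹ : ℂ) • (L + Complex.I • L.comp (Complex.I • ContinuousLinearMap.id ℝ (Cn n)))

/-- The operator `∂̄`: the alternatization of the conjugate linear part of the derivative, that is
`∂̄ (∑ α_K dz̄_K) = ∑ ∂̄α_K ∧ dz̄_K`. -/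
def dbar (α : Form n q F) : Form n (q + 1) F := fun z =>
  ContinuousAlternatingMap.alternatizeUncurryFin (conjLinearPart (fderiv ℝ α z))

theorem dbar_add (α η : Form n q F) (z : Cn n) (hα : DifferentiableAt ℝ α z)
    (hη : DifferentiableAt ℝ η z) : dbar (α + η) z = dbar α z + dbar η z := by
  ext v
  simp only [dbar, conjLinearPart, fderiv_add hα hη,
    ContinuousAlternatingMap.alternatizeUncurryFin_apply, ContinuousAlternatingMap.add_apply,
    _root_.smul_apply, _root_.add_apply, ContinuousLinearMap.comp_apply,
    ContinuousAlternatingMap.smul_apply, smul_add, ← Finset.sum_add_distrib]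
  refine Finset.sum_congr rfl fun i _ => ?_
  abel

theorem dbar_smul (c : ℂ) (α : Form n q F) (z : Cn n) (hα : DifferentiableAt ℝ α z) :
    dbar (c • α) z = c • dbar α z := by
  have h : fderiv ℝ (c • α) z = c • fderiv ℝ α z := fderiv_const_smul hα c
  ext v
  simp only [dbar, conjLinearPart, h,
    ContinuousAlternatingMap.alternatizeUncurryFin_apply,
    _root_.smul_apply, _root_.add_apply, ContinuousLinearMap.comp_apply,
    ContinuousAlternatingMap.add_apply,
    ContinuousAlternatingMap.smul_apply, smul_add, Finset.smul_sum]
  refine Finset.sum_congr rfl fun i _ => ?_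
  simp only [smul_comm c]

/-- The smooth `(0,q)`-forms on an open set `U` (values outside `U` are irrelevant). -/
def smoothForms (U : Set (Cn n)) (q : ℕ) (F : Type) [NormedAddCommGroup F] [NormedSpace ℂ F] :
    Submodule ℂ (Form n q F) where
  carrier := {α | ContDiffOn ℝ ∞ α U ∧ ∀ z ∈ U, IsAntiholType (α z)}
  add_mem' := by
    rintro α η ⟨h1, h2⟩ ⟨h3, h4⟩
    refine ⟨h1.add h3, fun z hz v a => ?_⟩
    simp only [Pi.add_apply, ContinuousAlternatingMap.add_apply, h2 z hz v a, h4 z hz v a,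
      smul_add, neg_add]
  zero_mem' := ⟨contDiffOn_const, fun z _ v a => by simp⟩
  smul_mem' := by
    rintro c α ⟨h1, h2⟩
    refine ⟨h1.const_smul c, fun z hz v a => ?_⟩
    simp only [Pi.smul_apply, ContinuousAlternatingMap.smul_apply, h2 z hz v a, smul_neg,
      smul_comm c]

/-- The `∂̄`-closed smooth scalar `(0,q)`-forms on the open set `U`. -/
def closedForms (U : TopologicalSpace.Opens (Cn n)) (q : ℕ) : Submodule ℂ (Form n q ℂ) where
  carrier := {α | α ∈ smoothForms (U : Set (Cn n)) q ℂ ∧ ∀ z ∈ U, dbar α z = 0}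
  add_mem' := by
    rintro α η ⟨h1, h2⟩ ⟨h3, h4⟩
    refine ⟨add_mem h1 h3, fun z hz => ?_⟩
    have hU := U.isOpen.mem_nhds hz
    rw [dbar_add α η z ((h1.1.contDiffAt hU).differentiableAt (by simp))
      ((h3.1.contDiffAt hU).differentiableAt (by simp)), h2 z hz, h4 z hz, add_zero]
  zero_mem' := ⟨zero_mem _, fun z _ => by
    have := dbar_smul (0 : ℂ) (0 : Form n q ℂ) z (differentiableAt_const 0)
    simpa using this⟩
  smul_mem' := by
    rintro c α ⟨h1, h2⟩
    refine ⟨Submodule.smul_mem _ c h1, fun z hz => ?_⟩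
    rw [dbar_smul c α z ((h1.1.contDiffAt (U.isOpen.mem_nhds hz)).differentiableAt (by simp)),
      h2 z hz, smul_zero]

/-- The forms that agree on the open set `U` with `∂̄η` for a smooth `(0,q-1)`-form `η` on `U`;
for `q = 0` these are the forms that vanish on `U`. -/
def exactForms (U : TopologicalSpace.Opens (Cn n)) : (q : ℕ) → Submodule ℂ (Form n q ℂ)
  | 0 =>
    { carrier := {α | ∀ z ∈ U, α z = 0}
      add_mem' := fun h1 h2 z hz => by simp [h1 z hz, h2 z hz]
      zero_mem' := fun z _ => rfl
      smul_mem' := fun c α h z hz => by simp [h z hz] }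
  | q + 1 =>
    { carrier := {α | ∃ η ∈ smoothForms (U : Set (Cn n)) q ℂ, ∀ z ∈ U, α z = dbar η z}
      add_mem' := by
        rintro α α' ⟨η, h1, h2⟩ ⟨η', h3, h4⟩
        refine ⟨η + η', add_mem h1 h3, fun z hz => ?_⟩
        have hU := U.isOpen.mem_nhds hz
        rw [dbar_add η η' z ((h1.1.contDiffAt hU).differentiableAt (by simp))
          ((h3.1.contDiffAt hU).differentiableAt (by simp)), Pi.add_apply, h2 z hz, h4 z hz]
      zero_mem' := ⟨0, zero_mem _, fun z _ => by
        have := dbar_smul (0 : ℂ) (0 : Form n q ℂ) z (differentiableAt_const 0)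
        simpa using this.symm⟩
      smul_mem' := by
        rintro c α ⟨η, h1, h2⟩
        refine ⟨c • η, Submodule.smul_mem _ c h1, fun z hz => ?_⟩
        rw [dbar_smul c η z ((h1.1.contDiffAt (U.isOpen.mem_nhds hz)).differentiableAt (by simp)),
          Pi.smul_apply, h2 z hz] }

/-- The Dolbeault cohomology group `H^{0,q}(U)` of the open set `U`: the `∂̄`-closed forms modulo
the exact ones. -/
abbrev Dolbeault (U : TopologicalSpace.Opens (Cn n)) (q : ℕ) : Type :=
  (closedForms U q).map (exactForms U q).mkQ

/-- The Dolbeault class on `U` of a `∂̄`-closed form. -/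
def Dolbeault.mk (U : TopologicalSpace.Opens (Cn n)) (α : Form n q ℂ)
    (hα : α ∈ closedForms U q) : Dolbeault U q :=
  ⟨(exactForms U q).mkQ α, Submodule.mem_map_of_mem hα⟩

end Forms

/-- The form `z ↦ L z ∘ α z`, for a field `L` of linear maps acting on the values of `α`. -/
def applyForm {n q r s : ℕ} (L : Cn n → Cn r →ₗ[ℂ] Cn s) (α : Form n q (Cn r)) :
    Form n q (Cn s) := fun z =>
  ((LinearMap.toContinuousLinearMap (L z)).restrictScalars ℝ).compContinuousAlternatingMap (α z)

/-- The scalar form obtained by pairing a row vector field `ξ` with a vector valued form. -/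
def pairForm {n q r : ℕ} (ξ : Cn n → Cn r) (α : Form n q (Cn r)) : Form n q ℂ := fun z =>
  ((LinearMap.toContinuousLinearMap (dotProductBilin ℂ ℂ (ξ z))).restrictScalars
    ℝ).compContinuousAlternatingMap (α z)

/-! ### Minimal inverses -/

/-- `σ` is the minimal inverse of the linear map `A : ℂʳ → ℂˢ` for the Hermitian inner products
`⟨v, w⟩ = v* K w` on the source and `⟨v, w⟩ = v* H w` on the target: for `y` in the image of `A`,
`σ y` is a solution of `A η = y` of minimal norm, and `σ y = 0` for `y` orthogonal to the
image of `A`. -/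
def IsMinimalInverse {r s : ℕ} (A : Matrix (Fin s) (Fin r) ℂ) (K : Matrix (Fin r) (Fin r) ℂ)
    (H : Matrix (Fin s) (Fin s) ℂ) (σ : Cn s →ₗ[ℂ] Cn r) : Prop :=
  (∀ y, (∃ η, A *ᵥ η = y) → A *ᵥ σ y = y ∧
    ∀ η, A *ᵥ η = y → (star (σ y) ⬝ᵥ K *ᵥ σ y).re ≤ (star η ⬝ᵥ K *ᵥ η).re) ∧
  ∀ y, (∀ η, star (A *ᵥ η) ⬝ᵥ H *ᵥ y = 0) → σ y = 0

theorem exists_minimalInverse_aux {A B : Type} [NormedAddCommGroup A] [InnerProductSpace ℂ A]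
    [NormedAddCommGroup B] [InnerProductSpace ℂ B] [FiniteDimensional ℂ A]
    [FiniteDimensional ℂ B] (f : A →ₗ[ℂ] B) :
    ∃ σ : B →ₗ[ℂ] A, (∀ y, (∃ η, f η = y) → f (σ y) = y ∧ ∀ η, f η = y → ‖σ y‖ ≤ ‖η‖) ∧
      ∀ y, (∀ η, inner ℂ (f η) y = 0) → σ y = 0 := by
  obtain ⟨s, hs⟩ := f.rangeRestrict.exists_rightInverse_of_surjective
    (LinearMap.range_eq_top.2 f.surjective_rangeRestrict)
  have hs' : ∀ y : LinearMap.range f, f (s y) = y := fun y => by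
    have := LinearMap.congr_fun hs y
    simpa using congrArg Subtype.val this
  let Q : A →ₗ[ℂ] A := ((LinearMap.ker f)ᗮ.starProjection).toLinearMap
  let P : B →ₗ[ℂ] LinearMap.range f := ((LinearMap.range f).orthogonalProjectionOnto).toLinearMap
  have hQ : ∀ a, f (Q a) = f a := fun a => by
    have h : a - Q a ∈ (LinearMap.ker f)ᗮᗮ := Submodule.sub_starProjection_mem_orthogonal a
    rw [Submodule.orthogonal_orthogonal, LinearMap.mem_ker, map_sub, sub_eq_zero] at h
    exact h.symm
  have hQ0 : ∀ a, f a = 0 → Q a = 0 := fun a ha => by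
    apply Submodule.starProjection_apply_eq_zero_iff _ |>.2
    rw [Submodule.orthogonal_orthogonal]
    exact ha
  refine ⟨Q ∘ₗ s ∘ₗ P, ?_, ?_⟩
  · rintro _ ⟨η₀, rfl⟩
    have hP : P (f η₀) = ⟨f η₀, η₀, rfl⟩ :=
      Submodule.orthogonalProjectionOnto_mem_subspace_eq_self (⟨f η₀, η₀, rfl⟩ : LinearMap.range f)
    have hf : f (s (P (f η₀))) = f η₀ := by rw [hs', hP]
    refine ⟨by simp only [LinearMap.comp_apply, hQ, hf], fun η hη => ?_⟩
    have h : Q (s (P (f η₀))) = Q η := by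
      rw [← sub_eq_zero, ← map_sub]
      exact hQ0 _ (by rw [map_sub, hf, hη, sub_self])
    simp only [LinearMap.comp_apply, h]
    exact Submodule.norm_starProjection_apply_le _ η
  · intro y hy
    have : P y = 0 := by
      apply Submodule.orthogonalProjectionOnto_eq_zero_iff.2
      rw [Submodule.mem_orthogonal]
      rintro _ ⟨η, rfl⟩
      exact hy η
    simp [LinearMap.comp_apply, this]

theorem exists_isMinimalInverse {r s : ℕ} (A : Matrix (Fin s) (Fin r) ℂ)
    {K : Matrix (Fin r) (Fin r) ℂ} {H : Matrix (Fin s) (Fin s) ℂ} (hK : K.PosDef)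
    (hH : H.PosDef) : ∃ σ, IsMinimalInverse A K H σ := by
  let nA : NormedAddCommGroup (Cn r) := K.toNormedAddCommGroup hK
  let iA : @InnerProductSpace ℂ (Cn r) _ nA.toSeminormedAddCommGroup := K.toInnerProductSpace hK.posSemidef
  let nB : NormedAddCommGroup (Cn s) := H.toNormedAddCommGroup hH
  let iB : @InnerProductSpace ℂ (Cn s) _ nB.toSeminormedAddCommGroup := H.toInnerProductSpace hH.posSemidef
  obtain ⟨σ, h1, h2⟩ := @exists_minimalInverse_aux (Cn r) (Cn s) nA iA nB iB inferInstance
    inferInstance A.mulVecLin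
  have hn : ∀ v : Cn r, (star v ⬝ᵥ K *ᵥ v).re = @norm _ nA.toNorm v ^ 2 := fun v => by
    rw [dotProduct_comm]
    exact (@inner_self_eq_norm_sq ℂ (Cn r) _ nA.toSeminormedAddCommGroup iA v)
  refine ⟨σ, fun y hy => ?_, fun y hy => h2 y fun η => ?_⟩
  · obtain ⟨h3, h4⟩ := h1 y hy
    refine ⟨h3, fun η hη => ?_⟩
    rw [hn, hn]
    exact pow_le_pow_left₀ (@norm_nonneg _ nA.toSeminormedAddCommGroup.toSeminormedAddGroup _) (h4 η hη) 2
  · rw [← hy η, dotProduct_comm]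
    rfl

open Classical in
/-- The minimal inverse; it exists (and is unique) when `K` and `H` are positive definite. -/
def minimalInverse {r s : ℕ} (A : Matrix (Fin s) (Fin r) ℂ) (K : Matrix (Fin r) (Fin r) ℂ)
    (H : Matrix (Fin s) (Fin s) ℂ) : Cn s →ₗ[ℂ] Cn r :=
  if h : ∃ σ, IsMinimalInverse A K H σ then h.choose else 0

/-! ### Complexes of holomorphic vector bundles, resolutions and Hermitian metrics -/

/-- A finite complex `0 → E_N → ⋯ → E_1 → E_0` of holomorphic vector bundles over `X`, with `E_0`
the trivial line bundle. The bundles are given by holomorphic transition matrices over a common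
open cover `U i` of `X`: a section `s` of `E_k` is a family of vectors `s_i` on `U i` with
`s_i = trans k i j * s_j` on `U i ∩ U j`, and `f k : E_{k+1} → E_k` is given over `U i` by the
matrix `f k i`. -/
structure BundleComplex {n : ℕ} (X : Set (Cn n)) where
  ι : Type
  U : ι → Set (Cn n)
  isOpen_U : ∀ i, IsOpen (U i)
  iUnion_U : ⋃ i, U i = X
  rank : ℕ → ι → ℕ
  trans : ∀ (k : ℕ) (i j : ι), Cn n → Matrix (Fin (rank k i)) (Fin (rank k j)) ℂ
  trans_hol : ∀ k i j a b, AnalyticOnNhd ℂ (fun z => trans k i j z a b) (U i ∩ U j)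
  trans_self : ∀ k i, ∀ z ∈ U i, trans k i i z = 1
  trans_mul : ∀ k i j l, ∀ z ∈ U i ∩ U j ∩ U l, trans k i j z * trans k j l z = trans k i l z
  f : ∀ (k : ℕ) (i : ι), Cn n → Matrix (Fin (rank k i)) (Fin (rank (k + 1) i)) ℂ
  f_hol : ∀ k i a b, AnalyticOnNhd ℂ (fun z => f k i z a b) (U i)
  f_trans : ∀ k i j, ∀ z ∈ U i ∩ U j, trans k i j z * f k j z = f k i z * trans (k + 1) i j z
  f_comp_f : ∀ k i, ∀ z ∈ U i, f k i z * f (k + 1) i z = 0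
  rank_zero : ∀ i, rank 0 i = 1
  trans_zero : ∀ i j, ∀ z ∈ U i ∩ U j, ∀ a b, trans 0 i j z a b = 1
  length : ℕ
  rank_eq_zero : ∀ k i, length < k → rank k i = 0

namespace BundleComplex

variable {n : ℕ} {X : Set (Cn n)}

/-- The sheaf complex `0 → O(E_N) → ⋯ → O(E_1) → O(E_0)` is a resolution of `O(E_0) / J`: it is
exact at `O(E_k)` for `k ≥ 1`, and the image of `O(E_1)` in `O(E_0) = O` is `J` (both on
stalks). -/
structure IsResolution (E : BundleComplex X) (J : ∀ x : Cn n, Ideal (HolGerm x)) : Prop where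
  exact : ∀ k i, ∀ z ∈ E.U i, ∀ s : Cn n → Cn (E.rank (k + 1) i), AnalyticAt ℂ s z →
    (∀ᶠ w in 𝓝 z, E.f k i w *ᵥ s w = 0) →
    ∃ t : Cn n → Cn (E.rank (k + 2) i), AnalyticAt ℂ t z ∧
      ∀ᶠ w in 𝓝 z, E.f (k + 1) i w *ᵥ t w = s w
  mem_iff : ∀ i, ∀ z ∈ E.U i, ∀ (φ : Cn n → ℂ) (hφ : AnalyticAt ℂ φ z),
    HolGerm.of φ hφ ∈ J z ↔ ∃ t : Cn n → Cn (E.rank 1 i), AnalyticAt ℂ t z ∧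
      ∀ᶠ w in 𝓝 z, ∀ a, (E.f 0 i w *ᵥ t w) a = φ w

/-- If `J` has a resolution over the open set `X`, then `X \ Z` is open, where `Z` is the zero
locus of `J`. -/
theorem IsResolution.isOpen_diff {E : BundleComplex X} {J : ∀ x : Cn n, Ideal (HolGerm x)}
    (hE : E.IsResolution J) : IsOpen (X \ zeroLocus J) := by
  rw [isOpen_iff_mem_nhds]
  rintro z ⟨hzX, hz⟩
  rw [← E.iUnion_U] at hzX
  obtain ⟨i, hi⟩ := Set.mem_iUnion.1 hzX
  simp only [zeroLocus, Set.mem_ofPred_eq, not_forall] at hz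
  obtain ⟨⟨g, φ, hφ, rfl⟩, hg, hg0⟩ := hz
  have hφ0 : φ z ≠ 0 := hg0
  obtain ⟨t, ht, htφ⟩ := (hE.mem_iff i z hi φ hφ).1 hg
  filter_upwards [(E.isOpen_U i).mem_nhds hi, hφ.eventually_analyticAt, ht.eventually_analyticAt,
    htφ.eventually_nhds, hφ.continuousAt.eventually_ne hφ0] with w h1 h2 h3 h4 h5
  refine ⟨E.iUnion_U ▸ Set.mem_iUnion.2 ⟨i, h1⟩, fun hw => h5 ?_⟩
  exact hw (HolGerm.of φ h2) ((hE.mem_iff i w h1 φ h2).2 ⟨t, h3, h4⟩)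

/-- The open set `X \ Z`, where `Z` is the zero locus of `J`. -/
def IsResolution.compl {E : BundleComplex X} {J : ∀ x : Cn n, Ideal (HolGerm x)}
    (hE : E.IsResolution J) : TopologicalSpace.Opens (Cn n) :=
  ⟨X \ zeroLocus J, hE.isOpen_diff⟩

/-- Smooth Hermitian metrics over `Y ⊆ X` on all bundles `E_k` of the complex, that is, a Hermitian
metric on `⨁ E_k` for which the `E_k` are orthogonal. In the frame over `U i` the metric on `E_k`
is `⟨v, w⟩ = v* (H k i) w`. -/
structure HermitianMetric (E : BundleComplex X) (Y : Set (Cn n)) where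
  H : ∀ (k : ℕ) (i : E.ι), Cn n → Matrix (Fin (E.rank k i)) (Fin (E.rank k i)) ℂ
  posDef : ∀ k i, ∀ z ∈ E.U i ∩ Y, (H k i z).PosDef
  smooth : ∀ k i a b, ContDiffOn ℝ ∞ (fun z => H k i z a b) (E.U i ∩ Y)
  compat : ∀ k i j, ∀ z ∈ E.U i ∩ E.U j ∩ Y,
    H k j z = (E.trans k i j z)ᴴ * H k i z * E.trans k i j z

/-- `ξ` is a holomorphic section over `X` of the dual bundle `E_k^*`, given by row vectors. -/
structure IsHolDualSection (E : BundleComplex X) (k : ℕ)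
    (ξ : ∀ i : E.ι, Cn n → Cn (E.rank k i)) : Prop where
  hol : ∀ i, AnalyticOnNhd ℂ (ξ i) (E.U i)
  compat : ∀ i j, ∀ z ∈ E.U i ∩ E.U j, ξ j z = ξ i z ᵥ* E.trans k i j z

/-! ### The endomorphism `u` -/

variable {E : BundleComplex X} {Y : Set (Cn n)}

/-- The minimal inverse `σ : E_k → E_{k+1}` of `f : E_{k+1} → E_k`, in the frames over `U i`. -/
def sigma (h : E.HermitianMetric Y) (k : ℕ) (i : E.ι) (z : Cn n) :
    Cn (E.rank k i) →ₗ[ℂ] Cn (E.rank (k + 1) i) :=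
  minimalInverse (E.f k i z) (h.H (k + 1) i z) (h.H k i z)

/-- The action of the odd endomorphism `σ` on `E_k`-valued `(0,q)`-forms,
`σ (α ⊗ e) = (-1)^q α ⊗ σ e`. -/
def sigmaForm (h : E.HermitianMetric Y) (k : ℕ) (i : E.ι) {q : ℕ}
    (α : Form n q (Cn (E.rank k i))) : Form n q (Cn (E.rank (k + 1) i)) :=
  (-1 : ℂ) ^ q • applyForm (sigma h k i) α

/-- The action on `E_k`-valued `(0,q)`-forms of the endomorphism valued form `∂̄σ`, the
supercommutator of the odd operators `∂̄` and `σ`. -/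
def dbarSigma (h : E.HermitianMetric Y) (k : ℕ) (i : E.ι) {q : ℕ}
    (α : Form n q (Cn (E.rank k i))) : Form n (q + 1) (Cn (E.rank (k + 1) i)) :=
  dbar (sigmaForm h k i α) + sigmaForm h k i (dbar α)

/-- `(∂̄σ)^k φ` for a section `φ` of the trivial line bundle `E_0`. -/
def dbarSigmaPow (h : E.HermitianMetric Y) (φ : Cn n → ℂ) (i : E.ι) :
    (k : ℕ) → Form n k (Cn (E.rank k i))
  | 0 => fun z => ContinuousAlternatingMap.constOfIsEmpty ℝ (Cn n) (Fin 0) (fun _ => φ z)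
  | k + 1 => dbarSigma h k i (dbarSigmaPow h φ i k)

/-- For a section `φ` of `E_0` and `u = σ + σ (∂̄σ) + σ (∂̄σ)^2 + ⋯`, the `E_{q+1}`-valued component
`u_{q+1} φ = σ (∂̄σ)^q φ` of `u φ`, in the frame over `U i`. -/
def uComponent (h : E.HermitianMetric Y) (φ : Cn n → ℂ) (q : ℕ) (i : E.ι) :
    Form n q (Cn (E.rank (q + 1) i)) :=
  sigmaForm h q i (dbarSigmaPow h φ i q)

end BundleComplex

/-- `S` is a holomorphic subbundle over `Y` of the trivial bundle with fibre `ℂʳ`: locally it has a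
frame consisting of holomorphic sections. -/
def IsHolSubbundle {n r : ℕ} (Y : Set (Cn n)) (S : Cn n → Submodule ℂ (Cn r)) : Prop :=
  ∀ z ∈ Y, ∃ (d : ℕ) (s : Fin d → Cn n → Cn r), (∀ a, AnalyticAt ℂ (s a) z) ∧
    ∀ᶠ w in 𝓝 z, LinearIndependent ℂ (fun a => s a w) ∧
      Submodule.span ℂ (Set.range fun a => s a w) = S w

/-- The holomorphic matrix field `G` restricts to an isomorphism over `Y` from the subbundle `S` of
the trivial bundle with fibre `ℂʳ` to the subbundle `T` of the trivial bundle with fibre `ℂˢ`. -/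
structure IsHolSubbundleIso {n r s : ℕ} (Y : Set (Cn n)) (S : Cn n → Submodule ℂ (Cn r))
    (T : Cn n → Submodule ℂ (Cn s)) (G : Cn n → Matrix (Fin s) (Fin r) ℂ) : Prop where
  source : IsHolSubbundle Y S
  target : IsHolSubbundle Y T
  hol : ∀ a b, AnalyticOnNhd ℂ (fun z => G z a b) Y
  bijOn : ∀ z ∈ Y, Set.BijOn (G z).mulVec (S z) (T z)

end Residue

end

/-! Index convention: `f k` is the map E_{k+1} → E_k, and u_p is treated through q = p - 1.

Off Z the complex is exact on fibres (`exact_at`), so the Laplacian of each term is invertible. The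
minimal inverse is then the adjoint of f composed with the inverse Laplacian
(`IsMinimalInverse.eq_gramAdjoint_mul`). This gives smoothness of σ and σσ = 0, and it shows that σ
commutes with any map commuting with f and its adjoint. Because σσ = 0, only σ∂̄ survives in
σ(∂̄σ)^q. Up to a sign, u_{q+1}φ is therefore the recursive solution x_0 = σφ, x_{q+1} = -σ∂̄x_q of
f x_0 = φ, f x_{q+1} = -∂̄x_q (`uComponent_eq_solve`, `solve_spec`).

For (i), ξ is holomorphic and ξf = 0, so ∂̄(ξx_q) = ξ∂̄x_q = -ξ f x_{q+1} = 0. For two metrics the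
signed differences d_q = (-1)^q (x_q - x'_q) satisfy f d_0 = 0 and f d_{q+1} = ∂̄d_q. The same
recursion one degree higher gives y_q with f y_0 = d_0 and f y_{q+1} = d_{q+1} - ∂̄y_q. Pairing with
ξ yields ξd_0 = 0 and ξd_{q+1} = ∂̄(ξy_q).

For (ii), each resolution is split near x into a summand whose differentials above the last one
vanish at x, and a complement. Generalized inverses of f at x, perturbed holomorphically, give the
projections P = 1 - fS - Sf (`exists_harmonicProj`). Maps of complexes lifting the identity of O_X
are inverse to each other up to homotopy. At x the homotopy terms vanish on the summands, so the
compressed comparison map G is invertible there, hence also nearby (`comparison_eq_one`,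
`exists_comparison`). Metrics are then chosen so that each summand is orthogonal to its complement
and G is an isometry of the summands. With such metrics P and G commute with f and its adjoints, so
they intertwine σ (`sigma_intertwine`) and, being holomorphic, also u (`solve_intertwine`). -/

noncomputable section

namespace Residue

/-! ### Calculus of ∂̄ on vector-valued (0,q)-forms -/

section FormCalculus

variable {n q : ℕ} {F G : Type} [NormedAddCommGroup F] [NormedSpace ℂ F]
  [NormedAddCommGroup G] [NormedSpace ℂ G]

/-- Composition of a complex linear map with an alternating form, as a continuous bilinear map. -/
def compBilin (n q : ℕ) (F G : Type) [NormedAddCommGroup F] [NormedSpace ℂ F]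
    [NormedAddCommGroup G] [NormedSpace ℂ G] :
    (F →L[ℂ] G) →L[ℝ] (Cn n [⋀^Fin q]→L[ℝ] F) →L[ℝ] (Cn n [⋀^Fin q]→L[ℝ] G) :=
  LinearMap.mkContinuous₂
    (LinearMap.mk₂ ℝ (fun (A : F →L[ℂ] G) (β : Cn n [⋀^Fin q]→L[ℝ] F) =>
      (A.restrictScalars ℝ).compContinuousAlternatingMap β)
      (fun _ _ _ => by ext; simp) (fun _ _ _ => by ext; simp)
      (fun _ _ _ => by ext; simp) (fun _ _ _ => by ext; simp)) 1
    (fun A β => by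
      simpa using (A.restrictScalars ℝ).norm_compContinuousAlternatingMap_le β)

/-- The form `z ↦ L z ∘ α z`, for a field `L` of continuous linear maps. -/
def clmForm (L : Cn n → F →L[ℂ] G) (α : Form n q F) : Form n q G := fun z =>
  compBilin n q F G (L z) (α z)

@[simp] theorem clmForm_apply (L : Cn n → F →L[ℂ] G) (α : Form n q F) (z : Cn n)
    (v : Fin q → Cn n) : clmForm L α z v = L z (α z v) := rfl

theorem contDiffAt_clmForm {L : Cn n → F →L[ℂ] G} {α : Form n q F} {z : Cn n}
    (hL : ContDiffAt ℝ ∞ L z) (hα : ContDiffAt ℝ ∞ α z) : ContDiffAt ℝ ∞ (clmForm L α) z :=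
  (compBilin n q F G).isBoundedBilinearMap.contDiff.comp_contDiffAt z (hL.prodMk hα)

theorem isAntiholType_clmForm {L : Cn n → F →L[ℂ] G} {α : Form n q F} {z : Cn n}
    (hα : IsAntiholType (α z)) : IsAntiholType (clmForm L α z) := fun v a => by
  simp only [clmForm_apply, hα v a, map_neg, map_smul]

theorem conjLinearPart_apply {W : Type} [NormedAddCommGroup W] [NormedSpace ℝ W] [Module ℂ W]
    [SMulCommClass ℝ ℂ W] [ContinuousConstSMul ℂ W] (L : Cn n →L[ℝ] W) (v : Cn n) :
    conjLinearPart L v = (2⁻¹ : ℂ) • (L v + Complex.I • L (Complex.I • v)) := rfl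

theorem conjLinearPart_I_smul {W : Type} [NormedAddCommGroup W] [NormedSpace ℝ W] [Module ℂ W]
    [SMulCommClass ℝ ℂ W] [ContinuousConstSMul ℂ W] (L : Cn n →L[ℝ] W) (v : Cn n) :
    conjLinearPart L (Complex.I • v) = -(Complex.I • conjLinearPart L v) := by
  have h : Complex.I • Complex.I • v = -v := by rw [smul_smul, Complex.I_mul_I, neg_one_smul]
  simp only [conjLinearPart_apply, h, map_neg]
  rw [smul_comm Complex.I (2⁻¹ : ℂ), ← smul_neg (2⁻¹ : ℂ), smul_add Complex.I,
    smul_smul Complex.I Complex.I, Complex.I_mul_I, neg_one_smul, smul_neg]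
  congr 1
  abel

theorem dbar_apply (α : Form n q F) (z : Cn n) (v : Fin (q + 1) → Cn n) :
    dbar α z v =
      ∑ i : Fin (q + 1), (-1 : ℤ) ^ (i : ℕ) • conjLinearPart (fderiv ℝ α z) (v i) (i.removeNth v) :=
  ContinuousAlternatingMap.alternatizeUncurryFin_apply _ _

/-- The derivative of a holomorphic L is complex linear, so the Leibniz term containing it has zero
conjugate linear part. No sign appears because L has form degree zero. -/
theorem dbar_clmForm {L : Cn n → F →L[ℂ] G} {α : Form n q F} {z : Cn n}
    (hL : DifferentiableAt ℂ L z) (hα : DifferentiableAt ℝ α z) :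
    dbar (clmForm L α) z = clmForm L (dbar α) z := by
  have hL' : HasFDerivAt L ((fderiv ℂ L z).restrictScalars ℝ) z :=
    hL.hasFDerivAt.restrictScalars ℝ
  have hB := (compBilin n q F G).isBoundedBilinearMap.hasFDerivAt (L z, α z)
  have h : HasFDerivAt (clmForm L α) _ z :=
    HasFDerivAt.comp (f := fun w => (L w, α w)) z hB (hL'.prodMk hα.hasFDerivAt)
  have key : ∀ (u : Cn n) (w : Fin q → Cn n), fderiv ℝ (clmForm L α) z u w =
      L z (fderiv ℝ α z u w) + fderiv ℂ L z u (α z w) := fun u w => by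
    rw [h.fderiv]; rfl
  have key2 : ∀ (u : Cn n) (w : Fin q → Cn n), conjLinearPart (fderiv ℝ (clmForm L α) z) u w =
      L z (conjLinearPart (fderiv ℝ α z) u w) := fun u w => by
    simp only [conjLinearPart_apply, ContinuousAlternatingMap.smul_apply,
      ContinuousAlternatingMap.add_apply, key, map_smul, map_add, smul_add,
      _root_.smul_apply]
    simp only [smul_smul]
    have : (2⁻¹ * (Complex.I * Complex.I) : ℂ) = -2⁻¹ := by rw [Complex.I_mul_I]; ring
    rw [this, neg_smul]
    abel
  ext v
  simp only [dbar_apply, clmForm_apply, key2, map_sum, map_zsmul]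

theorem dbar_congr {α β : Form n q F} {z : Cn n} (h : α =ᶠ[𝓝 z] β) : dbar α z = dbar β z := by
  rw [dbar, dbar, h.fderiv_eq]

theorem dbar_sub {α η : Form n q F} {z : Cn n} (hα : DifferentiableAt ℝ α z)
    (hη : DifferentiableAt ℝ η z) : dbar (α - η) z = dbar α z - dbar η z := by
  have := dbar_add α ((-1 : ℂ) • η) z hα (hη.const_smul _)
  rw [dbar_smul _ _ _ hη] at this
  have h1 : ∀ (p : ℕ) (β : Form n p F), (-1 : ℂ) • β = -β := fun p β => by
    ext; simp
  rw [sub_eq_add_neg, sub_eq_add_neg, ← h1, this]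
  congr 1
  ext; simp

variable (n) in
/-- The conjugate linear part as a continuous linear operator. -/
def conjLinearPartCLM (W : Type) [NormedAddCommGroup W] [NormedSpace ℂ W] :
    (Cn n →L[ℝ] W) →L[ℝ] (Cn n →L[ℝ] W) :=
  (2⁻¹ : ℂ) • (ContinuousLinearMap.id ℝ _ +
    Complex.I • (ContinuousLinearMap.compL ℝ (Cn n) (Cn n) W).flip
      (Complex.I • ContinuousLinearMap.id ℝ (Cn n)))

theorem dbar_eq (α : Form n q F) : dbar α = fun z =>
    (ContinuousAlternatingMap.alternatizeUncurryFinCLM ℝ (Cn n) F ∘L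
      conjLinearPartCLM n (Cn n [⋀^Fin q]→L[ℝ] F)) (fderiv ℝ α z) := rfl

theorem contDiffAt_dbar {α : Form n q F} {z : Cn n} (hα : ContDiffAt ℝ ∞ α z) :
    ContDiffAt ℝ ∞ (dbar α) z := by
  rw [dbar_eq]
  exact (ContinuousLinearMap.contDiff _).comp_contDiffAt z
    (hα.fderiv_right (m := ∞) (by simp))

/-- Conjugate linearity in the form slots is a closed linear condition, hence inherited by the
derivative; in the derivative slot it comes from `conjLinearPart`. -/
theorem isAntiholType_dbar {α : Form n q F} {z : Cn n} (hα : DifferentiableAt ℝ α z)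
    (h : ∀ᶠ w in 𝓝 z, IsAntiholType (α w)) : IsAntiholType (dbar α z) := by
  have h1 : ∀ (u : Cn n) (v : Fin q → Cn n) (a : Fin q),
      fderiv ℝ α z u (Function.update v a (Complex.I • v a)) =
        -(Complex.I • fderiv ℝ α z u v) := fun u v a => by
    -- `K` is a linear functional vanishing on forms of the right type, so `K ∘ α` is locally zero
    -- and its derivative vanishes.
    let K : (Cn n [⋀^Fin q]→L[ℝ] F) →L[ℝ] F :=
      ContinuousAlternatingMap.apply ℝ (Cn n) F (Function.update v a (Complex.I • v a)) +
        Complex.I • ContinuousAlternatingMap.apply ℝ (Cn n) F v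
    have h2 : HasFDerivAt (fun w => K (α w)) (K ∘L fderiv ℝ α z) z :=
      K.hasFDerivAt.comp z hα.hasFDerivAt
    have h3 : (fun w => K (α w)) =ᶠ[𝓝 z] fun _ => 0 := by
      filter_upwards [h] with w hw
      have := hw v a
      change α w _ + Complex.I • α w v = 0
      rw [this, neg_add_cancel]
    have h4 := (h2.congr_of_eventuallyEq h3.symm).unique (hasFDerivAt_const (0 : F) z)
    have h5 : fderiv ℝ α z u (Function.update v a (Complex.I • v a)) +
        Complex.I • fderiv ℝ α z u v = 0 := congrArg (fun L => L u) h4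
    exact eq_neg_of_add_eq_zero_left h5
  have h6 : ∀ (u : Cn n) (v : Fin q → Cn n) (a : Fin q),
      conjLinearPart (fderiv ℝ α z) u (Function.update v a (Complex.I • v a)) =
        -(Complex.I • conjLinearPart (fderiv ℝ α z) u v) := fun u v a => by
    simp only [conjLinearPart_apply, ContinuousAlternatingMap.smul_apply,
      ContinuousAlternatingMap.add_apply, h1, smul_neg, smul_add, smul_comm Complex.I (2⁻¹ : ℂ)]
    abel
  intro v a
  rw [dbar_apply, dbar_apply, Finset.smul_sum, ← Finset.sum_neg_distrib]
  refine Finset.sum_congr rfl fun i _ => ?_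
  rw [smul_comm Complex.I, ← smul_neg]
  congr 1
  -- In the summand `i` the vector `v i` is the direction of differentiation: the scaled slot is
  -- either that direction or one of the remaining arguments.
  by_cases hi : a = i
  · subst hi
    rw [Function.update_self, conjLinearPart_I_smul, Fin.removeNth_update]
    rfl
  · obtain ⟨b, rfl⟩ := Fin.exists_succAbove_eq hi
    rw [Function.update_of_ne (Fin.succAbove_ne i b).symm, Fin.removeNth_update_succAbove]
    exact h6 _ (i.removeNth v) b

/-- Taking conjugate linear parts in both slots of the symmetric second derivative leaves it
symmetric, and alternating a symmetric bilinear expression twice gives zero. -/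
theorem dbar_dbar {α : Form n q F} {z : Cn n} (hα : ContDiffAt ℝ ∞ α z) :
    dbar (dbar α) z = 0 := by
  set A := ContinuousAlternatingMap.alternatizeUncurryFinCLM (n := q) ℝ (Cn n) F
  set c := conjLinearPartCLM n (Cn n [⋀^Fin q]→L[ℝ] F)
  have h1 : DifferentiableAt ℝ (fderiv ℝ α) z :=
    (hα.fderiv_right (m := ∞) (by simp)).differentiableAt (by simp)
  set B := fderiv ℝ (fderiv ℝ α) z
  have h2 : fderiv ℝ (dbar α) z = A ∘L (c ∘L B) :=
    ((A ∘L c).hasFDerivAt.comp z h1.hasFDerivAt).fderiv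
  have hsymm : ∀ x y, B x y = B y x := fun x y =>
    (hα.isSymmSndFDerivAt (by
      rw [minSmoothness_of_isRCLikeNormedField]
      exact WithTop.coe_le_coe.2 le_top)) x y
  have h3 : conjLinearPart (A ∘L (c ∘L B)) = A ∘L conjLinearPart (c ∘L B) := by
    ext1 v
    simp only [conjLinearPart_apply, ContinuousLinearMap.comp_apply]
    have hA : ∀ (k : ℂ) L, A (k • L) = k • A L := fun k L =>
      ContinuousAlternatingMap.alternatizeUncurryFin_smul k L
    rw [hA, map_add, hA]
  rw [dbar, h2, h3]
  refine ContinuousAlternatingMap.alternatizeUncurryFin_alternatizeUncurryFinCLM_comp_of_symmetric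
    fun x y => ?_
  have hc : ∀ L v, c L v = (2⁻¹ : ℂ) • (L v + Complex.I • L (Complex.I • v)) := fun _ _ => rfl
  simp only [conjLinearPart_apply, ContinuousLinearMap.comp_apply, _root_.smul_apply,
    _root_.add_apply, hc, smul_add]
  rw [hsymm x y, hsymm (Complex.I • x) y, hsymm x (Complex.I • y),
    hsymm (Complex.I • x) (Complex.I • y)]
  simp only [smul_comm Complex.I (2⁻¹ : ℂ)]
  abel

/-- A function as a form of degree zero. -/
def zeroForm (φ : Cn n → F) : Form n 0 F := fun z =>
  ContinuousAlternatingMap.constOfIsEmpty ℝ (Cn n) (Fin 0) (φ z)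

theorem isAntiholType_zero (α : Cn n [⋀^Fin 0]→L[ℝ] F) : IsAntiholType α := fun _ a => a.elim0

theorem contDiffAt_zeroForm {φ : Cn n → F} {z : Cn n} (hφ : ContDiffAt ℝ ∞ φ z) :
    ContDiffAt ℝ ∞ (zeroForm φ) z :=
  (ContinuousAlternatingMap.constOfIsEmptyLIE ℝ (Cn n) F (Fin 0)).contDiff.comp_contDiffAt z hφ

theorem dbar_zeroForm {φ : Cn n → F} {z : Cn n} (hφ : DifferentiableAt ℂ φ z) :
    dbar (zeroForm φ) z = 0 := by
  have h : HasFDerivAt (zeroForm φ) _ z :=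
    (ContinuousAlternatingMap.constOfIsEmptyLIE ℝ (Cn n) F
      (Fin 0)).toContinuousLinearEquiv.toContinuousLinearMap.hasFDerivAt.comp z
      (hφ.hasFDerivAt.restrictScalars ℝ)
  ext v
  rw [dbar_apply]
  refine Finset.sum_eq_zero fun i _ => ?_
  rw [conjLinearPart_apply, h.fderiv]
  have key : ∀ u (w : Fin 0 → Cn n), (((ContinuousAlternatingMap.constOfIsEmptyLIE ℝ (Cn n) F
      (Fin 0)).toContinuousLinearEquiv.toContinuousLinearMap.comp
      ((fderiv ℂ φ z).restrictScalars ℝ)) u) w = fderiv ℂ φ z u := fun _ _ => rfl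
  simp only [ContinuousAlternatingMap.smul_apply, ContinuousAlternatingMap.add_apply, key,
    map_smul, smul_smul, Complex.I_mul_I]
  simp

end FormCalculus

/-! ### Regularity of fields of linear maps, and spaces of smooth forms -/

section LinearFields

variable {n r s : ℕ}

/-- A field of linear maps `ℂʳ → ℂˢ` as a field of continuous linear maps. -/
def toCLM (L : Cn n → Cn r →ₗ[ℂ] Cn s) : Cn n → Cn r →L[ℂ] Cn s :=
  fun z => LinearMap.toContinuousLinearMap (L z)

@[simp] theorem applyForm_apply {q : ℕ} (L : Cn n → Cn r →ₗ[ℂ] Cn s) (α : Form n q (Cn r))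
    (z : Cn n) (v : Fin q → Cn n) : applyForm L α z v = L z (α z v) := rfl

/-- The field of continuous linear maps `v ↦ ξ z ⬝ᵥ v` given by a field of row vectors. -/
def rowCLM (ξ : Cn n → Cn r) : Cn n → Cn r →L[ℂ] ℂ :=
  fun z => LinearMap.toContinuousLinearMap (dotProductBilin ℂ ℂ (ξ z))

theorem pairForm_eq_clmForm {q : ℕ} (ξ : Cn n → Cn r) (α : Form n q (Cn r)) :
    pairForm ξ α = clmForm (rowCLM ξ) α := rfl

@[simp] theorem pairForm_apply {q : ℕ} (ξ : Cn n → Cn r) (α : Form n q (Cn r))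
    (z : Cn n) (v : Fin q → Cn n) : pairForm ξ α z v = ξ z ⬝ᵥ α z v := rfl

/-- A matrix, given by its entries, as a continuous linear map. -/
def entriesCLM (r s : ℕ) : (Fin s → Fin r → ℂ) →L[ℂ] (Cn r →L[ℂ] Cn s) :=
  LinearMap.toContinuousLinearMap
    ((LinearMap.toContinuousLinearMap (𝕜 := ℂ) (E := Cn r) (F' := Cn s)).toLinearMap ∘ₗ
      (Matrix.toLin' (R := ℂ) (m := Fin s) (n := Fin r)).toLinearMap)

theorem toCLM_mulVecLin (M : Cn n → Matrix (Fin s) (Fin r) ℂ) :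
    toCLM (fun z => (M z).mulVecLin) = fun z => entriesCLM r s (fun a b => M z a b) := by
  ext z : 1
  rfl

theorem differentiableAt_toCLM_mulVecLin {M : Cn n → Matrix (Fin s) (Fin r) ℂ} {z : Cn n}
    (h : ∀ a b, AnalyticAt ℂ (fun w => M w a b) z) :
    DifferentiableAt ℂ (toCLM fun w => (M w).mulVecLin) z := by
  rw [toCLM_mulVecLin]
  exact (entriesCLM r s).differentiableAt.comp z (f := fun w a b => M w a b)
    (differentiableAt_pi.2 fun a => differentiableAt_pi.2 fun b => (h a b).differentiableAt)

theorem contDiffAt_toCLM_mulVecLin {M : Cn n → Matrix (Fin s) (Fin r) ℂ} {z : Cn n}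
    (h : ∀ a b, ContDiffAt ℝ ∞ (fun w => M w a b) z) :
    ContDiffAt ℝ ∞ (toCLM fun w => (M w).mulVecLin) z := by
  rw [toCLM_mulVecLin]
  exact ((entriesCLM r s).restrictScalars ℝ).contDiff.comp_contDiffAt z
    (f := fun w a b => M w a b) (contDiffAt_pi.2 fun a => contDiffAt_pi.2 fun b => h a b)

theorem differentiableAt_rowCLM {ξ : Cn n → Cn r} {z : Cn n} (h : DifferentiableAt ℂ ξ z) :
    DifferentiableAt ℂ (rowCLM ξ) z :=
  (LinearMap.toContinuousLinearMap
    ((LinearMap.toContinuousLinearMap (𝕜 := ℂ) (E := Cn r) (F' := ℂ)).toLinearMap ∘ₗ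
      (dotProductBilin (m := Fin r) (A := ℂ) ℂ ℂ))).differentiableAt.comp z h

theorem contDiffAt_rowCLM {ξ : Cn n → Cn r} {z : Cn n} (h : ContDiffAt ℝ ∞ ξ z) :
    ContDiffAt ℝ ∞ (rowCLM ξ) z :=
  ((LinearMap.toContinuousLinearMap
    ((LinearMap.toContinuousLinearMap (𝕜 := ℂ) (E := Cn r) (F' := ℂ)).toLinearMap ∘ₗ
      (dotProductBilin (m := Fin r) (A := ℂ) ℂ ℂ))).restrictScalars ℝ).contDiff.comp_contDiffAt z h

end LinearFields

section SmoothForms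

variable {n q : ℕ} {F G : Type} [NormedAddCommGroup F] [NormedSpace ℂ F]
  [NormedAddCommGroup G] [NormedSpace ℂ G] {W : Set (Cn n)}

theorem mem_smoothForms_iff (hW : IsOpen W) {α : Form n q F} :
    α ∈ smoothForms W q F ↔ ∀ z ∈ W, ContDiffAt ℝ ∞ α z ∧ IsAntiholType (α z) :=
  ⟨fun h z hz => ⟨h.1.contDiffAt (hW.mem_nhds hz), h.2 z hz⟩,
    fun h => ⟨fun z hz => (h z hz).1.contDiffWithinAt, fun z hz => (h z hz).2⟩⟩

theorem contDiffAt_of_mem_smoothForms (hW : IsOpen W) {α : Form n q F}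
    (h : α ∈ smoothForms W q F) {z : Cn n} (hz : z ∈ W) : ContDiffAt ℝ ∞ α z :=
  h.1.contDiffAt (hW.mem_nhds hz)

theorem differentiableAt_of_mem_smoothForms (hW : IsOpen W) {α : Form n q F}
    (h : α ∈ smoothForms W q F) {z : Cn n} (hz : z ∈ W) : DifferentiableAt ℝ α z :=
  (contDiffAt_of_mem_smoothForms hW h hz).differentiableAt (by simp)

theorem clmForm_mem_smoothForms (hW : IsOpen W) {L : Cn n → F →L[ℂ] G} {α : Form n q F}
    (hL : ∀ z ∈ W, ContDiffAt ℝ ∞ L z) (h : α ∈ smoothForms W q F) :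
    clmForm L α ∈ smoothForms W q G :=
  (mem_smoothForms_iff hW).2 fun z hz =>
    ⟨contDiffAt_clmForm (hL z hz) (contDiffAt_of_mem_smoothForms hW h hz),
      isAntiholType_clmForm (h.2 z hz)⟩

theorem dbar_mem_smoothForms (hW : IsOpen W) {α : Form n q F} (h : α ∈ smoothForms W q F) :
    dbar α ∈ smoothForms W (q + 1) F :=
  (mem_smoothForms_iff hW).2 fun z hz =>
    ⟨contDiffAt_dbar (contDiffAt_of_mem_smoothForms hW h hz),
      isAntiholType_dbar (differentiableAt_of_mem_smoothForms hW h hz)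
        (by filter_upwards [hW.mem_nhds hz] with w hw using h.2 w hw)⟩

end SmoothForms

/-! ### The recursive solution of D x = c - ∂̄x -/

section Solve

variable {n : ℕ} {r r' : ℕ → ℕ}

/-- Given linear maps `S k : ℂ^{r k} → ℂ^{r (k+1)}` depending on a point, the iterative solution
of the equations `D x₀ = c₀`, `D x_{q+1} = c_{q+1} - ∂̄ x_q`, where `S` is a homotopy for `D`. -/
def solve (S : ∀ k, Cn n → Cn (r k) →ₗ[ℂ] Cn (r (k + 1))) (c : ∀ q, Form n q (Cn (r q))) :
    ∀ q, Form n q (Cn (r (q + 1)))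
  | 0 => applyForm (S 0) (c 0)
  | q + 1 => applyForm (S (q + 1)) (c (q + 1) - dbar (solve S c q))

variable {S : ∀ k, Cn n → Cn (r k) →ₗ[ℂ] Cn (r (k + 1))}
  {S' : ∀ k, Cn n → Cn (r' k) →ₗ[ℂ] Cn (r' (k + 1))}
  {c : ∀ q, Form n q (Cn (r q))} {c' : ∀ q, Form n q (Cn (r' q))} {W : Set (Cn n)}

theorem solve_mem_smoothForms (hW : IsOpen W)
    (hS : ∀ k, ∀ z ∈ W, ContDiffAt ℝ ∞ (toCLM (S k)) z)
    (hc : ∀ q, c q ∈ smoothForms W q (Cn (r q))) (q : ℕ) :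
    solve S c q ∈ smoothForms W q (Cn (r (q + 1))) := by
  induction q with
  | zero => exact clmForm_mem_smoothForms hW (hS 0) (hc 0)
  | succ q ih =>
    exact clmForm_mem_smoothForms hW (hS (q + 1))
      (Submodule.sub_mem _ (hc (q + 1)) (dbar_mem_smoothForms hW ih))

/-- The right-hand side at stage q + 1 must lie in the kernel of `D q`, where `S` inverts. Indeed
D(c_{q+1} - ∂̄x_q) = ∂̄c_q - ∂̄(D x_q), and D x_q differs from c_q by a ∂̄-exact form, killed by
∂̄∂̄ = 0. The source `c` is left general: it is (φ, 0, 0, …) for u, and the difference of two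
solutions for the primitive. -/
theorem solve_spec (hW : IsOpen W)
    (hS : ∀ k, ∀ z ∈ W, ContDiffAt ℝ ∞ (toCLM (S k)) z)
    (hc : ∀ q, c q ∈ smoothForms W q (Cn (r q)))
    {D : ∀ k, Cn n → Cn (r (k + 1)) →ₗ[ℂ] Cn (r k)}
    (hD : ∀ k, ∀ z ∈ W, DifferentiableAt ℂ (toCLM (D k)) z)
    (h0 : ∀ z ∈ W, ∀ v, D 0 z (S 0 z (c 0 z v)) = c 0 z v)
    (hDS : ∀ k, ∀ z ∈ W, ∀ y, D k z y = 0 → D (k + 1) z (S (k + 1) z y) = y)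
    (hDc : ∀ q, ∀ z ∈ W, applyForm (D q) (c (q + 1)) z = dbar (c q) z) :
    (∀ z ∈ W, applyForm (D 0) (solve S c 0) z = c 0 z) ∧
      ∀ q, ∀ z ∈ W, applyForm (D (q + 1)) (solve S c (q + 1)) z =
        c (q + 1) z - dbar (solve S c q) z := by
  have hs := solve_mem_smoothForms hW hS hc
  have base : ∀ z ∈ W, applyForm (D 0) (solve S c 0) z = c 0 z := fun z hz => by
    ext1 v
    exact h0 z hz v
  -- The inductive step needs only ∂̄(D x_q) = ∂̄c_q, which holds both for q = 0 and, by ∂̄∂̄ = 0,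
  -- later on.
  have step : ∀ q, (∀ z ∈ W, dbar (applyForm (D q) (solve S c q)) z = dbar (c q) z) →
      ∀ z ∈ W, applyForm (D (q + 1)) (solve S c (q + 1)) z =
        c (q + 1) z - dbar (solve S c q) z := fun q hq z hz => by
    ext1 v
    refine hDS q z hz _ ?_
    have h1 : applyForm (D q) (dbar (solve S c q)) z = dbar (c q) z := by
      rw [← hq z hz]
      exact (dbar_clmForm (hD q z hz) (differentiableAt_of_mem_smoothForms hW (hs q) hz)).symm
    have h2 := DFunLike.congr_fun ((hDc q z hz).trans h1.symm) v
    simp only [applyForm_apply] at h2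
    change D q z (c (q + 1) z v - dbar (solve S c q) z v) = 0
    rw [map_sub, h2, sub_self]
  have main : ∀ q, ∀ z ∈ W, applyForm (D (q + 1)) (solve S c (q + 1)) z =
        c (q + 1) z - dbar (solve S c q) z := by
    intro q
    induction q with
    | zero =>
      refine step 0 fun z hz => dbar_congr ?_
      filter_upwards [hW.mem_nhds hz] with w hw using base w hw
    | succ q ih =>
      refine step (q + 1) fun z hz => ?_
      have h1 : applyForm (D (q + 1)) (solve S c (q + 1)) =ᶠ[𝓝 z]
          c (q + 1) - dbar (solve S c q) := by
        filter_upwards [hW.mem_nhds hz] with w hw using ih w hw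
      rw [dbar_congr h1, dbar_sub (differentiableAt_of_mem_smoothForms hW (hc (q + 1)) hz)
        (differentiableAt_of_mem_smoothForms hW (dbar_mem_smoothForms hW (hs q)) hz),
        dbar_dbar (contDiffAt_of_mem_smoothForms hW (hs q) hz), sub_zero]
  exact ⟨base, main⟩

/-- A holomorphic T passes through ∂̄, so intertwining the homotopies and the sources is enough.
This is used for transition maps (gluing), for projections (values in a subbundle) and for
comparison isomorphisms. -/
theorem solve_intertwine (hW : IsOpen W)
    (hS : ∀ k, ∀ z ∈ W, ContDiffAt ℝ ∞ (toCLM (S k)) z)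
    (hc : ∀ q, c q ∈ smoothForms W q (Cn (r q)))
    {T : ∀ k, Cn n → Cn (r k) →ₗ[ℂ] Cn (r' k)}
    (hT : ∀ k, ∀ z ∈ W, DifferentiableAt ℂ (toCLM (T k)) z)
    (hTS : ∀ k, ∀ z ∈ W, ∀ y, T (k + 1) z (S k z y) = S' k z (T k z y))
    (hTc : ∀ q, ∀ z ∈ W, applyForm (T q) (c q) z = c' q z) (q : ℕ) :
    ∀ z ∈ W, applyForm (T (q + 1)) (solve S c q) z = solve S' c' q z := by
  have hs := solve_mem_smoothForms hW hS hc
  induction q with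
  | zero =>
    intro z hz
    ext1 v
    change T 1 z (S 0 z (c 0 z v)) = S' 0 z (c' 0 z v)
    rw [hTS 0 z hz, ← hTc 0 z hz]
    rfl
  | succ q ih =>
    intro z hz
    have h1 : dbar (solve S' c' q) z = applyForm (T (q + 1)) (dbar (solve S c q)) z := by
      rw [← dbar_congr (α := applyForm (T (q + 1)) (solve S c q))]
      · exact dbar_clmForm (hT (q + 1) z hz) (differentiableAt_of_mem_smoothForms hW (hs q) hz)
      · filter_upwards [hW.mem_nhds hz] with w hw using ih w hw
    ext1 v
    change T (q + 2) z (S (q + 1) z (c (q + 1) z v - dbar (solve S c q) z v)) =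
      S' (q + 1) z (c' (q + 1) z v - dbar (solve S' c' q) z v)
    rw [hTS (q + 1) z hz, h1, ← hTc (q + 1) z hz, map_sub]
    rfl

/-- The source `(φ, 0, 0, …)` given by a section of the trivial line bundle. -/
def lineSource (r : ℕ → ℕ) (φ : Cn n → ℂ) : ∀ q, Form n q (Cn (r q))
  | 0 => zeroForm fun z _ => φ z
  | _ + 1 => 0

theorem lineSource_mem_smoothForms (hW : IsOpen W) {φ : Cn n → ℂ}
    (hφ : AnalyticOnNhd ℂ φ W) (q : ℕ) :
    lineSource r φ q ∈ smoothForms W q (Cn (r q)) := by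
  cases q with
  | zero =>
    refine (mem_smoothForms_iff hW).2 fun z hz =>
      ⟨contDiffAt_zeroForm ?_, isAntiholType_zero _⟩
    exact contDiffAt_pi.2 fun _ => (hφ z hz).restrictScalars.contDiffAt
  | succ q => exact Submodule.zero_mem _

theorem dbar_lineSource {φ : Cn n → ℂ} {z : Cn n} (hφ : AnalyticAt ℂ φ z) (q : ℕ) :
    dbar (lineSource r φ q) z = 0 := by
  cases q with
  | zero =>
    exact dbar_zeroForm (differentiableAt_pi.2 fun _ => hφ.differentiableAt)
  | succ q =>
    have := dbar_smul (0 : ℂ) (0 : Form n (q + 1) (Cn (r (q + 1)))) z (differentiableAt_const 0)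
    simpa [lineSource] using this

/-- The signs relating `σ (∂̄σ)^q φ` to the iterative solution. -/
def uSign : ℕ → ℂ
  | 0 => 1
  | q + 1 => (-1) ^ q * uSign q

namespace BundleComplex

/-- One has σ(∂̄σ)^{q+1}φ = σ∂̄(σ(∂̄σ)^qφ), since the other half of the supercommutator contains σσ
= 0. The odd action of σ on a (0,q+1)-form contributes (-1)^{q+1} and the recursion of `solve`
contributes -1; their product is the factor (-1)^q in `uSign`. -/
theorem uComponent_eq_solve {X Y : Set (Cn n)} {E : BundleComplex X} (h : E.HermitianMetric Y)
    {i : E.ι} (hW : IsOpen W)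
    (hσ : ∀ k, ∀ z ∈ W, ContDiffAt ℝ ∞ (toCLM (sigma h k i)) z)
    (hσσ : ∀ k, ∀ z ∈ W, ∀ y, sigma h (k + 1) i z (sigma h k i z y) = 0)
    {φ : Cn n → ℂ} (hφ : AnalyticOnNhd ℂ φ W) (q : ℕ) :
    ∀ z ∈ W, uComponent h φ q i z =
      uSign q • solve (r := fun k => E.rank k i) (fun k => sigma h k i)
        (lineSource (fun k => E.rank k i) φ) q z := by
  have hs := solve_mem_smoothForms (r := fun k => E.rank k i) hW hσ
    (lineSource_mem_smoothForms hW hφ)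
  induction q with
  | zero =>
    intro z hz
    ext1 v
    simp only [uComponent, sigmaForm, uSign, pow_zero, one_smul]
    rfl
  | succ q ih =>
    intro z hz
    have h1 : dbar (uComponent h φ q i) z = uSign q • dbar (solve (r := fun k => E.rank k i)
        (fun k => sigma h k i) (lineSource (fun k => E.rank k i) φ) q) z := by
      rw [← dbar_smul _ _ _ (differentiableAt_of_mem_smoothForms hW (hs q) hz)]
      refine dbar_congr ?_
      filter_upwards [hW.mem_nhds hz] with w hw using ih w hw
    ext1 v
    change (-1 : ℂ) ^ (q + 1) • sigma h (q + 1) i z (dbar (uComponent h φ q i) z v +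
      (-1 : ℂ) ^ (q + 1) • sigma h q i z (dbar (dbarSigmaPow h φ i q) z v)) =
      uSign (q + 1) • sigma h (q + 1) i z (0 - dbar (solve (r := fun k => E.rank k i)
        (fun k => sigma h k i) (lineSource (fun k => E.rank k i) φ) q) z v)
    rw [h1, map_add, map_smul, hσσ q z hz, smul_zero, add_zero, zero_sub, map_neg,
      ContinuousAlternatingMap.smul_apply, map_smul, smul_smul, uSign, smul_neg, ← neg_smul]
    congr 1
    ring

end BundleComplex

end Solve

/-! ### Minimal inverses through adjoints and Laplacians -/

section MinimalInverse

variable {r s t : ℕ}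

theorem star_mulVec_dotProduct (A : Matrix (Fin s) (Fin r) ℂ) (x : Cn r) (y : Cn s) :
    star (A *ᵥ x) ⬝ᵥ y = star x ⬝ᵥ Aᴴ *ᵥ y := by
  rw [star_mulVec, dotProduct_mulVec]

/-- The adjoint of `A` with respect to the Gram matrices `K` of the source and `H` of the target. -/
def gramAdjoint (A : Matrix (Fin s) (Fin r) ℂ) (K : Matrix (Fin r) (Fin r) ℂ)
    (H : Matrix (Fin s) (Fin s) ℂ) : Matrix (Fin r) (Fin s) ℂ :=
  K⁻¹ * Aᴴ * H

variable {A : Matrix (Fin s) (Fin r) ℂ} {B : Matrix (Fin t) (Fin s) ℂ}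
  {K : Matrix (Fin r) (Fin r) ℂ} {H : Matrix (Fin s) (Fin s) ℂ} {L : Matrix (Fin t) (Fin t) ℂ}

theorem mul_gramAdjoint (hK : K.PosDef) : K * gramAdjoint A K H = Aᴴ * H := by
  rw [gramAdjoint, Matrix.mul_assoc K⁻¹, Matrix.mul_nonsing_inv_cancel_left _ _
    ((Matrix.isUnit_iff_isUnit_det _).1 hK.isUnit)]

theorem star_dotProduct_gramAdjoint (hK : K.PosDef) (x : Cn r) (y : Cn s) :
    star x ⬝ᵥ K *ᵥ (gramAdjoint A K H *ᵥ y) = star (A *ᵥ x) ⬝ᵥ H *ᵥ y := by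
  rw [mulVec_mulVec, mul_gramAdjoint hK, star_mulVec_dotProduct, mulVec_mulVec]

theorem star_dotProduct_symm (hK : K.PosDef) (x y : Cn r) :
    star x ⬝ᵥ K *ᵥ y = star (star y ⬝ᵥ K *ᵥ x) := by
  rw [← star_dotProduct_star, star_star, star_mulVec, hK.isHermitian.eq,
    dotProduct_mulVec]

/-- The Laplacian of the complex `A`, `B` at its middle term, for the given Gram matrices. -/
def gramLaplacian (A : Matrix (Fin s) (Fin r) ℂ) (B : Matrix (Fin t) (Fin s) ℂ)
    (K : Matrix (Fin r) (Fin r) ℂ) (H : Matrix (Fin s) (Fin s) ℂ) (L : Matrix (Fin t) (Fin t) ℂ) :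
    Matrix (Fin s) (Fin s) ℂ :=
  A * gramAdjoint A K H + gramAdjoint B H L * B

/-- If Δy = 0, pairing with y gives |A*y|² + |By|² = 0. Exactness turns By = 0 into y = Ax, and then
|y|² = ⟨x, A*y⟩ = 0. -/
theorem det_gramLaplacian_ne_zero (hK : K.PosDef) (hH : H.PosDef) (hL : L.PosDef)
    (hex : ∀ y, B *ᵥ y = 0 → ∃ x, A *ᵥ x = y) : (gramLaplacian A B K H L).det ≠ 0 := by
  intro h0
  obtain ⟨y, hy0, hy⟩ := Matrix.exists_mulVec_eq_zero_iff.2 h0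
  have h1 : star (gramAdjoint A K H *ᵥ y) ⬝ᵥ K *ᵥ (gramAdjoint A K H *ᵥ y) +
      star (B *ᵥ y) ⬝ᵥ L *ᵥ (B *ᵥ y) = 0 := by
    have h2 : star y ⬝ᵥ H *ᵥ (gramLaplacian A B K H L *ᵥ y) = 0 := by
      rw [hy, mulVec_zero, dotProduct_zero]
    rw [gramLaplacian, add_mulVec, mulVec_add, dotProduct_add, ← mulVec_mulVec, ← mulVec_mulVec,
      star_dotProduct_gramAdjoint hH, star_dotProduct_symm hH,
      ← star_dotProduct_gramAdjoint hK, ← star_dotProduct_symm hK] at h2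
    exact h2
  have h3 := (add_eq_zero_iff_of_nonneg (hK.posSemidef.dotProduct_mulVec_nonneg _)
    (hL.posSemidef.dotProduct_mulVec_nonneg _)).1 h1
  have h4 : gramAdjoint A K H *ᵥ y = 0 := by
    by_contra h
    exact (hK.dotProduct_mulVec_pos h).ne' h3.1
  have h5 : B *ᵥ y = 0 := by
    by_contra h
    exact (hL.dotProduct_mulVec_pos h).ne' h3.2
  obtain ⟨x, rfl⟩ := hex y h5
  apply hy0
  by_contra h
  refine (hH.dotProduct_mulVec_pos h).ne' ?_
  rw [← star_dotProduct_gramAdjoint hK, h4, mulVec_zero, dotProduct_zero]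

/-- The Hodge decomposition, which has no harmonic part because the complex is exact here. -/
theorem mulVec_gramLaplacian_inv (hK : K.PosDef) (hH : H.PosDef) (hL : L.PosDef)
    (hex : ∀ y, B *ᵥ y = 0 → ∃ x, A *ᵥ x = y) (y : Cn s) :
    y = A *ᵥ (gramAdjoint A K H *ᵥ ((gramLaplacian A B K H L)⁻¹ *ᵥ y)) +
      gramAdjoint B H L *ᵥ (B *ᵥ ((gramLaplacian A B K H L)⁻¹ *ᵥ y)) := by
  have h := Matrix.mul_nonsing_inv _ (isUnit_iff_ne_zero.2
    (det_gramLaplacian_ne_zero hK hH hL hex))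
  conv_lhs => rw [← one_mulVec y, ← h, ← mulVec_mulVec]
  rw [gramLaplacian, add_mulVec, ← mulVec_mulVec, ← mulVec_mulVec]

/-- In y = AA*w + B*Bw with w = Δ⁻¹y, the second summand is orthogonal to im A and is killed by σ.
The vector A*w is orthogonal to ker A, hence the unique minimal solution for the first summand. -/
theorem IsMinimalInverse.eq_gramAdjoint_mul {σ : Cn s →ₗ[ℂ] Cn r}
    (hσ : IsMinimalInverse A K H σ) (hK : K.PosDef) (hH : H.PosDef) (hL : L.PosDef)
    (hBA : B * A = 0) (hex : ∀ y, B *ᵥ y = 0 → ∃ x, A *ᵥ x = y) :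
    σ = (gramAdjoint A K H * (gramLaplacian A B K H L)⁻¹).mulVecLin := by
  refine LinearMap.ext fun y => ?_
  set w := (gramLaplacian A B K H L)⁻¹ *ᵥ y with hw
  have hy : y = A *ᵥ (gramAdjoint A K H *ᵥ w) + gramAdjoint B H L *ᵥ (B *ᵥ w) :=
    mulVec_gramLaplacian_inv hK hH hL hex y
  set x := gramAdjoint A K H *ᵥ w with hx
  have h2 : σ (gramAdjoint B H L *ᵥ (B *ᵥ w)) = 0 := hσ.2 _ fun η => by
    rw [star_dotProduct_gramAdjoint hH, mulVec_mulVec, hBA, zero_mulVec, star_zero, zero_dotProduct]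
  obtain ⟨h3, h4⟩ := hσ.1 (A *ᵥ x) ⟨x, rfl⟩
  have h5 := h4 x rfl
  set ζ := σ (A *ᵥ x) - x with hζ
  have h6 : A *ᵥ ζ = 0 := by rw [hζ, mulVec_sub, h3, sub_self]
  have h7 : star ζ ⬝ᵥ K *ᵥ x = 0 := by
    rw [hx, star_dotProduct_gramAdjoint hK, h6, star_zero, zero_dotProduct]
  have h8 : σ (A *ᵥ x) = x + ζ := by rw [hζ]; abel
  have h9 : star x ⬝ᵥ K *ᵥ ζ = 0 := by rw [star_dotProduct_symm hK, h7, star_zero]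
  rw [h8, star_add, mulVec_add, dotProduct_add, add_dotProduct, add_dotProduct, h7, h9] at h5
  -- By orthogonality, minimality now reads |x|² + |ζ|² ≤ |x|².
  have h10 : ζ = 0 := by
    by_contra h
    have := (Complex.lt_def.1 (hK.dotProduct_mulVec_pos h)).1
    simp only [Complex.zero_re, Complex.add_re] at this h5
    linarith
  rw [mulVecLin_apply, ← mulVec_mulVec, ← hw, ← hx, hy, map_add, h2, h8, h10, add_zero, add_zero]

theorem minimalInverse_spec (A : Matrix (Fin s) (Fin r) ℂ) (hK : K.PosDef) (hH : H.PosDef) :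
    IsMinimalInverse A K H (minimalInverse A K H) := by
  have h := exists_isMinimalInverse A hK hH
  rw [minimalInverse, dif_pos h]
  exact h.choose_spec

theorem minimalInverse_eq (hK : K.PosDef) (hH : H.PosDef) (hL : L.PosDef)
    (hBA : B * A = 0) (hex : ∀ y, B *ᵥ y = 0 → ∃ x, A *ᵥ x = y) :
    minimalInverse A K H = (gramAdjoint A K H * (gramLaplacian A B K H L)⁻¹).mulVecLin :=
  (minimalInverse_spec A hK hH).eq_gramAdjoint_mul hK hH hL hBA hex

/-- Consecutive minimal inverses compose to zero: the image of the minimal inverse of `A` is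
orthogonal to the kernel of `A`. -/
theorem minimalInverse_minimalInverse {m : ℕ} {M : Matrix (Fin m) (Fin m) ℂ}
    {C : Matrix (Fin r) (Fin m) ℂ} (hM : M.PosDef) (hK : K.PosDef) (hH : H.PosDef) (hL : L.PosDef)
    (hBA : B * A = 0) (hAC : A * C = 0) (hex : ∀ y, B *ᵥ y = 0 → ∃ x, A *ᵥ x = y) (y : Cn s) :
    minimalInverse C M K (minimalInverse A K H y) = 0 := by
  refine (minimalInverse_spec C hM hK).2 _ fun η => ?_
  rw [minimalInverse_eq hK hH hL hBA hex, mulVecLin_apply, ← mulVec_mulVec,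
    star_dotProduct_gramAdjoint hK, mulVec_mulVec, hAC, zero_mulVec, star_zero, zero_dotProduct]

/-- Isometric maps of complexes intertwine the minimal inverses: here `T` is assumed to be
compatible with the differentials and with the adjoints of the differentials. -/
theorem minimalInverse_intertwine {r' s' t' : ℕ} {A' : Matrix (Fin s') (Fin r') ℂ}
    {B' : Matrix (Fin t') (Fin s') ℂ}
    {K' : Matrix (Fin r') (Fin r') ℂ} {H' : Matrix (Fin s') (Fin s') ℂ}
    {L' : Matrix (Fin t') (Fin t') ℂ}
    (hK : K.PosDef) (hH : H.PosDef) (hL : L.PosDef)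
    (hBA : B * A = 0) (hex : ∀ y, B *ᵥ y = 0 → ∃ x, A *ᵥ x = y)
    (hK' : K'.PosDef) (hH' : H'.PosDef) (hL' : L'.PosDef)
    (hBA' : B' * A' = 0) (hex' : ∀ y, B' *ᵥ y = 0 → ∃ x, A' *ᵥ x = y)
    {T₂ : Matrix (Fin r') (Fin r) ℂ} {T₁ : Matrix (Fin s') (Fin s) ℂ}
    {T₀ : Matrix (Fin t') (Fin t) ℂ}
    (hA : A' * T₂ = T₁ * A) (hB : B' * T₁ = T₀ * B)
    (hA' : gramAdjoint A' K' H' * T₁ = T₂ * gramAdjoint A K H)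
    (hB' : gramAdjoint B' H' L' * T₀ = T₁ * gramAdjoint B H L) (y : Cn s) :
    T₂ *ᵥ minimalInverse A K H y = minimalInverse A' K' H' (T₁ *ᵥ y) := by
  -- T commutes with all four factors of the Laplacians, hence with their inverses, and so with
  -- A*Δ⁻¹.
  have h1 : gramLaplacian A' B' K' H' L' * T₁ = T₁ * gramLaplacian A B K H L := by
    rw [gramLaplacian, gramLaplacian, Matrix.add_mul, Matrix.mul_add, Matrix.mul_assoc, hA',
      Matrix.mul_assoc, hB, ← Matrix.mul_assoc, ← Matrix.mul_assoc, hA, hB', Matrix.mul_assoc,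
      Matrix.mul_assoc]
  have h2 := isUnit_iff_ne_zero.2 (det_gramLaplacian_ne_zero hK hH hL hex)
  have h3 := isUnit_iff_ne_zero.2 (det_gramLaplacian_ne_zero hK' hH' hL' hex')
  have h4 : T₁ * (gramLaplacian A B K H L)⁻¹ = (gramLaplacian A' B' K' H' L')⁻¹ * T₁ := by
    rw [← Matrix.nonsing_inv_mul_cancel_left _ (T₁ * (gramLaplacian A B K H L)⁻¹) h3,
      ← Matrix.mul_assoc _ T₁, h1, Matrix.mul_assoc T₁, Matrix.mul_nonsing_inv _ h2,
      Matrix.mul_one]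
  rw [minimalInverse_eq hK hH hL hBA hex, minimalInverse_eq hK' hH' hL' hBA' hex',
    mulVecLin_apply, mulVecLin_apply, mulVec_mulVec, mulVec_mulVec, ← Matrix.mul_assoc, ← hA',
    Matrix.mul_assoc, h4, Matrix.mul_assoc]

/-- A criterion for compatibility with the adjoints: `T` has the adjoint `T'`, which is compatible
with the differentials. -/
theorem gramAdjoint_intertwine {r' s' : ℕ} {A' : Matrix (Fin s') (Fin r') ℂ}
    {K' : Matrix (Fin r') (Fin r') ℂ} {H' : Matrix (Fin s') (Fin s') ℂ}
    (hK : K.PosDef) (hK' : K'.PosDef)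
    {T₂ : Matrix (Fin r') (Fin r) ℂ} {T₁ : Matrix (Fin s') (Fin s) ℂ}
    {T₂' : Matrix (Fin r) (Fin r') ℂ} {T₁' : Matrix (Fin s) (Fin s') ℂ}
    (hA : A * T₂' = T₁' * A') (h1 : H' * T₁ = T₁'ᴴ * H) (h2 : K' * T₂ = T₂'ᴴ * K) :
    gramAdjoint A' K' H' * T₁ = T₂ * gramAdjoint A K H := by
  have hu := (Matrix.isUnit_iff_isUnit_det _).1 hK'.isUnit
  have h3 : K' * (gramAdjoint A' K' H' * T₁) = K' * (T₂ * gramAdjoint A K H) := by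
    rw [← Matrix.mul_assoc, mul_gramAdjoint hK', Matrix.mul_assoc, h1, ← Matrix.mul_assoc,
      ← Matrix.mul_assoc, ← conjTranspose_mul, ← hA, h2, Matrix.mul_assoc _ K,
      mul_gramAdjoint hK, conjTranspose_mul, Matrix.mul_assoc]
  rw [← Matrix.nonsing_inv_mul_cancel_left _ (gramAdjoint A' K' H' * T₁) hu, h3,
    Matrix.nonsing_inv_mul_cancel_left _ _ hu]

/-- A generalized inverse exists for every matrix. -/
theorem exists_generalizedInverse (A : Matrix (Fin s) (Fin r) ℂ) :
    ∃ C : Matrix (Fin r) (Fin s) ℂ, A * C * A = A ∧ C * A * C = C := by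
  obtain ⟨σ, hσ, -⟩ := exists_isMinimalInverse A Matrix.PosDef.one Matrix.PosDef.one
  set C := LinearMap.toMatrix' σ
  have h1 : A * C * A = A := by
    refine Matrix.ext_of_mulVec_single fun i => ?_
    rw [← mulVec_mulVec, ← mulVec_mulVec, LinearMap.toMatrix'_mulVec]
    exact (hσ _ ⟨_, rfl⟩).1
  -- The minimal inverse gives ACA = A; passing from C to CAC keeps this and adds the second
  -- identity.
  refine ⟨C * A * C, ?_, ?_⟩
  · rw [← Matrix.mul_assoc, ← Matrix.mul_assoc, h1, h1]
  · have h2 : C * A * C * A * (C * A * C) = C * (A * C * A) * C * A * C := by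
      simp only [Matrix.mul_assoc]
    rw [h2, h1, Matrix.mul_assoc C A C, Matrix.mul_assoc C (A * C) A, h1, Matrix.mul_assoc]

end MinimalInverse

/-! ### Matrices with holomorphic or smooth entries -/

section FunctionAlgebras

variable {n r s t : ℕ}

/-- A field of matrices with entries in the algebra `R` of functions. -/
def EntriesIn (R : Subalgebra ℂ (Cn n → ℂ)) (M : Cn n → Matrix (Fin s) (Fin r) ℂ) : Prop :=
  ∀ a b, (fun z => M z a b) ∈ R

variable {R : Subalgebra ℂ (Cn n → ℂ)}

theorem EntriesIn.mul {M : Cn n → Matrix (Fin s) (Fin r) ℂ} {N : Cn n → Matrix (Fin r) (Fin t) ℂ}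
    (hM : EntriesIn R M) (hN : EntriesIn R N) : EntriesIn R fun z => M z * N z := fun a b => by
  have : (fun z => (M z * N z) a b) = ∑ c, (fun z => M z a c) * fun z => N z c b := by
    ext z; simp [Matrix.mul_apply]
  rw [this]
  exact sum_mem fun c _ => mul_mem (hM a c) (hN c b)

theorem EntriesIn.add {M N : Cn n → Matrix (Fin s) (Fin r) ℂ}
    (hM : EntriesIn R M) (hN : EntriesIn R N) : EntriesIn R fun z => M z + N z := fun a b =>
  add_mem (hM a b) (hN a b)

theorem EntriesIn.sub {M N : Cn n → Matrix (Fin s) (Fin r) ℂ}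
    (hM : EntriesIn R M) (hN : EntriesIn R N) : EntriesIn R fun z => M z - N z := fun a b =>
  sub_mem (hM a b) (hN a b)

theorem EntriesIn.const (M : Matrix (Fin s) (Fin r) ℂ) :
    EntriesIn R fun _ : Cn n => M := fun a b => R.algebraMap_mem (M a b)

theorem EntriesIn.det {M : Cn n → Matrix (Fin s) (Fin s) ℂ} (hM : EntriesIn R M) :
    (fun z => (M z).det) ∈ R := by
  have : (fun z => (M z).det) = ∑ σ : Equiv.Perm (Fin s),
      ((Equiv.Perm.sign σ : ℤ) • ∏ i, fun z => M z (σ i) i) := by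
    ext z; simp [Matrix.det_apply, Units.smul_def]
  rw [this]
  exact sum_mem fun σ _ => zsmul_mem (prod_mem fun i _ => hM _ _) _

/-- Cramer's rule. Invertibility of the determinant inside `R` is a hypothesis so that the
holomorphic and the smooth case share one proof. -/
theorem EntriesIn.inv {M : Cn n → Matrix (Fin s) (Fin s) ℂ} (hM : EntriesIn R M)
    (hdet : (fun z => ((M z).det)⁻¹) ∈ R) : EntriesIn R fun z => (M z)⁻¹ := fun a b => by
  have : (fun z => (M z)⁻¹ a b) = (fun z => ((M z).det)⁻¹) *
      fun z => ((M z).updateRow b (Pi.single a 1)).det := by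
    ext z
    simp [Matrix.inv_def, Matrix.adjugate_apply]
  rw [this]
  refine mul_mem hdet (EntriesIn.det fun c d => ?_)
  by_cases hc : c = b
  · subst hc
    simp only [Matrix.updateRow_self]
    exact R.algebraMap_mem _
  · simp only [Matrix.updateRow_ne hc]
    exact hM c d

/-- The functions that are holomorphic at `z`. -/
def holAlg (z : Cn n) : Subalgebra ℂ (Cn n → ℂ) where
  carrier := {φ | AnalyticAt ℂ φ z}
  mul_mem' := fun h h' => AnalyticAt.mul h h'
  add_mem' := fun h h' => AnalyticAt.add h h'
  algebraMap_mem' := fun _ => analyticAt_const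

/-- The functions that are smooth at `z`. -/
def smoothAlg (z : Cn n) : Subalgebra ℂ (Cn n → ℂ) where
  carrier := {φ | ContDiffAt ℝ ∞ φ z}
  mul_mem' := fun {f g} (h : ContDiffAt ℝ ∞ f z) (h' : ContDiffAt ℝ ∞ g z) => h.mul h'
  add_mem' := fun {f g} (h : ContDiffAt ℝ ∞ f z) (h' : ContDiffAt ℝ ∞ g z) => h.add h'
  algebraMap_mem' := fun c => (contDiffAt_const : ContDiffAt ℝ ∞ (fun _ => c) z)

theorem mem_smoothAlg {φ : Cn n → ℂ} {z : Cn n} : φ ∈ smoothAlg z ↔ ContDiffAt ℝ ∞ φ z := Iff.rfl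

theorem holAlg_le_smoothAlg (z : Cn n) : holAlg z ≤ smoothAlg z := fun _ h =>
  mem_smoothAlg.2 (AnalyticAt.restrictScalars (𝕜 := ℝ) h).contDiffAt

theorem EntriesIn.mono {R' : Subalgebra ℂ (Cn n → ℂ)} (h : R ≤ R')
    {M : Cn n → Matrix (Fin s) (Fin r) ℂ} (hM : EntriesIn R M) : EntriesIn R' M :=
  fun a b => h (hM a b)

theorem EntriesIn.inv_hol {z : Cn n} {M : Cn n → Matrix (Fin s) (Fin s) ℂ}
    (hM : EntriesIn (holAlg z) M) (h : (M z).det ≠ 0) :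
    EntriesIn (holAlg z) fun w => (M w)⁻¹ :=
  hM.inv (AnalyticAt.inv hM.det h)

theorem EntriesIn.inv_smooth {z : Cn n} {M : Cn n → Matrix (Fin s) (Fin s) ℂ}
    (hM : EntriesIn (smoothAlg z) M) (h : (M z).det ≠ 0) :
    EntriesIn (smoothAlg z) fun w => (M w)⁻¹ :=
  hM.inv (mem_smoothAlg.2 ((mem_smoothAlg.1 hM.det).inv h))

theorem EntriesIn.conjTranspose {z : Cn n} {M : Cn n → Matrix (Fin s) (Fin r) ℂ}
    (hM : EntriesIn (smoothAlg z) M) : EntriesIn (smoothAlg z) fun w => (M w)ᴴ := fun a b =>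
  mem_smoothAlg.2 (Complex.conjCLE.contDiff.comp_contDiffAt z (mem_smoothAlg.1 (hM b a)))

theorem EntriesIn.gramAdjoint {z : Cn n} {A : Cn n → Matrix (Fin s) (Fin r) ℂ}
    {K : Cn n → Matrix (Fin r) (Fin r) ℂ} {H : Cn n → Matrix (Fin s) (Fin s) ℂ}
    (hA : EntriesIn (smoothAlg z) A) (hK : EntriesIn (smoothAlg z) K)
    (hH : EntriesIn (smoothAlg z) H) (hK' : (K z).PosDef) :
    EntriesIn (smoothAlg z) fun w => gramAdjoint (A w) (K w) (H w) :=
  ((hK.inv_smooth ((Matrix.isUnit_iff_isUnit_det _).1 hK'.isUnit).ne_zero).mul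
    hA.conjTranspose).mul hH

theorem EntriesIn.gramLaplacian {z : Cn n} {A : Cn n → Matrix (Fin s) (Fin r) ℂ}
    {B : Cn n → Matrix (Fin t) (Fin s) ℂ}
    {K : Cn n → Matrix (Fin r) (Fin r) ℂ} {H : Cn n → Matrix (Fin s) (Fin s) ℂ}
    {L : Cn n → Matrix (Fin t) (Fin t) ℂ}
    (hA : EntriesIn (smoothAlg z) A) (hB : EntriesIn (smoothAlg z) B)
    (hK : EntriesIn (smoothAlg z) K)
    (hH : EntriesIn (smoothAlg z) H) (hL : EntriesIn (smoothAlg z) L) (hK' : (K z).PosDef)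
    (hH' : (H z).PosDef) :
    EntriesIn (smoothAlg z) fun w => gramLaplacian (A w) (B w) (K w) (H w) (L w) :=
  (hA.mul (hA.gramAdjoint hK hH hK')).add ((hB.gramAdjoint hH hL hH').mul hB)

/-- The formula A*Δ⁻¹ holds on a whole neighbourhood and is smooth where Δ is invertible. `B` enters
only through Δ. -/
theorem contDiffAt_minimalInverse {z : Cn n} {A : Cn n → Matrix (Fin s) (Fin r) ℂ}
    {B : Cn n → Matrix (Fin t) (Fin s) ℂ}
    {K : Cn n → Matrix (Fin r) (Fin r) ℂ} {H : Cn n → Matrix (Fin s) (Fin s) ℂ}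
    {L : Cn n → Matrix (Fin t) (Fin t) ℂ}
    (hA : EntriesIn (smoothAlg z) A) (hB : EntriesIn (smoothAlg z) B)
    (hK : EntriesIn (smoothAlg z) K) (hH : EntriesIn (smoothAlg z) H)
    (hL : EntriesIn (smoothAlg z) L)
    (h : ∀ᶠ w in 𝓝 z, (K w).PosDef ∧ (H w).PosDef ∧ (L w).PosDef ∧ B w * A w = 0 ∧
      ∀ y, B w *ᵥ y = 0 → ∃ x, A w *ᵥ x = y) :
    ContDiffAt ℝ ∞ (toCLM fun w => minimalInverse (A w) (K w) (H w)) z := by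
  obtain ⟨hK', hH', hL', -, hex⟩ := h.self_of_nhds
  have h1 := (hA.gramAdjoint hK hH hK').mul ((hA.gramLaplacian hB hK hH hL hK' hH').inv_smooth
    (det_gramLaplacian_ne_zero hK' hH' hL' hex))
  refine (contDiffAt_toCLM_mulVecLin h1).congr_of_eventuallyEq ?_
  filter_upwards [h] with w ⟨a1, a2, a3, a4, a5⟩
  rw [toCLM, toCLM, minimalInverse_eq a1 a2 a3 a4 a5]

end FunctionAlgebras

/-- Dependent choice: `Q` is the invariant that allows the next lift, `R` the equation the lift
solves. It produces contracting homotopies, comparison maps and chain homotopies. -/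
theorem exists_dependent_seq {α : ℕ → Type} (Q : ∀ k, α k → Prop)
    (R : ∀ k, α k → α (k + 1) → Prop) {a₀ : α 0} (h0 : Q 0 a₀)
    (step : ∀ k a, Q k a → ∃ b, Q (k + 1) b ∧ R k a b) :
    ∃ a : ∀ k, α k, a 0 = a₀ ∧ (∀ k, Q k (a k)) ∧ ∀ k, R k (a k) (a (k + 1)) := by
  choose g hg using step
  let a : ∀ k, {x : α k // Q k x} := fun k =>
    Nat.rec ⟨a₀, h0⟩ (fun k x => ⟨g k x x.2, (hg k x x.2).1⟩) k
  exact ⟨fun k => (a k).1, rfl, fun k => (a k).2, fun k => (hg k _ (a k).2).2⟩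

/-! ### Fibrewise exactness off the zero locus and regularity of σ -/

namespace BundleComplex

variable {n : ℕ} {X Y : Set (Cn n)} {E : BundleComplex X}
  {J : ∀ x : Cn n, Ideal (HolGerm x)} {z : Cn n} {i : E.ι}

instance subsingleton_rank_zero (E : BundleComplex X) (i : E.ι) :
    Subsingleton (Fin (E.rank 0 i)) := by
  rw [E.rank_zero i]; infer_instance

theorem entriesIn_f (k : ℕ) (hz : z ∈ E.U i) : EntriesIn (holAlg z) (E.f k i) :=
  fun a b => E.f_hol k i a b z hz

theorem eventually_mem_U (hz : z ∈ E.U i) : ∀ᶠ w in 𝓝 z, w ∈ E.U i :=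
  (E.isOpen_U i).mem_nhds hz

/-- Matrices of holomorphic functions with columns in the kernel of `f k` lift along `f (k+1)`. -/
theorem IsResolution.exists_lift (hE : E.IsResolution J) (hz : z ∈ E.U i) {k m : ℕ}
    {M : Cn n → Matrix (Fin (E.rank (k + 1) i)) (Fin m) ℂ} (hM : EntriesIn (holAlg z) M)
    (h : ∀ᶠ w in 𝓝 z, E.f k i w * M w = 0) :
    ∃ N : Cn n → Matrix (Fin (E.rank (k + 2) i)) (Fin m) ℂ, EntriesIn (holAlg z) N ∧
      ∀ᶠ w in 𝓝 z, E.f (k + 1) i w * N w = M w := by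
  have h1 : ∀ b : Fin m, ∃ t : Cn n → Cn (E.rank (k + 2) i), AnalyticAt ℂ t z ∧
      ∀ᶠ w in 𝓝 z, E.f (k + 1) i w *ᵥ t w = fun a => M w a b := fun b => by
    refine hE.exact k i z hz (fun w a => M w a b) (analyticAt_pi_iff.2 fun a => hM a b) ?_
    filter_upwards [h] with w hw
    ext a
    exact congrFun (congrFun hw a) b
  choose t ht htM using h1
  refine ⟨fun w a b => t b w a, fun a b => analyticAt_pi_iff.1 (ht b) a, ?_⟩
  filter_upwards [eventually_all.2 htM] with w hw
  ext a b
  exact congrFun (hw b) a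

/-- The bottom case of lifting, where membership of the entries in J replaces exactness. -/
theorem IsResolution.exists_lift_zero (hE : E.IsResolution J) (hz : z ∈ E.U i) {m : ℕ}
    {M : Cn n → Matrix (Fin (E.rank 0 i)) (Fin m) ℂ} (hM : EntriesIn (holAlg z) M)
    (h : ∀ a b, HolGerm.of _ (hM a b) ∈ J z) :
    ∃ N : Cn n → Matrix (Fin (E.rank 1 i)) (Fin m) ℂ, EntriesIn (holAlg z) N ∧
      ∀ᶠ w in 𝓝 z, E.f 0 i w * N w = M w := by
  have a₀ : Fin (E.rank 0 i) := ⟨0, by rw [E.rank_zero]; exact one_pos⟩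
  have h1 : ∀ b : Fin m, ∃ t : Cn n → Cn (E.rank 1 i), AnalyticAt ℂ t z ∧
      ∀ᶠ w in 𝓝 z, ∀ a, (E.f 0 i w *ᵥ t w) a = M w a₀ b := fun b =>
    (hE.mem_iff i z hz _ (hM a₀ b)).1 (h a₀ b)
  choose t ht htM using h1
  refine ⟨fun w a b => t b w a, fun a b => analyticAt_pi_iff.1 (ht b) a, ?_⟩
  filter_upwards [eventually_all.2 htM] with w hw
  ext a b
  rw [Subsingleton.elim a a₀]
  exact hw b a₀

theorem IsResolution.f_zero_mem (hE : E.IsResolution J) (hz : z ∈ E.U i) (a b) :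
    HolGerm.of _ (entriesIn_f (E := E) 0 hz a b) ∈ J z := by
  refine (hE.mem_iff i z hz _ _).2 ⟨fun _ => Pi.single b 1, analyticAt_const, ?_⟩
  refine Eventually.of_forall fun w a' => ?_
  rw [Subsingleton.elim a' a, mulVec_single_one]
  rfl

/-- Outside the zero locus the complex of vector spaces is exact, also at `E_0`. -/
theorem IsResolution.exact_at (hE : E.IsResolution J) (hz : z ∈ E.U i) (hzJ : z ∉ zeroLocus J) :
    (∀ y, ∃ x, E.f 0 i z *ᵥ x = y) ∧
      ∀ k y, E.f k i z *ᵥ y = 0 → ∃ x, E.f (k + 1) i z *ᵥ x = y := by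
  simp only [zeroLocus, Set.mem_ofPred_eq, not_forall] at hzJ
  obtain ⟨⟨g, φ, hφ, rfl⟩, hg, hg0⟩ := hzJ
  have hφ0 : φ z ≠ 0 := hg0
  obtain ⟨t, ht, htφ⟩ := (hE.mem_iff i z hz φ hφ).1 hg
  -- A germ φ in J with φ(z) ≠ 0 is a unit, so dividing a lift of it by φ splits `f 0` near z.
  let s₀ : Cn n → Matrix (Fin (E.rank 1 i)) (Fin (E.rank 0 i)) ℂ := fun w a _ => (φ w)⁻¹ * t w a
  have hs₀ : EntriesIn (holAlg z) s₀ := fun a _ => (hφ.inv hφ0).mul (analyticAt_pi_iff.1 ht a)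
  have hfs₀ : ∀ᶠ w in 𝓝 z, E.f 0 i w * s₀ w = 1 := by
    filter_upwards [htφ, hφ.continuousAt.eventually_ne hφ0] with w h1 h2
    ext a b
    rw [Subsingleton.elim b a, Matrix.one_apply_eq]
    have : (E.f 0 i w * s₀ w) a a = (φ w)⁻¹ * (E.f 0 i w *ᵥ t w) a := by
      change ∑ c, E.f 0 i w a c * ((φ w)⁻¹ * t w c) = (φ w)⁻¹ * ∑ c, E.f 0 i w a c * t w c
      rw [Finset.mul_sum]
      exact Finset.sum_congr rfl fun _ _ => by ring
    rw [this, h1, inv_mul_cancel₀ h2]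
  -- Exactness on stalks does not directly concern a vector in the fibre at z. A holomorphic
  -- contraction with f_{k+1}s_{k+1} = 1 - s_k f_k can, however, be evaluated at z. The invariant f
  -- s f = f makes the columns of 1 - s f liftable.
  obtain ⟨s, hs0, hs1, hs2⟩ := exists_dependent_seq
    (α := fun k => Cn n → Matrix (Fin (E.rank (k + 1) i)) (Fin (E.rank k i)) ℂ)
    (fun k s => EntriesIn (holAlg z) s ∧ ∀ᶠ w in 𝓝 z, E.f k i w * s w * E.f k i w = E.f k i w)
    (fun k s s' => ∀ᶠ w in 𝓝 z, E.f (k + 1) i w * s' w = 1 - s w * E.f k i w)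
    (a₀ := s₀) ⟨hs₀, by filter_upwards [hfs₀] with w hw; rw [hw, Matrix.one_mul]⟩
    (fun k s ⟨h1, h2⟩ => by
      obtain ⟨N, hN, hfN⟩ := hE.exists_lift hz
        ((EntriesIn.const (R := holAlg z) 1).sub (h1.mul (entriesIn_f k hz))) (by
          filter_upwards [h2] with w hw
          rw [Matrix.mul_sub, Matrix.mul_one, ← Matrix.mul_assoc, hw, sub_self])
      refine ⟨N, ⟨hN, ?_⟩, hfN⟩
      filter_upwards [hfN, eventually_mem_U hz] with w hw hwU
      rw [hw, Matrix.sub_mul, Matrix.one_mul, Matrix.mul_assoc, E.f_comp_f k i w hwU,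
        Matrix.mul_zero, sub_zero])
  refine ⟨fun y => ⟨s 0 z *ᵥ y, ?_⟩, fun k y hy => ⟨s (k + 1) z *ᵥ y, ?_⟩⟩
  · rw [mulVec_mulVec, hs0, hfs₀.self_of_nhds, one_mulVec]
  · rw [mulVec_mulVec, (hs2 k).self_of_nhds, sub_mulVec, one_mulVec, ← mulVec_mulVec, hy,
      mulVec_zero, sub_zero]

/-- The rank of `E_{k-1}`, and zero for `k = 0`. -/
def prevRank (E : BundleComplex X) : ℕ → E.ι → ℕ
  | 0, _ => 0
  | k + 1, i => E.rank k i

/-- The differential out of `E_k`, which is zero for `k = 0`. -/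
def prevF (E : BundleComplex X) :
    ∀ (k : ℕ) (i : E.ι), Cn n → Matrix (Fin (E.prevRank k i)) (Fin (E.rank k i)) ℂ
  | 0, _ => fun _ => 0
  | k + 1, i => E.f k i

/-- The metric on `E_{k-1}`. -/
def HermitianMetric.prevH (h : E.HermitianMetric Y) :
    ∀ (k : ℕ) (i : E.ι), Cn n → Matrix (Fin (E.prevRank k i)) (Fin (E.prevRank k i)) ℂ
  | 0, _ => fun _ => 1
  | k + 1, i => h.H k i

theorem HermitianMetric.prevH_posDef (h : E.HermitianMetric Y) (k : ℕ) (hz : z ∈ E.U i ∩ Y) :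
    (h.prevH k i z).PosDef := by
  cases k with
  | zero => exact Matrix.PosDef.one
  | succ k => exact h.posDef k i z hz

theorem prevF_mul_f (k : ℕ) (hz : z ∈ E.U i) : E.prevF k i z * E.f k i z = 0 := by
  cases k with
  | zero => exact Matrix.zero_mul _
  | succ k => exact E.f_comp_f k i z hz

theorem IsResolution.exact_prevF (hE : E.IsResolution J) (hz : z ∈ E.U i)
    (hzJ : z ∉ zeroLocus J) (k : ℕ) :
    ∀ y, E.prevF k i z *ᵥ y = 0 → ∃ x, E.f k i z *ᵥ x = y := by
  cases k with
  | zero => exact fun y _ => (hE.exact_at hz hzJ).1 y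
  | succ k => exact (hE.exact_at hz hzJ).2 k

theorem HermitianMetric.entriesIn_H (h : E.HermitianMetric Y) (hY : IsOpen Y) (k : ℕ)
    (hz : z ∈ E.U i ∩ Y) : EntriesIn (smoothAlg z) (h.H k i) := fun a b =>
  mem_smoothAlg.2 ((h.smooth k i a b).contDiffAt (((E.isOpen_U i).inter hY).mem_nhds hz))

theorem IsResolution.isOpen_inter_diff (hE : E.IsResolution J) (hY : IsOpen Y) (i : E.ι) :
    IsOpen ((E.U i ∩ Y) \ zeroLocus J) := by
  have h : (E.U i ∩ Y) \ zeroLocus J = (E.U i ∩ Y) ∩ (X \ zeroLocus J) := by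
    ext w
    refine ⟨fun hw => ⟨hw.1, ?_, hw.2⟩, fun hw => ⟨hw.1, hw.2.2⟩⟩
    rw [← E.iUnion_U]
    exact Set.mem_iUnion.2 ⟨i, hw.1.1⟩
  rw [h]
  exact ((E.isOpen_U i).inter hY).inter hE.isOpen_diff

theorem IsResolution.contDiffAt_sigma (hE : E.IsResolution J) (h : E.HermitianMetric Y)
    (hY : IsOpen Y) (k : ℕ) (hz : z ∈ (E.U i ∩ Y) \ zeroLocus J) :
    ContDiffAt ℝ ∞ (toCLM (sigma h k i)) z := by
  have hB : EntriesIn (smoothAlg z) (E.prevF k i) := by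
    cases k with
    | zero => exact EntriesIn.const _
    | succ k => exact (entriesIn_f k hz.1.1).mono (holAlg_le_smoothAlg z)
  have hL : EntriesIn (smoothAlg z) (h.prevH k i) := by
    cases k with
    | zero => exact EntriesIn.const _
    | succ k => exact h.entriesIn_H hY k hz.1
  refine contDiffAt_minimalInverse ((entriesIn_f k hz.1.1).mono (holAlg_le_smoothAlg z)) hB
    (h.entriesIn_H hY (k + 1) hz.1) (h.entriesIn_H hY k hz.1) hL ?_
  filter_upwards [(hE.isOpen_inter_diff hY i).mem_nhds hz] with w hw
  exact ⟨h.posDef _ _ _ hw.1, h.posDef _ _ _ hw.1, h.prevH_posDef k hw.1, prevF_mul_f k hw.1.1,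
    hE.exact_prevF hw.1.1 hw.2 k⟩

theorem IsResolution.sigma_sigma (hE : E.IsResolution J) (h : E.HermitianMetric Y)
    (k : ℕ) (hz : z ∈ (E.U i ∩ Y) \ zeroLocus J) (y : Cn (E.rank k i)) :
    sigma h (k + 1) i z (sigma h k i z y) = 0 :=
  minimalInverse_minimalInverse (h.posDef _ _ _ hz.1) (h.posDef _ _ _ hz.1) (h.posDef _ _ _ hz.1)
    (h.prevH_posDef k hz.1) (prevF_mul_f k hz.1.1) (E.f_comp_f k i z hz.1.1)
    (hE.exact_prevF hz.1.1 hz.2 k) y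

theorem f_mulVec_sigma (h : E.HermitianMetric Y) (k : ℕ) (hz : z ∈ E.U i ∩ Y)
    {y : Cn (E.rank k i)} (hy : ∃ x, E.f k i z *ᵥ x = y) :
    E.f k i z *ᵥ sigma h k i z y = y :=
  ((minimalInverse_spec _ (h.posDef _ _ _ hz) (h.posDef _ _ _ hz)).1 y hy).1

/-- Morphisms of complexes whose adjoints are also morphisms of complexes intertwine the minimal
inverses. -/
theorem IsResolution.sigma_intertwine {X' Y' : Set (Cn n)} {F : BundleComplex X'} {j : F.ι}
    {J' : ∀ x : Cn n, Ideal (HolGerm x)}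
    (hE : E.IsResolution J) (hF : F.IsResolution J') (h : E.HermitianMetric Y)
    (h' : F.HermitianMetric Y') (hz : z ∈ (E.U i ∩ Y) \ zeroLocus J)
    (hz' : z ∈ (F.U j ∩ Y') \ zeroLocus J')
    {T : ∀ k, Matrix (Fin (F.rank k j)) (Fin (E.rank k i)) ℂ}
    {T' : ∀ k, Matrix (Fin (E.rank k i)) (Fin (F.rank k j)) ℂ}
    (hT : ∀ k, F.f k j z * T (k + 1) = T k * E.f k i z)
    (hT' : ∀ k, E.f k i z * T' (k + 1) = T' k * F.f k j z)
    (hTT : ∀ k, h'.H k j z * T k = (T' k)ᴴ * h.H k i z) (k : ℕ) (y : Cn (E.rank k i)) :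
    T (k + 1) *ᵥ sigma h k i z y = sigma h' k j z (T k *ᵥ y) := by
  have hadj : ∀ k, gramAdjoint (F.f k j z) (h'.H (k + 1) j z) (h'.H k j z) * T k =
      T (k + 1) * gramAdjoint (E.f k i z) (h.H (k + 1) i z) (h.H k i z) := fun k =>
    gramAdjoint_intertwine (h.posDef _ _ _ hz.1) (h'.posDef _ _ _ hz'.1) (hT' k) (hTT k)
      (hTT (k + 1))
  -- The Laplacian on E_k also involves the map out of E_k. For k = 0 this map goes to the zero
  -- space and T₀ = 0 serves.
  have key : ∃ T₀ : Matrix (Fin (F.prevRank k j)) (Fin (E.prevRank k i)) ℂ,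
      F.prevF k j z * T k = T₀ * E.prevF k i z ∧
      gramAdjoint (F.prevF k j z) (h'.H k j z) (h'.prevH k j z) * T₀ =
        T k * gramAdjoint (E.prevF k i z) (h.H k i z) (h.prevH k i z) := by
    cases k with
    | zero => exact ⟨0, by simp [prevF], by simp [prevF, gramAdjoint]⟩
    | succ k => exact ⟨T k, hT k, hadj k⟩
  obtain ⟨T₀, h1, h2⟩ := key
  exact minimalInverse_intertwine (h.posDef _ _ _ hz.1) (h.posDef _ _ _ hz.1)
    (h.prevH_posDef k hz.1) (prevF_mul_f k hz.1.1) (hE.exact_prevF hz.1.1 hz.2 k)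
    (h'.posDef _ _ _ hz'.1) (h'.posDef _ _ _ hz'.1)
    (h'.prevH_posDef k hz'.1) (prevF_mul_f k hz'.1.1) (hF.exact_prevF hz'.1.1 hz'.2 k)
    (hT k) h1 (hadj k) h2 y

end BundleComplex

/-! ### Independence of frames, gluing, and closedness of ξuφ -/

namespace BundleComplex

variable {n : ℕ} {X Y : Set (Cn n)} {E : BundleComplex X}
  {J : ∀ x : Cn n, Ideal (HolGerm x)} {z : Cn n} {i j : E.ι} {φ : Cn n → ℂ}

/-- The field of linear maps given by the differential `f k`. -/
def fLin (E : BundleComplex X) (k : ℕ) (i : E.ι) : Cn n → Cn (E.rank (k + 1) i) →ₗ[ℂ] Cn (E.rank k i) :=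
  fun z => (E.f k i z).mulVecLin

/-- The components of `u φ`, up to sign. -/
def uSolve (h : E.HermitianMetric Y) (φ : Cn n → ℂ) (i : E.ι) (q : ℕ) :
    Form n q (Cn (E.rank (q + 1) i)) :=
  solve (r := fun k => E.rank k i) (fun k => sigma h k i) (lineSource (fun k => E.rank k i) φ) q

theorem differentiableAt_fLin (k : ℕ) (hz : z ∈ E.U i) :
    DifferentiableAt ℂ (toCLM (E.fLin k i)) z :=
  differentiableAt_toCLM_mulVecLin (entriesIn_f k hz)

section Metric

variable (hE : E.IsResolution J) (h : E.HermitianMetric Y) (hY : IsOpen Y)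
include hE hY

theorem IsResolution.uComponent_eq (hφ : AnalyticOnNhd ℂ φ Y) (q : ℕ)
    (hz : z ∈ (E.U i ∩ Y) \ zeroLocus J) :
    uComponent h φ q i z = uSign q • uSolve h φ i q z :=
  uComponent_eq_solve h (hE.isOpen_inter_diff hY i) (fun k _ hw => hE.contDiffAt_sigma h hY k hw)
    (fun k _ hw => hE.sigma_sigma h k hw) (hφ.mono fun _ hw => hw.1.2) q z hz

theorem IsResolution.uSolve_mem (hφ : AnalyticOnNhd ℂ φ Y) (q : ℕ) :
    uSolve h φ i q ∈ smoothForms ((E.U i ∩ Y) \ zeroLocus J) q (Cn (E.rank (q + 1) i)) :=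
  solve_mem_smoothForms (r := fun k => E.rank k i) (hE.isOpen_inter_diff hY i)
    (fun k _ hw => hE.contDiffAt_sigma h hY k hw)
    (lineSource_mem_smoothForms (hE.isOpen_inter_diff hY i) (hφ.mono fun _ hw => hw.1.2)) q

/-- The case of source (φ, 0, 0, …) with ∂̄φ = 0: solvability at the first stage is surjectivity of
`f 0` off Z. -/
theorem IsResolution.fLin_uSolve (hφ : AnalyticOnNhd ℂ φ Y) :
    (∀ z ∈ (E.U i ∩ Y) \ zeroLocus J,
      applyForm (E.fLin 0 i) (uSolve h φ i 0) z = lineSource (fun k => E.rank k i) φ 0 z) ∧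
    ∀ q, ∀ z ∈ (E.U i ∩ Y) \ zeroLocus J,
      applyForm (E.fLin (q + 1) i) (uSolve h φ i (q + 1)) z = -dbar (uSolve h φ i q) z := by
  have hW := hE.isOpen_inter_diff hY i
  have h1 := solve_spec (r := fun k => E.rank k i) (S := fun k => sigma h k i)
    (c := lineSource (fun k => E.rank k i) φ) (D := fun k => E.fLin k i) hW
    (fun k _ hw => hE.contDiffAt_sigma h hY k hw)
    (lineSource_mem_smoothForms hW (hφ.mono fun _ hw => hw.1.2))
    (fun k w hw => differentiableAt_fLin k hw.1.1)
    (fun w hw v => f_mulVec_sigma h 0 hw.1 ((hE.exact_at hw.1.1 hw.2).1 _))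
    (fun k w hw y hy => f_mulVec_sigma h (k + 1) hw.1 ((hE.exact_at hw.1.1 hw.2).2 k y hy))
    (fun q w hw => by
      rw [dbar_lineSource (hφ w hw.1.2)]
      ext1 v
      exact map_zero (E.fLin q i w))
  refine ⟨h1.1, fun q w hw => (h1.2 q w hw).trans ?_⟩
  exact zero_sub _

end Metric

/-- Only degree zero matters, and there `T 0` is the identity of a line. It is described by its
entry because `r 0` and `r' 0` need not be definitionally equal. -/
theorem lineSource_intertwine {r r' : ℕ → ℕ} (hr : r 0 = 1)
    {T : ∀ k, Cn n → Cn (r k) →ₗ[ℂ] Cn (r' k)} {M : Matrix (Fin (r' 0)) (Fin (r 0)) ℂ}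
    (hM : T 0 z = M.mulVecLin) (h1 : ∀ a b, M a b = 1) (q : ℕ) :
    applyForm (T q) (lineSource r φ q) z = lineSource r' φ q z := by
  cases q with
  | zero =>
    ext v a
    change (T 0 z fun _ => φ z) a = φ z
    rw [hM, mulVecLin_apply, mulVec, dotProduct]
    simp [h1, hr]
  | succ q =>
    ext1 v
    exact map_zero (T (q + 1) z)

/-- The transition maps of the bundle `E_k`, as linear maps. -/
def transLin (E : BundleComplex X) (k : ℕ) (j i : E.ι) :
    Cn n → Cn (E.rank k i) →ₗ[ℂ] Cn (E.rank k j) :=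
  fun z => (E.trans k j i z).mulVecLin

theorem differentiableAt_transLin (k : ℕ) (hz : z ∈ E.U j ∩ E.U i) :
    DifferentiableAt ℂ (toCLM (E.transLin k j i)) z :=
  differentiableAt_toCLM_mulVecLin fun a b => E.trans_hol k j i a b z hz

theorem trans_mul_trans (k : ℕ) (hi : z ∈ E.U i) (hj : z ∈ E.U j) :
    E.trans k i j z * E.trans k j i z = 1 := by
  rw [E.trans_mul k i j i z ⟨⟨hi, hj⟩, hi⟩, E.trans_self k i z hi]

section Metric

variable (hE : E.IsResolution J) (h : E.HermitianMetric Y)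
include hE

/-- Transition matrices are isometries by compatibility of the metric, so their adjoints are the
inverse transition matrices, which again commute with f. -/
theorem IsResolution.transLin_sigma (k : ℕ) (hi : z ∈ E.U i) (hj : z ∈ E.U j) (hz : z ∈ Y)
    (hzJ : z ∉ zeroLocus J) (y : Cn (E.rank k i)) :
    E.transLin (k + 1) j i z (sigma h k i z y) = sigma h k j z (E.transLin k j i z y) :=
  hE.sigma_intertwine hE h h ⟨⟨hi, hz⟩, hzJ⟩ ⟨⟨hj, hz⟩, hzJ⟩ (T := fun k => E.trans k j i z)
    (T' := fun k => E.trans k i j z) (fun k => (E.f_trans k j i z ⟨hj, hi⟩).symm)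
    (fun k => (E.f_trans k i j z ⟨hi, hj⟩).symm)
    (fun k => by
      rw [h.compat k j i z ⟨⟨hj, hi⟩, hz⟩, ← Matrix.mul_assoc, ← Matrix.mul_assoc,
        ← conjTranspose_mul, trans_mul_trans k hj hi, conjTranspose_one, Matrix.one_mul]) k y

variable (hY : IsOpen Y)
include hY

theorem IsResolution.transLin_uSolve (hφ : AnalyticOnNhd ℂ φ Y) (q : ℕ) (hi : z ∈ E.U i)
    (hj : z ∈ E.U j) (hz : z ∈ Y) (hzJ : z ∉ zeroLocus J) :
    applyForm (E.transLin (q + 1) j i) (uSolve h φ i q) z = uSolve h φ j q z := by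
  have hW := (hE.isOpen_inter_diff hY i).inter (hE.isOpen_inter_diff hY j)
  exact solve_intertwine (r := fun k => E.rank k i) (r' := fun k => E.rank k j)
    (S := fun k => sigma h k i) (S' := fun k => sigma h k j) (T := fun k => E.transLin k j i) hW
    (fun k _ hw => hE.contDiffAt_sigma h hY k hw.1)
    (lineSource_mem_smoothForms hW (hφ.mono fun _ hw => hw.1.1.2))
    (fun k w hw => differentiableAt_transLin k ⟨hw.2.1.1, hw.1.1.1⟩)
    (fun k w hw y => hE.transLin_sigma h k hw.1.1.1 hw.2.1.1 hw.1.1.2 hw.1.2 y)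
    (fun q w hw => lineSource_intertwine (r := fun k => E.rank k i)
      (r' := fun k => E.rank k j) (T := fun k => E.transLin k j i) (E.rank_zero i) rfl
      (E.trans_zero j i w ⟨hw.2.1.1, hw.1.1.1⟩) q) q z ⟨⟨⟨hi, hz⟩, hzJ⟩, ⟨⟨hj, hz⟩, hzJ⟩⟩

end Metric

theorem IsHolDualSection.pairForm_eq {k q : ℕ} {ξ : ∀ i : E.ι, Cn n → Cn (E.rank k i)}
    (hξ : E.IsHolDualSection k ξ) (hi : z ∈ E.U i) (hj : z ∈ E.U j)
    {α : Form n q (Cn (E.rank k i))} {β : Form n q (Cn (E.rank k j))}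
    (h : applyForm (E.transLin k j i) α z = β z) : pairForm (ξ i) α z = pairForm (ξ j) β z := by
  ext v
  rw [pairForm_apply, pairForm_apply, ← h, hξ.compat j i z ⟨hj, hi⟩, ← dotProduct_mulVec]
  rfl

theorem IsHolDualSection.differentiableAt_rowCLM {k : ℕ} {ξ : ∀ i : E.ι, Cn n → Cn (E.rank k i)}
    (hξ : E.IsHolDualSection k ξ) (hi : z ∈ E.U i) : DifferentiableAt ℂ (rowCLM (ξ i)) z :=
  Residue.differentiableAt_rowCLM (hξ.hol i z hi).differentiableAt

theorem IsHolDualSection.contDiffAt_rowCLM {k : ℕ} {ξ : ∀ i : E.ι, Cn n → Cn (E.rank k i)}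
    (hξ : E.IsHolDualSection k ξ) (hi : z ∈ E.U i) : ContDiffAt ℝ ∞ (rowCLM (ξ i)) z :=
  Residue.contDiffAt_rowCLM ((hξ.hol i z hi).restrictScalars (𝕜 := ℝ)).contDiffAt

open Classical in
/-- The form that is equal to `β i` over `U i`. -/
def glue (E : BundleComplex X) {q : ℕ} (β : E.ι → Form n q ℂ) : Form n q ℂ := fun z =>
  if h : ∃ i, z ∈ E.U i then β h.choose z else 0

theorem glue_eq {q : ℕ} {β : E.ι → Form n q ℂ}
    (hβ : ∀ i j, z ∈ E.U i → z ∈ E.U j → β i z = β j z) (hz : z ∈ E.U i) :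
    E.glue β z = β i z := by
  have h : ∃ i, z ∈ E.U i := ⟨i, hz⟩
  rw [glue, dif_pos h]
  exact hβ _ _ h.choose_spec hz

theorem exists_mem_U (hz : z ∈ X) : ∃ i, z ∈ E.U i := by
  rw [← E.iUnion_U] at hz
  exact Set.mem_iUnion.1 hz

theorem mem_of_mem_U (hz : z ∈ E.U i) : z ∈ X := by
  rw [← E.iUnion_U]
  exact Set.mem_iUnion.2 ⟨i, hz⟩

theorem glue_eventuallyEq (hE : E.IsResolution J) {q : ℕ} {β : E.ι → Form n q ℂ}
    (hβ : ∀ z ∉ zeroLocus J, ∀ i j, z ∈ E.U i → z ∈ E.U j → β i z = β j z) (hz : z ∈ E.U i)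
    (hzJ : z ∉ zeroLocus J) : E.glue β =ᶠ[𝓝 z] β i := by
  filter_upwards [(hE.isOpen_diff).mem_nhds ⟨mem_of_mem_U hz, hzJ⟩, eventually_mem_U hz] with w h1 h2
  exact glue_eq (hβ w h1.2) h2

theorem glue_mem_smoothForms (hE : E.IsResolution J) {q : ℕ} {β : E.ι → Form n q ℂ}
    (hβ : ∀ z ∉ zeroLocus J, ∀ i j, z ∈ E.U i → z ∈ E.U j → β i z = β j z)
    (hs : ∀ i, β i ∈ smoothForms ((E.U i ∩ X) \ zeroLocus J) q ℂ) (hX : IsOpen X) :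
    E.glue β ∈ smoothForms (X \ zeroLocus J) q ℂ := by
  refine (mem_smoothForms_iff hE.isOpen_diff).2 fun z hz => ?_
  obtain ⟨i, hi⟩ := E.exists_mem_U hz.1
  have h1 := (mem_smoothForms_iff (hE.isOpen_inter_diff hX i)).1 (hs i) z ⟨⟨hi, hz.1⟩, hz.2⟩
  have h2 := glue_eventuallyEq hE hβ hi hz.2
  exact ⟨h1.1.congr_of_eventuallyEq h2, h2.self_of_nhds ▸ h1.2⟩

section PairedClass

variable (hX : IsOpen X) (hE : E.IsResolution J) (h : E.HermitianMetric X) {q : ℕ}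
  {ξ : ∀ i : E.ι, Cn n → Cn (E.rank (q + 1) i)} (hξ : E.IsHolDualSection (q + 1) ξ)
  (hφ : AnalyticOnNhd ℂ φ X)
include hX hE hξ hφ

theorem pairForm_uSolve_compat :
    ∀ z ∉ zeroLocus J, ∀ i j, z ∈ E.U i → z ∈ E.U j →
      (uSign q • pairForm (ξ i) (uSolve h φ i q)) z =
        (uSign q • pairForm (ξ j) (uSolve h φ j q)) z := fun z hz i j hi hj => by
  rw [Pi.smul_apply, Pi.smul_apply, hξ.pairForm_eq hi hj
    (hE.transLin_uSolve h hX hφ q hi hj (mem_of_mem_U hi) hz)]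

omit hξ in
theorem pairForm_uComponent (hi : z ∈ E.U i) (hz : z ∉ zeroLocus J) :
    pairForm (ξ i) (uComponent h φ q i) z = (uSign q • pairForm (ξ i) (uSolve h φ i q)) z := by
  ext v
  rw [pairForm_apply, hE.uComponent_eq h hX hφ q ⟨⟨hi, mem_of_mem_U hi⟩, hz⟩,
    ContinuousAlternatingMap.smul_apply, dotProduct_smul]
  rfl

/-- Since ξ is holomorphic, ∂̄(ξx_q) = ξ∂̄x_q = -(ξf)x_{q+1} = 0. -/
theorem glue_mem_closedForms (hξf : ∀ i, ∀ z ∈ E.U i, ξ i z ᵥ* E.f (q + 1) i z = 0) :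
    E.glue (fun i => uSign q • pairForm (ξ i) (uSolve h φ i q)) ∈ closedForms hE.compl q := by
  have hc := pairForm_uSolve_compat hX hE h hξ hφ
  refine ⟨glue_mem_smoothForms hE hc (fun i => Submodule.smul_mem _ _
    (clmForm_mem_smoothForms (hE.isOpen_inter_diff hX i)
      (fun z hz => hξ.contDiffAt_rowCLM hz.1.1) (hE.uSolve_mem h hX hφ q))) hX, fun z hz => ?_⟩
  obtain ⟨i, hi⟩ := E.exists_mem_U hz.1
  have hz' : z ∈ (E.U i ∩ X) \ zeroLocus J := ⟨⟨hi, hz.1⟩, hz.2⟩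
  have hd := differentiableAt_of_mem_smoothForms (hE.isOpen_inter_diff hX i)
    (hE.uSolve_mem h hX hφ q) hz'
  have hd' : DifferentiableAt ℝ (pairForm (ξ i) (uSolve h φ i q)) z :=
    differentiableAt_of_mem_smoothForms (hE.isOpen_inter_diff hX i)
      (clmForm_mem_smoothForms (hE.isOpen_inter_diff hX i)
      (fun z hz => hξ.contDiffAt_rowCLM hz.1.1) (hE.uSolve_mem h hX hφ q)) hz'
  rw [dbar_congr (glue_eventuallyEq hE hc hi hz.2), dbar_smul _ _ _ hd', pairForm_eq_clmForm,
    dbar_clmForm (hξ.differentiableAt_rowCLM hi) hd]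
  ext v
  have h1 : dbar (uSolve h φ i q) z = -applyForm (E.fLin (q + 1) i) (uSolve h φ i (q + 1)) z := by
    rw [(hE.fLin_uSolve h hX hφ).2 q z hz', neg_neg]
  have h2 : ξ i z ⬝ᵥ -(E.f (q + 1) i z *ᵥ uSolve h φ i (q + 1) z v) = 0 := by
    rw [dotProduct_neg, dotProduct_mulVec, hξf i z hi, zero_dotProduct, neg_zero]
  rw [ContinuousAlternatingMap.smul_apply, clmForm_apply, h1]
  exact (congrArg (uSign q • ·) h2).trans (smul_zero _)

end PairedClass

/-! ### Independence of the Dolbeault class from the metrics -/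

section Independence

variable (hX : IsOpen X) (hE : E.IsResolution J) (h h' : E.HermitianMetric X)

/-- The difference of the solutions for two metrics, with signs. -/
def uDiff (h h' : E.HermitianMetric Y) (φ : Cn n → ℂ) (i : E.ι) (q : ℕ) :
    Form n q (Cn (E.rank (q + 1) i)) :=
  (-1 : ℂ) ^ q • (uSolve h φ i q - uSolve h' φ i q)

/-- The primitive of the difference of the solutions for two metrics. -/
def uPrimitive (h h' : E.HermitianMetric Y) (φ : Cn n → ℂ) (i : E.ι) (q : ℕ) :
    Form n q (Cn (E.rank (q + 2) i)) :=
  solve (r := fun k => E.rank (k + 1) i) (fun k => sigma h (k + 1) i) (uDiff h h' φ i) q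

variable (hφ : AnalyticOnNhd ℂ φ X)
include hX hE hφ

theorem uDiff_mem (q : ℕ) :
    uDiff h h' φ i q ∈ smoothForms ((E.U i ∩ X) \ zeroLocus J) q (Cn (E.rank (q + 1) i)) :=
  Submodule.smul_mem _ _ (Submodule.sub_mem _ (hE.uSolve_mem h hX hφ q)
    (hE.uSolve_mem h' hX hφ q))

theorem uPrimitive_mem (q : ℕ) :
    uPrimitive h h' φ i q ∈
      smoothForms ((E.U i ∩ X) \ zeroLocus J) q (Cn (E.rank (q + 2) i)) :=
  solve_mem_smoothForms (r := fun k => E.rank (k + 1) i) (hE.isOpen_inter_diff hX i)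
    (fun k _ hw => hE.contDiffAt_sigma h hX (k + 1) hw) (uDiff_mem hX hE h h' hφ) q

/-- Both solutions have the same image φ under `f 0`, so d_0 is in its kernel. The factor (-1)^q in
`uDiff` turns f(x_{q+1} - x'_{q+1}) = -∂̄(x_q - x'_q) into f d_{q+1} = ∂̄d_q, the compatibility
required by `solve_spec`. -/
theorem fLin_uPrimitive :
    (∀ z ∈ (E.U i ∩ X) \ zeroLocus J,
      applyForm (E.fLin 1 i) (uPrimitive h h' φ i 0) z = uDiff h h' φ i 0 z) ∧
    ∀ q, ∀ z ∈ (E.U i ∩ X) \ zeroLocus J,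
      applyForm (E.fLin (q + 2) i) (uPrimitive h h' φ i (q + 1)) z =
        uDiff h h' φ i (q + 1) z - dbar (uPrimitive h h' φ i q) z := by
  have hW := hE.isOpen_inter_diff hX i
  refine solve_spec (r := fun k => E.rank (k + 1) i) (S := fun k => sigma h (k + 1) i)
    (D := fun k => E.fLin (k + 1) i) hW
    (fun k _ hw => hE.contDiffAt_sigma h hX (k + 1) hw) (uDiff_mem hX hE h h' hφ)
    (fun k w hw => differentiableAt_fLin (k + 1) hw.1.1)
    (fun w hw v => f_mulVec_sigma h 1 hw.1 ((hE.exact_at hw.1.1 hw.2).2 0 _ ?_))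
    (fun k w hw y hy => f_mulVec_sigma h (k + 2) hw.1 ((hE.exact_at hw.1.1 hw.2).2 (k + 1) y hy))
    (fun q w hw => ?_)
  · have h1 := DFunLike.congr_fun ((hE.fLin_uSolve h hX hφ).1 w hw) v
    have h2 := DFunLike.congr_fun ((hE.fLin_uSolve h' hX hφ).1 w hw) v
    change E.fLin 0 i w ((-1 : ℂ) ^ 0 • (uSolve h φ i 0 w v - uSolve h' φ i 0 w v)) = 0
    rw [map_smul, map_sub]
    rw [applyForm_apply] at h1 h2
    rw [h1, h2, sub_self, smul_zero]
  · have hd := differentiableAt_of_mem_smoothForms hW (hE.uSolve_mem h hX hφ q) hw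
    have hd' := differentiableAt_of_mem_smoothForms hW (hE.uSolve_mem h' hX hφ q) hw
    have h1 := (hE.fLin_uSolve h hX hφ).2 q w hw
    have h2 := (hE.fLin_uSolve h' hX hφ).2 q w hw
    have h0 : dbar (uDiff h h' φ i q) w = (-1 : ℂ) ^ q • (dbar (uSolve h φ i q) w -
        dbar (uSolve h' φ i q) w) := by
      rw [uDiff, dbar_smul _ _ _ (hd.sub hd'), dbar_sub hd hd']
    rw [h0]
    ext1 v
    have h3 := DFunLike.congr_fun h1 v
    have h4 := DFunLike.congr_fun h2 v
    rw [applyForm_apply] at h3 h4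
    change E.fLin (q + 1) i w ((-1 : ℂ) ^ (q + 1) • (uSolve h φ i (q + 1) w v -
      uSolve h' φ i (q + 1) w v)) = (-1 : ℂ) ^ q • (dbar (uSolve h φ i q) w v -
        dbar (uSolve h' φ i q) w v)
    rw [map_smul, map_sub, h3, h4, pow_succ, mul_neg_one, neg_smul, ← smul_neg]
    congr 1
    simp only [ContinuousAlternatingMap.neg_apply]
    abel

/-- The homotopy used for the primitive is the minimal inverse of the first metric. Being
independent of frames, it gives local primitives that glue. -/
theorem transLin_uPrimitive (q : ℕ) (hi : z ∈ E.U i) (hj : z ∈ E.U j) (hzJ : z ∉ zeroLocus J) :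
    applyForm (E.transLin (q + 2) j i) (uPrimitive h h' φ i q) z = uPrimitive h h' φ j q z := by
  have hW := (hE.isOpen_inter_diff hX i).inter (hE.isOpen_inter_diff hX j)
  have hX' := mem_of_mem_U hi
  refine solve_intertwine (r := fun k => E.rank (k + 1) i) (r' := fun k => E.rank (k + 1) j)
    (S := fun k => sigma h (k + 1) i) (S' := fun k => sigma h (k + 1) j)
    (T := fun k => E.transLin (k + 1) j i) hW
    (fun k _ hw => hE.contDiffAt_sigma h hX (k + 1) hw.1)
    (fun q => (mem_smoothForms_iff hW).2 fun w hw =>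
      (mem_smoothForms_iff (hE.isOpen_inter_diff hX i)).1 (uDiff_mem hX hE h h' hφ q) w hw.1)
    (fun k w hw => differentiableAt_transLin (k + 1) ⟨hw.2.1.1, hw.1.1.1⟩)
    (fun k w hw y => hE.transLin_sigma h (k + 1) hw.1.1.1 hw.2.1.1 hw.1.1.2 hw.1.2 y)
    (fun q w hw => ?_) q z ⟨⟨⟨hi, hX'⟩, hzJ⟩, ⟨⟨hj, hX'⟩, hzJ⟩⟩
  have h1 := hE.transLin_uSolve h hX hφ q hw.1.1.1 hw.2.1.1 hw.1.1.2 hw.1.2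
  have h2 := hE.transLin_uSolve h' hX hφ q hw.1.1.1 hw.2.1.1 hw.1.1.2 hw.1.2
  ext1 v
  change E.transLin (q + 1) j i w ((-1 : ℂ) ^ q • (uSolve h φ i q w v - uSolve h' φ i q w v)) =
    (-1 : ℂ) ^ q • (uSolve h φ j q w v - uSolve h' φ j q w v)
  rw [map_smul, map_sub, ← h1, ← h2]
  rfl

/-- Pairing d_{q+1} = f y_{q+1} + ∂̄y_q with ξ removes the first term and leaves ∂̄(ξy_q). -/
theorem glue_sub_mem_exactForms {q : ℕ}
    {ξ : ∀ i : E.ι, Cn n → Cn (E.rank (q + 1) i)} (hξ : E.IsHolDualSection (q + 1) ξ)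
    (hξf : ∀ i, ∀ z ∈ E.U i, ξ i z ᵥ* E.f (q + 1) i z = 0) :
    E.glue (fun i => uSign q • pairForm (ξ i) (uSolve h φ i q)) -
      E.glue (fun i => uSign q • pairForm (ξ i) (uSolve h' φ i q)) ∈ exactForms hE.compl q := by
  have hc := pairForm_uSolve_compat hX hE h hξ hφ
  have hc' := pairForm_uSolve_compat hX hE h' hξ hφ
  have hsign : ∀ q : ℕ, (-1 : ℂ) ^ q * (-1) ^ q = 1 := fun q => by
    rw [← mul_pow, neg_one_mul, neg_neg, one_pow]
  have hdiff : ∀ z ∈ X \ zeroLocus J, ∀ i, z ∈ E.U i → ∀ v,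
      (E.glue (fun i => uSign q • pairForm (ξ i) (uSolve h φ i q)) -
      E.glue (fun i => uSign q • pairForm (ξ i) (uSolve h' φ i q))) z v =
      (uSign q * (-1) ^ q) * (ξ i z ⬝ᵥ uDiff h h' φ i q z v) := fun z hz i hi v => by
    rw [Pi.sub_apply, glue_eq (hc z hz.2) hi, glue_eq (hc' z hz.2) hi]
    change uSign q * (ξ i z ⬝ᵥ uSolve h φ i q z v) - uSign q * (ξ i z ⬝ᵥ uSolve h' φ i q z v) =
      (uSign q * (-1) ^ q) * (ξ i z ⬝ᵥ ((-1 : ℂ) ^ q • (uSolve h φ i q z v - uSolve h' φ i q z v)))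
    rw [dotProduct_smul, dotProduct_sub, smul_eq_mul, ← mul_assoc, mul_assoc (uSign q), hsign,
      mul_one, mul_sub]
  -- In degree zero exactness means vanishing on X \ Z: here d_0 = f y_0, which ξ annihilates.
  cases q with
  | zero =>
    intro z hz
    obtain ⟨i, hi⟩ := E.exists_mem_U hz.1
    ext v
    rw [hdiff z hz i hi v, ← (fLin_uPrimitive hX hE h h' hφ).1 z ⟨⟨hi, hz.1⟩, hz.2⟩]
    change _ * (ξ i z ⬝ᵥ E.f 1 i z *ᵥ uPrimitive h h' φ i 0 z v) = 0
    rw [dotProduct_mulVec, hξf i z hi, zero_dotProduct, mul_zero]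
  | succ q =>
    have hk : ∀ z ∉ zeroLocus J, ∀ i j, z ∈ E.U i → z ∈ E.U j →
        ((uSign (q + 1) * (-1) ^ (q + 1)) • pairForm (ξ i) (uPrimitive h h' φ i q)) z =
        ((uSign (q + 1) * (-1) ^ (q + 1)) • pairForm (ξ j) (uPrimitive h h' φ j q)) z :=
      fun z hz i j hi hj => by
        rw [Pi.smul_apply, Pi.smul_apply, hξ.pairForm_eq hi hj
          (transLin_uPrimitive hX hE h h' hφ q hi hj hz)]
    have hs : ∀ i, pairForm (ξ i) (uPrimitive h h' φ i q) ∈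
        smoothForms ((E.U i ∩ X) \ zeroLocus J) q ℂ := fun i =>
      clmForm_mem_smoothForms (hE.isOpen_inter_diff hX i)
        (fun z hz => hξ.contDiffAt_rowCLM hz.1.1) (uPrimitive_mem hX hE h h' hφ q)
    refine ⟨_, glue_mem_smoothForms hE hk (fun i => Submodule.smul_mem _ _ (hs i)) hX,
      fun z hz => ?_⟩
    obtain ⟨i, hi⟩ := E.exists_mem_U hz.1
    have hz' : z ∈ (E.U i ∩ X) \ zeroLocus J := ⟨⟨hi, hz.1⟩, hz.2⟩
    rw [dbar_congr (glue_eventuallyEq hE hk hi hz.2),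
      dbar_smul _ _ _ (differentiableAt_of_mem_smoothForms (hE.isOpen_inter_diff hX i) (hs i) hz'),
      pairForm_eq_clmForm, dbar_clmForm (hξ.differentiableAt_rowCLM hi)
        (differentiableAt_of_mem_smoothForms (hE.isOpen_inter_diff hX i)
          (uPrimitive_mem hX hE h h' hφ q) hz')]
    ext v
    have h1 : uDiff h h' φ i (q + 1) z = applyForm (E.fLin (q + 2) i)
        (uPrimitive h h' φ i (q + 1)) z + dbar (uPrimitive h h' φ i q) z := by
      rw [(fLin_uPrimitive hX hE h h' hφ).2 q z hz', sub_add_cancel]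
    rw [hdiff z hz i hi v, h1]
    change _ * (ξ i z ⬝ᵥ (E.f (q + 2) i z *ᵥ uPrimitive h h' φ i (q + 1) z v +
      dbar (uPrimitive h h' φ i q) z v)) = _ * (ξ i z ⬝ᵥ dbar (uPrimitive h h' φ i q) z v)
    rw [dotProduct_add, dotProduct_mulVec, hξf i z hi, zero_dotProduct, zero_add]

end Independence

/-- The class of `ξ u φ` exists and does not depend on the metric. -/
theorem IsResolution.exists_class (hX : IsOpen X) (hE : E.IsResolution J) (q : ℕ)
    (ξ : ∀ i : E.ι, Cn n → Cn (E.rank (q + 1) i)) (hξ : E.IsHolDualSection (q + 1) ξ)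
    (hξf : ∀ i, ∀ z ∈ E.U i, ξ i z ᵥ* E.f (q + 1) i z = 0)
    (φ : Cn n → ℂ) (hφ : AnalyticOnNhd ℂ φ X) :
    ∃ c : Dolbeault hE.compl q, ∀ h : E.HermitianMetric X,
      ∃ (α : Form n q ℂ) (hα : α ∈ closedForms hE.compl q),
        (∀ i, ∀ z ∈ E.U i \ zeroLocus J, α z = pairForm (ξ i) (uComponent h φ q i) z) ∧
        Dolbeault.mk hE.compl α hα = c := by
  have hcl := fun h => glue_mem_closedForms hX hE h hξ hφ hξf
  have key : ∀ h h', Dolbeault.mk hE.compl _ (hcl h) = Dolbeault.mk hE.compl _ (hcl h') :=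
    fun h h' => Subtype.ext ((Submodule.Quotient.eq _).2
      (glue_sub_mem_exactForms hX hE h h' hφ hξ hξf))
  have heq : ∀ h : E.HermitianMetric X, ∀ i, ∀ z ∈ E.U i \ zeroLocus J,
      E.glue (fun i => uSign q • pairForm (ξ i) (uSolve h φ i q)) z =
        pairForm (ξ i) (uComponent h φ q i) z := fun h i z hz => by
    rw [pairForm_uComponent hX hE h hφ hz.1 hz.2,
      glue_eq (pairForm_uSolve_compat hX hE h hξ hφ z hz.2) hz.1]
  -- Some metric is needed to name the class; if there is none, the assertion is vacuous and zero
  -- serves.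
  by_cases hne : Nonempty (E.HermitianMetric X)
  · obtain ⟨h₀⟩ := hne
    exact ⟨_, fun h => ⟨_, hcl h, heq h, key h h₀⟩⟩
  · exact ⟨0, fun h => (hne ⟨h⟩).elim⟩

end BundleComplex

/-! ### Linear algebra of perturbed splittings and compressed comparison maps -/

section Perturbation

variable {r s t r' s' : ℕ}

/-- A generalized inverse `S` of `A₀`, corrected to one of `A`. -/
def perturbInverse (A₀ A : Matrix (Fin s) (Fin r) ℂ) (S : Matrix (Fin r) (Fin s) ℂ) :
    Matrix (Fin r) (Fin s) ℂ :=
  S * (1 + (A - A₀) * S)⁻¹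

/-- Put T = 1 + (A - A₀)S. Then T fixes 1 - A₀S because SA₀S = S, so ST⁻¹(1 - A₀S) = 0. Now AS = T -
(1 - A₀S) gives ST⁻¹AS = S. -/
theorem perturbInverse_mul_mul {A₀ A : Matrix (Fin s) (Fin r) ℂ} {S : Matrix (Fin r) (Fin s) ℂ}
    (hS : S * A₀ * S = S) (h : IsUnit (1 + (A - A₀) * S).det) :
    perturbInverse A₀ A S * A * perturbInverse A₀ A S = perturbInverse A₀ A S := by
  rw [perturbInverse]
  set T := 1 + (A - A₀) * S with hT
  have h1 : T * (1 - A₀ * S) = 1 - A₀ * S := by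
    rw [hT, Matrix.add_mul, Matrix.one_mul, Matrix.mul_assoc (A - A₀), Matrix.mul_sub S,
      Matrix.mul_one, ← Matrix.mul_assoc S, hS, sub_self, Matrix.mul_zero, add_zero]
  have h2 : S * T⁻¹ * (1 - A₀ * S) = 0 := by
    rw [← h1, Matrix.mul_assoc, Matrix.nonsing_inv_mul_cancel_left _ _ h, Matrix.mul_sub,
      Matrix.mul_one, ← Matrix.mul_assoc, hS, sub_self]
  have h3 : A * S = T - (1 - A₀ * S) := by
    rw [hT, Matrix.sub_mul]; abel
  rw [← Matrix.mul_assoc, Matrix.mul_assoc _ A S, h3, Matrix.mul_sub, h2, sub_zero,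
    Matrix.mul_assoc S, Matrix.nonsing_inv_mul _ h, Matrix.mul_one]

/-- The correction factor of the first map fixes the image of S' because SS' = 0, so perturbed
splittings still form a complex. -/
theorem perturbInverse_mul_perturbInverse {A₀ A : Matrix (Fin s) (Fin r) ℂ}
    {S : Matrix (Fin r) (Fin s) ℂ} {B₀ B : Matrix (Fin t) (Fin s) ℂ}
    {S' : Matrix (Fin s) (Fin t) ℂ} (hS : S * S' = 0) (h : IsUnit (1 + (A - A₀) * S).det) :
    perturbInverse A₀ A S * perturbInverse B₀ B S' = 0 := by
  have h1 : (1 + (A - A₀) * S) * S' = S' := by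
    rw [Matrix.add_mul, Matrix.one_mul, Matrix.mul_assoc, hS, Matrix.mul_zero, add_zero]
  have h2 : (1 + (A - A₀) * S)⁻¹ * S' = S' := by
    conv_lhs => rw [← h1, Matrix.nonsing_inv_mul_cancel_left _ _ h]
  rw [perturbInverse, perturbInverse, ← Matrix.mul_assoc, Matrix.mul_assoc S, h2, hS,
    Matrix.zero_mul]

theorem perturbInverse_self (A : Matrix (Fin s) (Fin r) ℂ) (S : Matrix (Fin r) (Fin s) ℂ) :
    perturbInverse A A S = S := by
  simp [perturbInverse]

/-- AS and S'B are idempotents whose products in both orders vanish. -/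
theorem harmonic_idempotent {A : Matrix (Fin s) (Fin r) ℂ} {B : Matrix (Fin t) (Fin s) ℂ}
    {S : Matrix (Fin r) (Fin s) ℂ} {S' : Matrix (Fin s) (Fin t) ℂ} (hBA : B * A = 0)
    (hSS : S * S' = 0) (hS : S * A * S = S) (hS' : S' * B * S' = S') :
    (1 - A * S - S' * B) * (1 - A * S - S' * B) = 1 - A * S - S' * B := by
  have h1 : A * S * (A * S) = A * S := by
    rw [← Matrix.mul_assoc, Matrix.mul_assoc A S, Matrix.mul_assoc A (S * A), hS]
  have h2 : A * S * (S' * B) = 0 := by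
    rw [← Matrix.mul_assoc, Matrix.mul_assoc A, hSS, Matrix.mul_zero, Matrix.zero_mul]
  have h3 : S' * B * (A * S) = 0 := by
    rw [← Matrix.mul_assoc, Matrix.mul_assoc S', hBA, Matrix.mul_zero, Matrix.zero_mul]
  have h4 : S' * B * (S' * B) = S' * B := by rw [← Matrix.mul_assoc, hS']
  rw [Matrix.mul_sub, Matrix.mul_sub, Matrix.sub_mul, Matrix.sub_mul, Matrix.sub_mul,
    Matrix.sub_mul, Matrix.sub_mul, Matrix.sub_mul, h1, h2, h3, h4]
  simp

variable {P : Matrix (Fin s) (Fin s) ℂ} {P' : Matrix (Fin s') (Fin s') ℂ}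
  {D : Matrix (Fin s) (Fin s') ℂ} {G : Matrix (Fin s') (Fin s) ℂ}

/-- The inverse of `G : im P → im P'`, if `D : im P' → im P` is such that `D G` and `G D` are
invertible. -/
def cornerInverse (P : Matrix (Fin s) (Fin s) ℂ) (D : Matrix (Fin s) (Fin s') ℂ)
    (G : Matrix (Fin s') (Fin s) ℂ) : Matrix (Fin s) (Fin s') ℂ :=
  (1 - P + D * G)⁻¹ * D

/-- Adding 1 - P extends DG by the identity on ker P to an endomorphism of the whole space, which
can be inverted by a determinant; on im P the two agree. -/
theorem cornerInverse_mul (hP : P * P = P) (hGP : G * P = G)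
    (h : IsUnit (1 - P + D * G).det) : cornerInverse P D G * G = P := by
  have h1 : (1 - P + D * G) * P = D * G := by
    rw [Matrix.add_mul, Matrix.sub_mul, Matrix.one_mul, hP, sub_self, zero_add, Matrix.mul_assoc,
      hGP]
  have h2 := Matrix.nonsing_inv_mul_cancel_left _ P h
  rwa [h1, ← Matrix.mul_assoc] at h2

theorem mul_cornerInverse_left (hP : P * P = P) (hGP : G * P = G) (hPD : P * D = D)
    (h : IsUnit (1 - P + D * G).det) : P * cornerInverse P D G = cornerInverse P D G := by
  have h1 : (1 - P + D * G) * P = P * (1 - P + D * G) := by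
    rw [Matrix.add_mul, Matrix.sub_mul, Matrix.one_mul, hP, sub_self, zero_add, Matrix.mul_assoc,
      hGP, Matrix.mul_add, Matrix.mul_sub, Matrix.mul_one, hP, sub_self, zero_add,
      ← Matrix.mul_assoc, hPD]
  rw [cornerInverse, ← Matrix.mul_assoc,
    ← Matrix.nonsing_inv_mul_cancel_left _ (P * (1 - P + D * G)⁻¹) h, ← Matrix.mul_assoc _ P, h1,
    Matrix.mul_assoc P, Matrix.mul_nonsing_inv _ h, Matrix.mul_one, Matrix.mul_assoc, hPD]

theorem mul_cornerInverse (hP' : P' * P' = P') (hGP : G * P = G) (hPG : P' * G = G)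
    (hDP : D * P' = D) (h : IsUnit (1 - P + D * G).det) (h' : IsUnit (1 - P' + G * D).det) :
    G * cornerInverse P D G = P' := by
  have h1 : (1 - P' + G * D) * G = G * (1 - P + D * G) := by
    rw [Matrix.add_mul, Matrix.sub_mul, Matrix.one_mul, hPG, sub_self, zero_add, Matrix.mul_add,
      Matrix.mul_sub, Matrix.mul_one, hGP, sub_self, zero_add, Matrix.mul_assoc]
  have h2 : (1 - P' + G * D) * P' = G * D := by
    rw [Matrix.add_mul, Matrix.sub_mul, Matrix.one_mul, hP', sub_self, zero_add, Matrix.mul_assoc,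
      hDP]
  rw [cornerInverse, ← Matrix.mul_assoc,
    ← Matrix.nonsing_inv_mul_cancel_left _ (G * (1 - P + D * G)⁻¹) h', ← Matrix.mul_assoc _ G, h1,
    Matrix.mul_assoc G, Matrix.mul_nonsing_inv _ h, Matrix.mul_one, Matrix.mul_assoc]
  have h3 := Matrix.nonsing_inv_mul_cancel_left _ P' h'
  rwa [h2] at h3

/-- At a point where the differentials vanish on the harmonic parts, the comparison maps restrict
to mutually inverse isomorphisms of the harmonic parts. -/
theorem harmonic_comparison {A : Matrix (Fin s) (Fin r) ℂ} {B : Matrix (Fin t) (Fin s) ℂ}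
    {t' : ℕ} {A' : Matrix (Fin s') (Fin r') ℂ} {B' : Matrix (Fin t') (Fin s') ℂ}
    {S' : Matrix (Fin r') (Fin s') ℂ} {T' : Matrix (Fin s') (Fin t') ℂ}
    {a : Matrix (Fin s') (Fin s) ℂ} {b : Matrix (Fin s) (Fin s') ℂ} {b₂ : Matrix (Fin r) (Fin r') ℂ}
    {a₀ : Matrix (Fin t') (Fin t) ℂ} {h : Matrix (Fin r) (Fin s) ℂ} {h₀ : Matrix (Fin s) (Fin t) ℂ}
    (hP : P * P = P) (hPA : P * A = 0) (hP' : P' * P' = P') (hP1 : 1 - P' = A' * S' + T' * B')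
    (hTaB : T' * (a₀ * (B * P)) = 0) (hhB : h₀ * (B * P) = 0)
    (hb : b * A' = A * b₂) (ha : B' * a = a₀ * B)
    (hba : b * a = 1 + A * h + h₀ * B) :
    P * b * P' * (P' * a * P) = P := by
  have e1 : P * b * A' = 0 := by
    rw [Matrix.mul_assoc, hb, ← Matrix.mul_assoc, hPA, Matrix.zero_mul]
  have e2 : T' * B' * (a * P) = 0 := by
    rw [Matrix.mul_assoc, ← Matrix.mul_assoc B', ha, Matrix.mul_assoc a₀, hTaB]
  -- Inserting P' between b and a is harmless: the part A'S' is carried by b into im A, killed by P,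
  -- and the part T'B' is killed by hypothesis.
  have e3 : P * b * (1 - P') * (a * P) = 0 := by
    rw [hP1, Matrix.mul_add, Matrix.add_mul, Matrix.mul_assoc (P * b) (T' * B'), e2,
      ← Matrix.mul_assoc _ A', e1, Matrix.zero_mul, Matrix.zero_mul, Matrix.mul_zero, add_zero]
  have e4 : P * b * (a * P) = P := by
    rw [Matrix.mul_assoc, ← Matrix.mul_assoc b, hba, Matrix.add_mul, Matrix.add_mul,
      Matrix.one_mul, Matrix.mul_assoc h₀, hhB, add_zero, Matrix.mul_add, hP, Matrix.mul_assoc A,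
      ← Matrix.mul_assoc P A, hPA, Matrix.zero_mul, add_zero]
  rw [Matrix.mul_sub, Matrix.mul_one, Matrix.sub_mul, e4, sub_eq_zero] at e3
  rw [Matrix.mul_assoc P' a, ← Matrix.mul_assoc, Matrix.mul_assoc (P * b), hP', ← e3]

end Perturbation

/-- The matrix with all entries equal to one. -/
def ones (s r : ℕ) : Matrix (Fin s) (Fin r) ℂ := Matrix.of fun _ _ => 1

@[simp] theorem ones_apply (s r : ℕ) (a : Fin s) (b : Fin r) : ones s r a b = 1 := rfl

theorem HolGerm.of_mem_congr {n : ℕ} {x : Cn n} {I : Ideal (HolGerm x)} {φ ψ : Cn n → ℂ}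
    (h : φ = ψ) {hφ : AnalyticAt ℂ φ x} {hψ : AnalyticAt ℂ ψ x} (hI : HolGerm.of φ hφ ∈ I) :
    HolGerm.of ψ hψ ∈ I := by
  subst h
  exact hI

/-! ### Holomorphic splittings, comparison maps and homotopies near a point -/

namespace BundleComplex

variable {n : ℕ} {X : Set (Cn n)} {E : BundleComplex X}
  {J : ∀ x : Cn n, Ideal (HolGerm x)} {x : Cn n} {i : E.ι}

/-- In a complex of vector spaces the generalized inverses of the differentials can be chosen such
that they form a complex; here the one of the last differential is replaced by zero. -/
theorem exists_splitting (hx : x ∈ E.U i) :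
    ∃ S : ∀ k, Matrix (Fin (E.rank (k + 1) i)) (Fin (E.rank k i)) ℂ, S 0 = 0 ∧
      (∀ k, S k * E.f k i x * S k = S k) ∧ (∀ k, S (k + 1) * S k = 0) ∧
      ∀ k, E.f (k + 1) i x * S (k + 1) * E.f (k + 1) i x = E.f (k + 1) i x := by
  choose C hC hC' using fun k => exists_generalizedInverse (E.f k i x)
  -- The left factor 1 - f C projects onto a subspace killed by the next C. This forces consecutive
  -- compositions to vanish without changing `f k * C k`.
  let S₁ : ∀ k, Matrix (Fin (E.rank (k + 1) i)) (Fin (E.rank k i)) ℂ :=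
    fun k => (1 - E.f (k + 1) i x * C (k + 1)) * C k
  have h1 : ∀ k, E.f k i x * S₁ k = E.f k i x * C k := fun k => by
    rw [← Matrix.mul_assoc, Matrix.mul_sub, Matrix.mul_one, ← Matrix.mul_assoc, E.f_comp_f k i x hx,
      Matrix.zero_mul, sub_zero]
  have h2 : ∀ k, S₁ k * E.f k i x * S₁ k = S₁ k := fun k => by
    rw [Matrix.mul_assoc, h1, Matrix.mul_assoc, ← Matrix.mul_assoc (C k), hC']
  have h3 : ∀ k, C (k + 1) * S₁ k = 0 := fun k => by
    rw [← Matrix.mul_assoc, Matrix.mul_sub, Matrix.mul_one, ← Matrix.mul_assoc, hC', sub_self,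
      Matrix.zero_mul]
  -- Setting `S 0 = 0` keeps E_0 entirely in the summand: φ lives there, even if `f 0` is nonzero at
  -- x.
  let S : ∀ k, Matrix (Fin (E.rank (k + 1) i)) (Fin (E.rank k i)) ℂ
    | 0 => 0
    | k + 1 => S₁ (k + 1)
  refine ⟨S, rfl, fun k => ?_, fun k => ?_, fun k => ?_⟩
  · cases k with
    | zero => simp [S]
    | succ k => exact h2 (k + 1)
  · cases k with
    | zero => exact Matrix.mul_zero _
    | succ k =>
      change (1 - E.f (k + 3) i x * C (k + 3)) * C (k + 2) * S₁ (k + 1) = 0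
      rw [Matrix.mul_assoc, h3, Matrix.mul_zero]
  · change E.f (k + 1) i x * S₁ (k + 1) * E.f (k + 1) i x = E.f (k + 1) i x
    rw [h1, hC]

/-- The projections `1 - f S - S f`, with `1` in degree zero. -/
def harmonicProj (E : BundleComplex X) (i : E.ι)
    (S : ∀ k, Cn n → Matrix (Fin (E.rank (k + 1) i)) (Fin (E.rank k i)) ℂ) :
    ∀ k, Cn n → Matrix (Fin (E.rank k i)) (Fin (E.rank k i)) ℂ
  | 0 => fun _ => 1
  | k + 1 => fun w => 1 - E.f (k + 1) i w * S (k + 1) w - S k w * E.f k i w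

/-- Near a point `x` there are holomorphic projections of the complex onto a subcomplex with
vanishing differentials at `x`, except for the last one. -/
theorem exists_harmonicProj (hx : x ∈ E.U i) :
    ∃ (P : ∀ k, Cn n → Matrix (Fin (E.rank k i)) (Fin (E.rank k i)) ℂ)
      (S : ∀ k, Matrix (Fin (E.rank (k + 1) i)) (Fin (E.rank k i)) ℂ),
      S 0 = 0 ∧ P 0 = (fun _ => 1) ∧ (∀ k, EntriesIn (holAlg x) (P k)) ∧
      (∀ k, ∀ᶠ w in 𝓝 x, P k w * P k w = P k w) ∧
      (∀ k, ∀ᶠ w in 𝓝 x, E.f k i w * P (k + 1) w = P k w * E.f k i w) ∧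
      (∀ k, P (k + 1) x * E.f (k + 1) i x = 0) ∧
      ∀ k, 1 - P (k + 1) x = E.f (k + 1) i x * S (k + 1) + S k * E.f k i x := by
  obtain ⟨S, hS0, hS, hSS, hfS⟩ := exists_splitting hx
  let s : ∀ k, Cn n → Matrix (Fin (E.rank (k + 1) i)) (Fin (E.rank k i)) ℂ :=
    fun k w => perturbInverse (E.f k i x) (E.f k i w) (S k)
  have hT : ∀ k, EntriesIn (holAlg x) fun w => 1 + (E.f k i w - E.f k i x) * S k := fun k =>
    (EntriesIn.const 1).add (((entriesIn_f k hx).sub (EntriesIn.const _)).mul (EntriesIn.const _))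
  have hTx : ∀ k, (1 + (E.f k i x - E.f k i x) * S k).det ≠ 0 := fun k => by simp
  have hdet : ∀ k, ∀ᶠ w in 𝓝 x, IsUnit (1 + (E.f k i w - E.f k i x) * S k).det := fun k => by
    have h1 : AnalyticAt ℂ (fun w => (1 + (E.f k i w - E.f k i x) * S k).det) x := (hT k).det
    filter_upwards [h1.continuousAt.eventually_ne (hTx k)] with w hw
    exact isUnit_iff_ne_zero.2 hw
  have hs : ∀ k, EntriesIn (holAlg x) (s k) := fun k =>
    (EntriesIn.const _).mul ((hT k).inv_hol (hTx k))
  have hs0 : s 0 = fun _ => 0 := by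
    ext1 w
    simp only [s, perturbInverse, hS0, Matrix.zero_mul]
  have hsx : ∀ k, s k x = S k := fun k => perturbInverse_self _ _
  have hsfs : ∀ k, ∀ᶠ w in 𝓝 x, s k w * E.f k i w * s k w = s k w := fun k => by
    filter_upwards [hdet k] with w hw using perturbInverse_mul_mul (hS k) hw
  have hss : ∀ k, ∀ᶠ w in 𝓝 x, s (k + 1) w * s k w = 0 := fun k => by
    filter_upwards [hdet (k + 1)] with w hw using perturbInverse_mul_perturbInverse (hSS k) hw
  refine ⟨E.harmonicProj i s, S, hS0, rfl, fun k => ?_, fun k => ?_, fun k => ?_, fun k => ?_,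
    fun k => ?_⟩
  · cases k with
    | zero => exact EntriesIn.const 1
    | succ k =>
      exact ((EntriesIn.const 1).sub ((entriesIn_f (k + 1) hx).mul (hs (k + 1)))).sub
        ((hs k).mul (entriesIn_f k hx))
  · cases k with
    | zero => exact Eventually.of_forall fun w => Matrix.one_mul _
    | succ k =>
      filter_upwards [hsfs k, hsfs (k + 1), hss k, eventually_mem_U hx] with w h1 h2 h3 h4
      exact harmonic_idempotent (E.f_comp_f k i w h4) h3 h2 h1
  · cases k with
    | zero =>
      filter_upwards [eventually_mem_U hx] with w h4
      simp only [harmonicProj, hs0]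
      rw [Matrix.mul_sub, Matrix.mul_sub, ← Matrix.mul_assoc, E.f_comp_f 0 i w h4]
      simp
    | succ k =>
      filter_upwards [eventually_mem_U hx] with w h4
      simp only [harmonicProj]
      rw [Matrix.mul_sub, Matrix.mul_sub, ← Matrix.mul_assoc, E.f_comp_f (k + 1) i w h4,
        Matrix.sub_mul, Matrix.sub_mul, Matrix.mul_assoc (s k w), E.f_comp_f k i w h4,
        Matrix.zero_mul, Matrix.mul_zero, sub_zero, sub_zero, Matrix.mul_one, Matrix.one_mul,
        Matrix.mul_assoc]
  · simp only [harmonicProj, hsx]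
    rw [Matrix.sub_mul, Matrix.sub_mul, Matrix.one_mul, hfS, Matrix.mul_assoc, E.f_comp_f k i x hx,
      Matrix.mul_zero, sub_zero, sub_self]
  · simp only [harmonicProj, hsx]
    abel

variable {X' : Set (Cn n)} {F : BundleComplex X'} {j : F.ι}

/-- The usual lifting of the identity of O_X; it starts because both `f 0` have image J. The
invariant says that the next composite lies in the kernel, so exactness of F lifts it. -/
theorem exists_comparisonMap (hE : E.IsResolution J) (hF : F.IsResolution J) (hx : x ∈ E.U i)
    (hx' : x ∈ F.U j) :
    ∃ a : ∀ k, Cn n → Matrix (Fin (F.rank k j)) (Fin (E.rank k i)) ℂ,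
      a 0 = (fun _ => ones _ _) ∧ (∀ k, EntriesIn (holAlg x) (a k)) ∧
      ∀ k, ∀ᶠ w in 𝓝 x, F.f k j w * a (k + 1) w = a k w * E.f k i w := by
  have h0 : EntriesIn (holAlg x) fun _ => ones (F.rank 0 j) (E.rank 0 i) := EntriesIn.const _
  obtain ⟨a₁, ha₁, hfa₁⟩ := hF.exists_lift_zero hx' (h0.mul (entriesIn_f 0 hx)) (fun a b => by
    let c : Fin (E.rank 0 i) := ⟨0, by rw [E.rank_zero]; exact one_pos⟩
    refine HolGerm.of_mem_congr ?_ (hE.f_zero_mem hx c b)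
    ext w
    rw [Matrix.mul_apply, Finset.sum_eq_single c (fun d _ hd => (hd (Subsingleton.elim _ _)).elim)
      (fun h => (h (Finset.mem_univ _)).elim), ones_apply, one_mul])
  obtain ⟨a, ha, hQ, hR⟩ := exists_dependent_seq
    (α := fun k => Cn n → Matrix (Fin (F.rank (k + 1) j)) (Fin (E.rank (k + 1) i)) ℂ)
    (fun k a => EntriesIn (holAlg x) a ∧ ∀ᶠ w in 𝓝 x, F.f k j w * (a w * E.f (k + 1) i w) = 0)
    (fun k a a' => ∀ᶠ w in 𝓝 x, F.f (k + 1) j w * a' w = a w * E.f (k + 1) i w)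
    (a₀ := a₁) ⟨ha₁, by
      filter_upwards [hfa₁, eventually_mem_U hx] with w h1 h2
      rw [← Matrix.mul_assoc, h1, Matrix.mul_assoc, E.f_comp_f 0 i w h2, Matrix.mul_zero]⟩
    (fun k a ⟨h1, h2⟩ => by
      obtain ⟨N, hN, hfN⟩ := hF.exists_lift hx' (h1.mul (entriesIn_f (k + 1) hx)) h2
      refine ⟨N, ⟨hN, ?_⟩, hfN⟩
      filter_upwards [hfN, eventually_mem_U hx] with w h3 h4
      rw [← Matrix.mul_assoc, h3, Matrix.mul_assoc, E.f_comp_f (k + 1) i w h4, Matrix.mul_zero])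
  let a' : ∀ k, Cn n → Matrix (Fin (F.rank k j)) (Fin (E.rank k i)) ℂ
    | 0 => fun _ => ones _ _
    | k + 1 => a k
  refine ⟨a', rfl, fun k => ?_, fun k => ?_⟩
  · cases k with
    | zero => exact h0
    | succ k => exact (hQ k).1
  · cases k with
    | zero =>
      filter_upwards [hfa₁] with w hw
      change F.f 0 j w * a 0 w = _
      rw [ha]
      exact hw
    | succ k => exact hR k

/-- The usual uniqueness of lifts up to homotopy. As c is exactly the identity in degree zero, the
homotopy may start with zero, which is essential at the bottom of the complex. -/
theorem exists_homotopy (hE : E.IsResolution J) (hx : x ∈ E.U i)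
    {c : ∀ k, Cn n → Matrix (Fin (E.rank k i)) (Fin (E.rank k i)) ℂ}
    (hc0 : c 0 = fun _ => 1) (hc : ∀ k, EntriesIn (holAlg x) (c k))
    (hfc : ∀ k, ∀ᶠ w in 𝓝 x, E.f k i w * c (k + 1) w = c k w * E.f k i w) :
    ∃ h : ∀ k, Cn n → Matrix (Fin (E.rank (k + 1) i)) (Fin (E.rank k i)) ℂ, h 0 = (fun _ => 0) ∧
      ∀ k, ∀ᶠ w in 𝓝 x, c (k + 1) w = 1 + E.f (k + 1) i w * h (k + 1) w + h k w * E.f k i w := by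
  obtain ⟨h, h0, hQ, hR⟩ := exists_dependent_seq
    (α := fun k => Cn n → Matrix (Fin (E.rank (k + 1) i)) (Fin (E.rank k i)) ℂ)
    (fun k h => EntriesIn (holAlg x) h ∧
      ∀ᶠ w in 𝓝 x, (c k w - 1 - E.f k i w * h w) * E.f k i w = 0)
    (fun k h h' => ∀ᶠ w in 𝓝 x, E.f (k + 1) i w * h' w = c (k + 1) w - 1 - h w * E.f k i w)
    (a₀ := fun _ => 0) ⟨EntriesIn.const _, by simp [hc0]⟩
    (fun k h ⟨h1, h2⟩ => by
      obtain ⟨N, hN, hfN⟩ := hE.exists_lift hx (((hc (k + 1)).sub (EntriesIn.const 1)).sub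
        (h1.mul (entriesIn_f k hx))) (by
          filter_upwards [h2, hfc k] with w h3 h4
          rw [Matrix.mul_sub, Matrix.mul_sub, h4, Matrix.mul_one, ← Matrix.mul_assoc]
          rwa [Matrix.sub_mul, Matrix.sub_mul, Matrix.one_mul] at h3)
      refine ⟨N, ⟨hN, ?_⟩, hfN⟩
      filter_upwards [hfN, eventually_mem_U hx] with w h3 h4
      rw [h3, sub_sub_cancel, Matrix.mul_assoc, E.f_comp_f k i w h4, Matrix.mul_zero])
  refine ⟨h, h0, fun k => ?_⟩
  filter_upwards [hR k] with w hw
  rw [hw]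
  abel

theorem ones_mul_ones (E : BundleComplex X) (F : BundleComplex X') (i : E.ι) (j : F.ι) :
    ones (E.rank 0 i) (F.rank 0 j) * ones (F.rank 0 j) (E.rank 0 i) = 1 := by
  ext a b
  rw [Subsingleton.elim b a, Matrix.mul_apply, Matrix.one_apply_eq]
  simp [F.rank_zero]

end BundleComplex

/-! ### Isomorphic direct summands of two resolutions -/

namespace BundleComplex

variable {n : ℕ} {X X' : Set (Cn n)} {E : BundleComplex X} {F : BundleComplex X'}
  {J : ∀ x : Cn n, Ideal (HolGerm x)} {x : Cn n} {i : E.ι} {j : F.ι}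

/-- On the summand the differentials vanish at x, so a homotopy to the identity contributes nothing
and the compressed composite is exactly P. This is uniqueness of minimal resolutions, in fibre form.
-/
theorem comparison_eq_one (hE : E.IsResolution J) (hx : x ∈ E.U i)
    {P : ∀ k, Cn n → Matrix (Fin (E.rank k i)) (Fin (E.rank k i)) ℂ}
    {P' : ∀ k, Cn n → Matrix (Fin (F.rank k j)) (Fin (F.rank k j)) ℂ}
    {S' : ∀ k, Matrix (Fin (F.rank (k + 1) j)) (Fin (F.rank k j)) ℂ} (hS' : S' 0 = 0)
    (hP0 : P 0 = fun _ => 1) (hP'0 : P' 0 = fun _ => 1)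
    (hPP : ∀ k, ∀ᶠ w in 𝓝 x, P k w * P k w = P k w)
    (hPP' : ∀ k, ∀ᶠ w in 𝓝 x, P' k w * P' k w = P' k w)
    (hfP : ∀ k, ∀ᶠ w in 𝓝 x, E.f k i w * P (k + 1) w = P k w * E.f k i w)
    (hPf : ∀ k, P (k + 1) x * E.f (k + 1) i x = 0)
    (hPS' : ∀ k, 1 - P' (k + 1) x = F.f (k + 1) j x * S' (k + 1) + S' k * F.f k j x)
    {a : ∀ k, Cn n → Matrix (Fin (F.rank k j)) (Fin (E.rank k i)) ℂ} (ha0 : a 0 = fun _ => ones _ _)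
    {b : ∀ k, Cn n → Matrix (Fin (E.rank k i)) (Fin (F.rank k j)) ℂ} (hb0 : b 0 = fun _ => ones _ _)
    (ha : ∀ k, EntriesIn (holAlg x) (a k)) (hb : ∀ k, EntriesIn (holAlg x) (b k))
    (hfa : ∀ k, ∀ᶠ w in 𝓝 x, F.f k j w * a (k + 1) w = a k w * E.f k i w)
    (hfb : ∀ k, ∀ᶠ w in 𝓝 x, E.f k i w * b (k + 1) w = b k w * F.f k j w) (k : ℕ) :
    1 - P k x + P k x * b k x * P' k x * (P' k x * a k x * P k x) = 1 := by
  cases k with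
  | zero => simp only [hP0, hP'0, ha0, hb0, Matrix.one_mul, Matrix.mul_one, ones_mul_ones,
      sub_self, zero_add]
  | succ k =>
    obtain ⟨h, h0, hh⟩ := exists_homotopy hE hx (c := fun k w => b k w * a k w)
      (by ext1 w; simp only [ha0, hb0, ones_mul_ones])
      (fun k => (hb k).mul (ha k)) (fun k => by
        filter_upwards [hfa k, hfb k] with w h1 h2
        rw [← Matrix.mul_assoc, h2, Matrix.mul_assoc, h1, Matrix.mul_assoc])
    have hfPx : ∀ k, E.f (k + 1) i x * P (k + 2) x = 0 := fun k => by
      rw [(hfP (k + 1)).self_of_nhds, hPf]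
    rw [harmonic_comparison (hPP (k + 1)).self_of_nhds (hPf k) (hPP' (k + 1)).self_of_nhds (hPS' k)
      (a₀ := a k x) (B := E.f k i x) (h := h (k + 1) x) (h₀ := h k x) ?_ ?_
      (hfb (k + 1)).self_of_nhds.symm (hfa k).self_of_nhds
      (hh k).self_of_nhds, sub_add_cancel]
    -- The map `f 0` need not vanish at x on the summand; in that degree `S' 0 = 0`, and in the next
    -- goal `h 0 = 0`, take over.
    · cases k with
      | zero => rw [hS', Matrix.zero_mul]
      | succ k => rw [hfPx, Matrix.mul_zero, Matrix.mul_zero]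
    · cases k with
      | zero => rw [h0, Matrix.zero_mul]
      | succ k => rw [hfPx, Matrix.mul_zero]

/-- Holomorphic projections `P`, `P'` of two complexes and inverse isomorphisms `G`, `C` between
their images, in degree `k` at the point `w`. -/
structure IsComparisonAt (E : BundleComplex X) (F : BundleComplex X') (i : E.ι) (j : F.ι)
    (P : ∀ k, Cn n → Matrix (Fin (E.rank k i)) (Fin (E.rank k i)) ℂ)
    (P' : ∀ k, Cn n → Matrix (Fin (F.rank k j)) (Fin (F.rank k j)) ℂ)
    (G : ∀ k, Cn n → Matrix (Fin (F.rank k j)) (Fin (E.rank k i)) ℂ)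
    (C : ∀ k, Cn n → Matrix (Fin (E.rank k i)) (Fin (F.rank k j)) ℂ)
    (k : ℕ) (w : Cn n) : Prop where
  hol_P : EntriesIn (holAlg w) (P k)
  hol_P' : EntriesIn (holAlg w) (P' k)
  hol_G : EntriesIn (holAlg w) (G k)
  hol_C : EntriesIn (holAlg w) (C k)
  P_P : P k w * P k w = P k w
  P'_P' : P' k w * P' k w = P' k w
  C_G : C k w * G k w = P k w
  G_C : G k w * C k w = P' k w
  G_P : G k w * P k w = G k w
  P'_G : P' k w * G k w = G k w
  P_C : P k w * C k w = C k w
  C_P' : C k w * P' k w = C k w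
  f_P : E.f k i w * P (k + 1) w = P k w * E.f k i w
  f_P' : F.f k j w * P' (k + 1) w = P' k w * F.f k j w
  f_G : F.f k j w * G (k + 1) w = G k w * E.f k i w
  f_C : E.f k i w * C (k + 1) w = C k w * F.f k j w

theorem EntriesIn.eventually_hol {r s : ℕ} {M : Cn n → Matrix (Fin s) (Fin r) ℂ}
    (h : EntriesIn (holAlg x) M) : ∀ᶠ w in 𝓝 x, EntriesIn (holAlg w) M :=
  eventually_all.2 fun a => eventually_all.2 fun b => AnalyticAt.eventually_analyticAt (h a b)

theorem EntriesIn.eventually_isUnit_det {s : ℕ} {M : Cn n → Matrix (Fin s) (Fin s) ℂ}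
    (h : EntriesIn (holAlg x) M) (h1 : M x = 1) : ∀ᶠ w in 𝓝 x, IsUnit (M w).det := by
  have h2 : AnalyticAt ℂ (fun w => (M w).det) x := h.det
  filter_upwards [h2.continuousAt.eventually_ne (by rw [h1, det_one]; exact one_ne_zero)] with w hw
  exact isUnit_iff_ne_zero.2 hw

/-- Beyond both lengths all matrices are empty, so only finitely many degrees restrict the
neighbourhood. -/
theorem isComparisonAt_of_length_lt {P : ∀ k, Cn n → Matrix (Fin (E.rank k i)) (Fin (E.rank k i)) ℂ}
    {P' : ∀ k, Cn n → Matrix (Fin (F.rank k j)) (Fin (F.rank k j)) ℂ}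
    {G : ∀ k, Cn n → Matrix (Fin (F.rank k j)) (Fin (E.rank k i)) ℂ}
    {C : ∀ k, Cn n → Matrix (Fin (E.rank k i)) (Fin (F.rank k j)) ℂ} {k : ℕ}
    (hk : E.length < k) (hk' : F.length < k) (w : Cn n) :
    IsComparisonAt E F i j P P' G C k w := by
  have h1 : IsEmpty (Fin (E.rank k i)) := by
    rw [E.rank_eq_zero k i hk]; infer_instance
  have h2 : IsEmpty (Fin (F.rank k j)) := by
    rw [F.rank_eq_zero k j hk']; infer_instance
  exact ⟨fun a => isEmptyElim a, fun a => isEmptyElim a, fun a => isEmptyElim a,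
    fun a => isEmptyElim a, Subsingleton.elim _ _, Subsingleton.elim _ _, Subsingleton.elim _ _,
    Subsingleton.elim _ _, Subsingleton.elim _ _, Subsingleton.elim _ _, Subsingleton.elim _ _,
    Subsingleton.elim _ _, Subsingleton.elim _ _, Subsingleton.elim _ _, Subsingleton.elim _ _,
    Subsingleton.elim _ _⟩

/-- Two resolutions of the same ideal have isomorphic direct summands near every point, which
contain the trivial line bundles in degree zero. -/
theorem exists_comparison (hE : E.IsResolution J) (hF : F.IsResolution J) (hx : x ∈ E.U i)
    (hx' : x ∈ F.U j) :
    ∃ (P : ∀ k, Cn n → Matrix (Fin (E.rank k i)) (Fin (E.rank k i)) ℂ)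
      (P' : ∀ k, Cn n → Matrix (Fin (F.rank k j)) (Fin (F.rank k j)) ℂ)
      (G : ∀ k, Cn n → Matrix (Fin (F.rank k j)) (Fin (E.rank k i)) ℂ)
      (C : ∀ k, Cn n → Matrix (Fin (E.rank k i)) (Fin (F.rank k j)) ℂ),
      P 0 = (fun _ => 1) ∧ G 0 = (fun _ => ones _ _) ∧
      ∃ Y, IsOpen Y ∧ x ∈ Y ∧ Y ⊆ E.U i ∩ F.U j ∧
        ∀ w ∈ Y, ∀ k, IsComparisonAt E F i j P P' G C k w := by
  obtain ⟨P, S, hS0, hP0, hP, hPP, hfP, hPf, hPS⟩ := exists_harmonicProj hx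
  obtain ⟨P', S', hS'0, hP'0, hP', hPP', hfP', hPf', hPS'⟩ := exists_harmonicProj hx'
  obtain ⟨a, ha0, ha, hfa⟩ := exists_comparisonMap hE hF hx hx'
  obtain ⟨b, hb0, hb, hfb⟩ := exists_comparisonMap hF hE hx' hx
  let G : ∀ k, Cn n → Matrix (Fin (F.rank k j)) (Fin (E.rank k i)) ℂ :=
    fun k w => P' k w * a k w * P k w
  let D : ∀ k, Cn n → Matrix (Fin (E.rank k i)) (Fin (F.rank k j)) ℂ :=
    fun k w => P k w * b k w * P' k w
  let C : ∀ k, Cn n → Matrix (Fin (E.rank k i)) (Fin (F.rank k j)) ℂ :=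
    fun k w => cornerInverse (P k w) (D k w) (G k w)
  have hG : ∀ k, EntriesIn (holAlg x) (G k) := fun k => ((hP' k).mul (ha k)).mul (hP k)
  have hD : ∀ k, EntriesIn (holAlg x) (D k) := fun k => ((hP k).mul (hb k)).mul (hP' k)
  have hM : ∀ k, EntriesIn (holAlg x) fun w => 1 - P k w + D k w * G k w := fun k =>
    ((EntriesIn.const 1).sub (hP k)).add ((hD k).mul (hG k))
  have hM' : ∀ k, EntriesIn (holAlg x) fun w => 1 - P' k w + G k w * D k w := fun k =>
    ((EntriesIn.const 1).sub (hP' k)).add ((hG k).mul (hD k))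
  have hMx : ∀ k, 1 - P k x + D k x * G k x = 1 :=
    comparison_eq_one hE hx hS'0 hP0 hP'0 hPP hPP' hfP hPf hPS' ha0 hb0 ha hb hfa hfb
  have hMx' : ∀ k, 1 - P' k x + G k x * D k x = 1 :=
    comparison_eq_one hF hx' hS0 hP'0 hP0 hPP' hPP hfP' hPf' hPS hb0 ha0 hb ha hfb hfa
  have hC : ∀ k, EntriesIn (holAlg x) (C k) := fun k =>
    ((hM k).inv_hol (by rw [hMx, det_one]; exact one_ne_zero)).mul (hD k)
  have hloc : ∀ k, ∀ᶠ w in 𝓝 x, P k w * P k w = P k w ∧ P' k w * P' k w = P' k w ∧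
      C k w * G k w = P k w ∧ G k w * C k w = P' k w ∧ G k w * P k w = G k w ∧
      P' k w * G k w = G k w ∧ P k w * C k w = C k w ∧ C k w * P' k w = C k w := fun k => by
    filter_upwards [hPP k, hPP' k, EntriesIn.eventually_isUnit_det (hM k) (hMx k),
      EntriesIn.eventually_isUnit_det (hM' k) (hMx' k)] with w h1 h2 h3 h4
    have h5 : G k w * P k w = G k w := by
      simp only [G]; rw [Matrix.mul_assoc, h1]
    have h6 : P' k w * G k w = G k w := by
      simp only [G]; rw [← Matrix.mul_assoc, ← Matrix.mul_assoc, h2]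
    have h7 : P k w * D k w = D k w := by
      simp only [D]; rw [← Matrix.mul_assoc, ← Matrix.mul_assoc, h1]
    have h8 : D k w * P' k w = D k w := by
      simp only [D]; rw [Matrix.mul_assoc, h2]
    refine ⟨h1, h2, cornerInverse_mul h1 h5 h3, mul_cornerInverse h2 h5 h6 h8 h3 h4, h5, h6,
      mul_cornerInverse_left h1 h5 h7 h3, ?_⟩
    simp only [C, cornerInverse]
    rw [Matrix.mul_assoc, h8]
  have hcomp : ∀ k, ∀ᶠ w in 𝓝 x, IsComparisonAt E F i j P P' G C k w := fun k => by
    filter_upwards [hloc k, hloc (k + 1), hfP k, hfP' k, hfa k,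
      EntriesIn.eventually_hol (hP k), EntriesIn.eventually_hol (hP' k),
      EntriesIn.eventually_hol (hG k), EntriesIn.eventually_hol (hC k)] with w
      ⟨h1, h2, h3, h4, h5, h6, h7, h8⟩ ⟨g1, g2, g3, g4, g5, g6, g7, g8⟩ e1 e2 e3 e4 e5 e6 e7
    have hfG : F.f k j w * G (k + 1) w = G k w * E.f k i w := by
      simp only [G]
      rw [← Matrix.mul_assoc, ← Matrix.mul_assoc, e2, Matrix.mul_assoc (P' k w), e3,
        Matrix.mul_assoc, Matrix.mul_assoc (a k w), e1]
      simp only [Matrix.mul_assoc]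
    refine ⟨e4, e5, e6, e7, h1, h2, h3, h4, h5, h6, h7, h8, e1, e2, hfG, ?_⟩
    -- C commutes with f because its inverse does: f C = P f C = C G f C = C f G C = C f P' = C P' f
    -- = C f.
    rw [← g7, ← Matrix.mul_assoc, e1, ← h3, Matrix.mul_assoc (C k w), ← hfG,
      Matrix.mul_assoc (C k w), Matrix.mul_assoc (F.f k j w), g4, e2, ← Matrix.mul_assoc, h8]
  have hfin : ∀ᶠ w in 𝓝 x, ∀ k, IsComparisonAt E F i j P P' G C k w := by
    have h1 : ∀ᶠ w in 𝓝 x, ∀ k ∈ Finset.range (max E.length F.length + 1),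
        IsComparisonAt E F i j P P' G C k w := by
      rw [Filter.eventually_all_finset]
      exact fun k _ => hcomp k
    filter_upwards [h1] with w hw k
    by_cases hk : k ∈ Finset.range (max E.length F.length + 1)
    · exact hw k hk
    · rw [Finset.mem_range, not_lt] at hk
      exact isComparisonAt_of_length_lt (lt_of_le_of_lt (le_max_left _ _) hk)
        (lt_of_le_of_lt (le_max_right _ _) hk) w
  obtain ⟨Y, hY, hYo, hxY⟩ := eventually_nhds_iff.1
    (hfin.and ((eventually_mem_U hx).and (eventually_mem_U hx')))
  refine ⟨P, P', G, C, hP0, ?_, Y, hYo, hxY, fun w hw => (hY w hw).2, fun w hw => (hY w hw).1⟩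
  ext1 w
  simp only [G, hP0, hP'0, ha0, Matrix.one_mul, Matrix.mul_one]

end BundleComplex

/-! ### Images of holomorphic projections, and positive definiteness -/

section Projections

variable {n r s : ℕ} {Y : Set (Cn n)}

/-- The matrix Θ(w) = P(w)P(z) + (1 - P(w))(1 - P(z)) is the identity at w = z and satisfies
Θ(w)P(z) = P(w)Θ(w). It therefore carries a basis of im P(z) to a frame of im P(w) for w near z. -/
theorem isHolSubbundle_range (hY : IsOpen Y) {P : Cn n → Matrix (Fin r) (Fin r) ℂ}
    (hP : ∀ z ∈ Y, EntriesIn (holAlg z) P) (hPP : ∀ z ∈ Y, P z * P z = P z) :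
    IsHolSubbundle Y fun z => LinearMap.range (P z).mulVecLin := by
  intro z hz
  let b := Module.finBasis ℂ (LinearMap.range (P z).mulVecLin)
  let Θ : Cn n → Matrix (Fin r) (Fin r) ℂ := fun w => P w * P z + (1 - P w) * (1 - P z)
  have hΘ : EntriesIn (holAlg z) Θ := ((hP z hz).mul (EntriesIn.const _)).add
    (((EntriesIn.const 1).sub (hP z hz)).mul (EntriesIn.const _))
  have hΘz : Θ z = 1 := by
    simp only [Θ, Matrix.mul_sub, Matrix.sub_mul, hPP z hz, Matrix.one_mul, Matrix.mul_one]
    abel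
  have hb : ∀ a, P z *ᵥ (b a : Cn r) = b a := fun a => by
    obtain ⟨y, hy⟩ := (b a).2
    rw [← hy, mulVecLin_apply, mulVec_mulVec, hPP z hz]
  have hbl : LinearIndependent ℂ fun a => (b a : Cn r) :=
    b.linearIndependent.map' (Submodule.subtype _) (Submodule.ker_subtype _)
  have hbs : Submodule.span ℂ (Set.range fun a => (b a : Cn r)) =
      LinearMap.range (P z).mulVecLin := by
    have h1 := congrArg (Submodule.map (Submodule.subtype _)) b.span_eq
    rw [Submodule.map_span, ← Set.range_comp, Submodule.map_top, Submodule.range_subtype] at h1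
    exact h1
  refine ⟨_, fun a w => P w *ᵥ (b a : Cn r), fun a => ?_, ?_⟩
  · refine analyticAt_pi_iff.2 fun c => ?_
    have h1 : EntriesIn (holAlg z) fun w => P w * Matrix.of fun d (_ : Fin 1) => (b a : Cn r) d :=
      (hP z hz).mul (EntriesIn.const _)
    exact h1 c 0
  · filter_upwards [BundleComplex.EntriesIn.eventually_isUnit_det hΘ hΘz, hY.mem_nhds hz]
      with w h1 h2
    have h3 : ∀ a, P w *ᵥ (b a : Cn r) = (Θ w).mulVecLin (b a : Cn r) := fun a => by
      simp only [Θ, mulVecLin_apply, add_mulVec, ← mulVec_mulVec, sub_mulVec, one_mulVec, hb,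
        sub_self, mulVec_zero, add_zero]
    have hker : LinearMap.ker (Θ w).mulVecLin = ⊥ :=
      LinearMap.ker_eq_bot.2 (Matrix.mulVec_injective_iff_isUnit.2
        ((Matrix.isUnit_iff_isUnit_det _).2 h1))
    have hrange : LinearMap.range (Θ w).mulVecLin = ⊤ :=
      LinearMap.range_eq_top.2 (Matrix.mulVec_surjective_iff_isUnit.2
        ((Matrix.isUnit_iff_isUnit_det _).2 h1))
    have h4 : Θ w * P z = P w * Θ w := by
      simp only [Θ, Matrix.mul_sub, Matrix.sub_mul, Matrix.add_mul, Matrix.mul_add, hPP z hz,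
        Matrix.one_mul, Matrix.mul_one, Matrix.mul_assoc, ← Matrix.mul_assoc (P w) (P w), hPP w h2]
      abel
    simp only [h3]
    refine ⟨hbl.map' _ hker, ?_⟩
    have h5 := congrArg (Submodule.map (Θ w).mulVecLin) hbs
    rw [Submodule.map_span, ← Set.range_comp] at h5
    refine h5.trans ?_
    rw [← LinearMap.range_comp, ← Matrix.mulVecLin_mul, h4, Matrix.mulVecLin_mul,
      LinearMap.range_comp, hrange, Submodule.map_top]

theorem posDef_conjTranspose_mul_self_add {t : ℕ} (A : Matrix (Fin s) (Fin r) ℂ)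
    (B : Matrix (Fin t) (Fin r) ℂ) (h : ∀ v, A *ᵥ v = 0 → B *ᵥ v = 0 → v = 0) :
    (Aᴴ * A + Bᴴ * B).PosDef := by
  have h1 : (Matrix.fromRows A B)ᴴ * Matrix.fromRows A B = Aᴴ * A + Bᴴ * B := by
    rw [Matrix.conjTranspose_fromRows_eq_fromCols_conjTranspose, Matrix.fromCols_mul_fromRows]
  rw [← h1]
  refine Matrix.PosDef.conjTranspose_mul_self _ ?_
  refine (injective_iff_map_eq_zero (Matrix.fromRows A B).mulVecLin).2 fun v hv => ?_
  rw [mulVecLin_apply, Matrix.fromRows_mulVec] at hv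
  exact h v (funext fun a => congrFun hv (Sum.inl a)) (funext fun a => congrFun hv (Sum.inr a))

end Projections

/-! ### Adapted metrics and the comparison of u and v -/

namespace BundleComplex

variable {n : ℕ} {X X' Y : Set (Cn n)} {E : BundleComplex X} {F : BundleComplex X'}
  {J : ∀ x : Cn n, Ideal (HolGerm x)} {x : Cn n} {i : E.ι} {j : F.ι}

/-- The metric with given Gram matrices in one frame. -/
def metricOfFrame (hYi : Y ⊆ E.U i) (K : ∀ k, Cn n → Matrix (Fin (E.rank k i)) (Fin (E.rank k i)) ℂ)
    (hK : ∀ k, ∀ z ∈ Y, (K k z).PosDef) (hKs : ∀ k, ∀ z ∈ Y, EntriesIn (smoothAlg z) (K k)) :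
    E.HermitianMetric Y where
  H k l z := (E.trans k i l z)ᴴ * K k z * E.trans k i l z
  posDef k l z hz := (hK k z hz.2).conjTranspose_mul_mul_same (by
    refine Function.LeftInverse.injective (g := (E.trans k l i z).mulVec) fun v => ?_
    rw [mulVec_mulVec, trans_mul_trans k hz.1 (hYi hz.2), one_mulVec])
  smooth k l a b z hz := by
    have h1 : EntriesIn (smoothAlg z) (E.trans k i l) :=
      EntriesIn.mono (R := holAlg z) (holAlg_le_smoothAlg z)
        fun a b => E.trans_hol k i l a b z ⟨hYi hz.2, hz.1⟩
    have h2 := (h1.conjTranspose.mul (hKs k z hz.2)).mul h1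
    exact (mem_smoothAlg.1 (h2 a b)).contDiffWithinAt
  compat k l m z hz := by
    rw [← E.trans_mul k i l m z ⟨⟨hYi hz.2, hz.1.1⟩, hz.1.2⟩, conjTranspose_mul]
    simp only [Matrix.mul_assoc]

theorem metricOfFrame_H (hYi : Y ⊆ E.U i)
    (K : ∀ k, Cn n → Matrix (Fin (E.rank k i)) (Fin (E.rank k i)) ℂ)
    (hK : ∀ k, ∀ z ∈ Y, (K k z).PosDef) (hKs : ∀ k, ∀ z ∈ Y, EntriesIn (smoothAlg z) (K k))
    (k : ℕ) {z : Cn n} (hz : z ∈ Y) : (metricOfFrame hYi K hK hKs).H k i z = K k z := by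
  change (E.trans k i i z)ᴴ * K k z * E.trans k i i z = K k z
  rw [E.trans_self k i z (hYi hz), conjTranspose_one, Matrix.one_mul, Matrix.mul_one]

/-- Two resolutions of the same ideal have, near every point, metrics for which the components
`u φ` take values in isomorphic subbundles and correspond to each other. -/
theorem IsResolution.exists_metrics (hE : E.IsResolution J) (hF : F.IsResolution J)
    (hx : x ∈ E.U i) (hx' : x ∈ F.U j) :
    ∃ Y : Set (Cn n), IsOpen Y ∧ x ∈ Y ∧ Y ⊆ E.U i ∩ F.U j ∧
      ∃ (h : E.HermitianMetric Y) (h' : F.HermitianMetric Y), ∀ q : ℕ,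
        ∃ (S : Cn n → Submodule ℂ (Cn (E.rank (q + 1) i)))
          (T : Cn n → Submodule ℂ (Cn (F.rank (q + 1) j)))
          (G : Cn n → Matrix (Fin (F.rank (q + 1) j)) (Fin (E.rank (q + 1) i)) ℂ),
          IsHolSubbundleIso Y S T G ∧
          ∀ φ : Cn n → ℂ, AnalyticOnNhd ℂ φ Y →
            ∀ z ∈ Y \ zeroLocus J, ∀ v : Fin q → Cn n,
              uComponent h φ q i z v ∈ S z ∧ uComponent h' φ q j z v ∈ T z ∧
              G z *ᵥ uComponent h φ q i z v = uComponent h' φ q j z v := by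
  obtain ⟨P, P', G, C, hP0, hG0, Y, hY, hxY, hYU, hcmp⟩ := exists_comparison hE hF hx hx'
  -- Both metrics make the summand orthogonal to the kernel of its projection. On im P the metric is
  -- the standard one, and on im P' it is the standard one transported by C, so that G is an
  -- isometry of the summands.
  let K : ∀ k, Cn n → Matrix (Fin (E.rank k i)) (Fin (E.rank k i)) ℂ :=
    fun k z => (P k z)ᴴ * P k z + (1 - P k z)ᴴ * (1 - P k z)
  let K' : ∀ k, Cn n → Matrix (Fin (F.rank k j)) (Fin (F.rank k j)) ℂ :=
    fun k z => (1 - P' k z)ᴴ * (1 - P' k z) + (C k z)ᴴ * C k z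
  have hK : ∀ k, ∀ z ∈ Y, (K k z).PosDef := fun k z _ =>
    posDef_conjTranspose_mul_self_add _ _ fun v h1 h2 => by
      rwa [sub_mulVec, one_mulVec, h1, sub_zero] at h2
  have hK' : ∀ k, ∀ z ∈ Y, (K' k z).PosDef := fun k z hz =>
    posDef_conjTranspose_mul_self_add _ _ fun v h1 h2 => by
      rwa [sub_mulVec, one_mulVec, ← (hcmp z hz k).G_C, ← mulVec_mulVec, h2, mulVec_zero,
        sub_zero] at h1
  have hKs : ∀ k, ∀ z ∈ Y, EntriesIn (smoothAlg z) (K k) := fun k z hz => by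
    have h1 := (hcmp z hz k).hol_P.mono (holAlg_le_smoothAlg z)
    have h2 := (EntriesIn.const (R := smoothAlg z) 1).sub h1
    exact (h1.conjTranspose.mul h1).add (h2.conjTranspose.mul h2)
  have hKs' : ∀ k, ∀ z ∈ Y, EntriesIn (smoothAlg z) (K' k) := fun k z hz => by
    have h1 := (hcmp z hz k).hol_C.mono (holAlg_le_smoothAlg z)
    have h2 := (EntriesIn.const (R := smoothAlg z) 1).sub
      ((hcmp z hz k).hol_P'.mono (holAlg_le_smoothAlg z))
    exact (h2.conjTranspose.mul h2).add (h1.conjTranspose.mul h1)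
  have hYE : Y ⊆ E.U i := fun z hz => (hYU hz).1
  have hYF : Y ⊆ F.U j := fun z hz => (hYU hz).2
  let h := metricOfFrame hYE K hK hKs
  let h' := metricOfFrame hYF K' hK' hKs'
  have hH : ∀ k, ∀ z ∈ Y, h.H k i z = K k z := fun k z hz => metricOfFrame_H hYE K hK hKs k hz
  have hH' : ∀ k, ∀ z ∈ Y, h'.H k j z = K' k z := fun k z hz =>
    metricOfFrame_H hYF K' hK' hKs' k hz
  -- P is self-adjoint, so its adjoint is again a map of complexes.
  have hKP : ∀ k, ∀ z ∈ Y, h.H k i z * P k z = (P k z)ᴴ * h.H k i z := fun k z hz => by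
    have h1 := (hcmp z hz k).P_P
    have h2 : (1 - P k z) * P k z = 0 := by rw [Matrix.sub_mul, h1, Matrix.one_mul, sub_self]
    rw [hH k z hz]
    simp only [K]
    rw [Matrix.add_mul, Matrix.mul_assoc, h1, Matrix.mul_assoc, h2, Matrix.mul_zero, Matrix.mul_add,
      ← Matrix.mul_assoc, ← Matrix.mul_assoc, ← conjTranspose_mul, ← conjTranspose_mul, h1, h2,
      conjTranspose_zero, Matrix.zero_mul]
  -- The adjoint of G is C, which is also a map of complexes.
  have hKG : ∀ k, ∀ z ∈ Y, h'.H k j z * G k z = (C k z)ᴴ * h.H k i z := fun k z hz => by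
    have h1 := hcmp z hz k
    have h2 : (1 - P' k z) * G k z = 0 := by
      rw [Matrix.sub_mul, h1.P'_G, Matrix.one_mul, sub_self]
    have h3 : (1 - P k z) * C k z = 0 := by
      rw [Matrix.sub_mul, h1.P_C, Matrix.one_mul, sub_self]
    rw [hH k z hz, hH' k z hz]
    simp only [K, K']
    rw [Matrix.add_mul, Matrix.mul_assoc, h2, Matrix.mul_assoc, h1.C_G, Matrix.mul_zero,
      Matrix.mul_add, ← Matrix.mul_assoc, ← Matrix.mul_assoc, ← conjTranspose_mul,
      ← conjTranspose_mul, h1.P_C, h3, conjTranspose_zero, Matrix.zero_mul, zero_add, add_zero]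
  have hWE : ∀ z ∈ Y \ zeroLocus J, z ∈ (E.U i ∩ Y) \ zeroLocus J := fun z hz =>
    ⟨⟨hYE hz.1, hz.1⟩, hz.2⟩
  have hWF : ∀ z ∈ Y \ zeroLocus J, z ∈ (F.U j ∩ Y) \ zeroLocus J := fun z hz =>
    ⟨⟨hYF hz.1, hz.1⟩, hz.2⟩
  have hW : IsOpen (Y \ zeroLocus J) := by
    have h1 := hE.isOpen_inter_diff hY i
    rwa [Set.inter_eq_self_of_subset_right hYE] at h1
  -- Taking both complexes equal to E and T = P shows that P fixes uφ, so uφ takes values in im P.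
  have huP : ∀ φ, AnalyticOnNhd ℂ φ Y → ∀ q, ∀ z ∈ Y \ zeroLocus J,
      applyForm (fun w => (P (q + 1) w).mulVecLin) (uSolve h φ i q) z = uSolve h φ i q z :=
    fun φ hφ q => solve_intertwine (r := fun k => E.rank k i) (r' := fun k => E.rank k i)
      (S := fun k => sigma h k i) (S' := fun k => sigma h k i)
      (T := fun k w => (P k w).mulVecLin) hW
      (fun k z hz => hE.contDiffAt_sigma h hY k (hWE z hz))
      (lineSource_mem_smoothForms hW (hφ.mono fun _ hw => hw.1))
      (fun k z hz => differentiableAt_toCLM_mulVecLin (hcmp z hz.1 k).hol_P)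
      (fun k z hz y => hE.sigma_intertwine hE h h (hWE z hz) (hWE z hz) (T := fun k => P k z)
        (T' := fun k => P k z) (fun k => (hcmp z hz.1 k).f_P) (fun k => (hcmp z hz.1 k).f_P)
        (fun k => hKP k z hz.1) k y)
      (fun q z hz => lineSource_intertwine (r := fun k => E.rank k i) (r' := fun k => E.rank k i)
        (T := fun k w => (P k w).mulVecLin) (E.rank_zero i) rfl (fun a b => by
          rw [Subsingleton.elim b a, hP0]; exact Matrix.one_apply_eq a) q) q
  have huG : ∀ φ, AnalyticOnNhd ℂ φ Y → ∀ q, ∀ z ∈ Y \ zeroLocus J,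
      applyForm (fun w => (G (q + 1) w).mulVecLin) (uSolve h φ i q) z = uSolve h' φ j q z :=
    fun φ hφ q => solve_intertwine (r := fun k => E.rank k i) (r' := fun k => F.rank k j)
      (S := fun k => sigma h k i) (S' := fun k => sigma h' k j)
      (T := fun k w => (G k w).mulVecLin) hW
      (fun k z hz => hE.contDiffAt_sigma h hY k (hWE z hz))
      (lineSource_mem_smoothForms hW (hφ.mono fun _ hw => hw.1))
      (fun k z hz => differentiableAt_toCLM_mulVecLin (hcmp z hz.1 k).hol_G)
      (fun k z hz y => hE.sigma_intertwine hF h h' (hWE z hz) (hWF z hz) (T := fun k => G k z)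
        (T' := fun k => C k z) (fun k => (hcmp z hz.1 k).f_G) (fun k => (hcmp z hz.1 k).f_C)
        (fun k => hKG k z hz.1) k y)
      (fun q z hz => lineSource_intertwine (r := fun k => E.rank k i) (r' := fun k => F.rank k j)
        (T := fun k w => (G k w).mulVecLin) (E.rank_zero i) rfl (fun a b => by
          rw [hG0]; rfl) q) q
  refine ⟨Y, hY, hxY, hYU, h, h', fun q => ⟨fun z => LinearMap.range (P (q + 1) z).mulVecLin,
    fun z => LinearMap.range (P' (q + 1) z).mulVecLin, G (q + 1), ⟨?_, ?_, ?_, ?_⟩, ?_⟩⟩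
  · exact isHolSubbundle_range hY (fun z hz => (hcmp z hz _).hol_P) fun z hz => (hcmp z hz _).P_P
  · exact isHolSubbundle_range hY (fun z hz => (hcmp z hz _).hol_P') fun z hz => (hcmp z hz _).P'_P'
  · exact fun a b z hz => (hcmp z hz _).hol_G a b
  · intro z hz
    have hc := hcmp z hz (q + 1)
    refine Set.InvOn.bijOn (f' := (C (q + 1) z).mulVec) ⟨?_, ?_⟩ ?_ ?_
    · rintro _ ⟨y, rfl⟩
      rw [mulVecLin_apply, mulVec_mulVec, mulVec_mulVec, hc.C_G, hc.P_P]
    · rintro _ ⟨y, rfl⟩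
      rw [mulVecLin_apply, mulVec_mulVec, mulVec_mulVec, hc.G_C, hc.P'_P']
    · intro y _
      exact ⟨G (q + 1) z *ᵥ y, by rw [mulVecLin_apply, mulVec_mulVec, hc.P'_G]⟩
    · intro y _
      exact ⟨C (q + 1) z *ᵥ y, by rw [mulVecLin_apply, mulVec_mulVec, hc.P_C]⟩
  · intro φ hφ z hz v
    have h1 := DFunLike.congr_fun (huP φ hφ q z hz) v
    have h2 := DFunLike.congr_fun (huG φ hφ q z hz) v
    rw [applyForm_apply, mulVecLin_apply] at h1 h2
    rw [hE.uComponent_eq h hY hφ q (hWE z hz), hF.uComponent_eq h' hY hφ q (hWF z hz),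
      ContinuousAlternatingMap.smul_apply, ContinuousAlternatingMap.smul_apply, mulVec_smul, h2]
    refine ⟨Submodule.smul_mem _ _ ⟨_, h1⟩, Submodule.smul_mem _ _
      ⟨uSolve h' φ j q z v, ?_⟩, rfl⟩
    rw [mulVecLin_apply, ← h2, mulVec_mulVec, (hcmp z hz.1 (q + 1)).P'_G]

end BundleComplex

end Residue

end

theorem mainTheorem3 {n : ℕ} (X : Set (Residue.Cn n)) (hX : IsOpen X)
    (J : ∀ x : Residue.Cn n, Ideal (Residue.HolGerm x))
    (E : Residue.BundleComplex X) (hE : E.IsResolution J) :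
    -- (i) with `p = q + 1`: the class of `ξ u_p φ` in `H^{0,p-1}(X \ Z)` exists and does not
    -- depend on the metric
    (∀ (q : ℕ) (ξ : ∀ i : E.ι, Residue.Cn n → Residue.Cn (E.rank (q + 1) i)),
      E.IsHolDualSection (q + 1) ξ →
      (∀ i, ∀ z ∈ E.U i, ξ i z ᵥ* E.f (q + 1) i z = 0) →
      ∀ φ : Residue.Cn n → ℂ, AnalyticOnNhd ℂ φ X →
      ∃ c : Residue.Dolbeault hE.compl q, ∀ h : E.HermitianMetric X,
        ∃ (α : Residue.Form n q ℂ) (hα : α ∈ Residue.closedForms hE.compl q),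
          (∀ i, ∀ z ∈ E.U i \ Residue.zeroLocus J,
            α z = Residue.pairForm (ξ i) (Residue.BundleComplex.uComponent h φ q i) z) ∧
          Residue.Dolbeault.mk hE.compl α hα = c) ∧
    -- (ii) with `p = q + 1`: comparison of two resolutions near a point `x`
    (∀ F : Residue.BundleComplex X, F.IsResolution J →
      ∀ x ∈ X, ∀ (i : E.ι) (j : F.ι), x ∈ E.U i → x ∈ F.U j →
      ∃ Y : Set (Residue.Cn n), IsOpen Y ∧ x ∈ Y ∧ Y ⊆ E.U i ∩ F.U j ∧
      ∃ (h : E.HermitianMetric Y) (h' : F.HermitianMetric Y) (g₀ : Residue.Cn n → ℂ),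
        AnalyticOnNhd ℂ g₀ Y ∧ (∀ z ∈ Y, g₀ z ≠ 0) ∧
        ∀ q : ℕ, ∃ (S : Residue.Cn n → Submodule ℂ (Residue.Cn (E.rank (q + 1) i)))
          (T : Residue.Cn n → Submodule ℂ (Residue.Cn (F.rank (q + 1) j)))
          (G : Residue.Cn n → Matrix (Fin (F.rank (q + 1) j)) (Fin (E.rank (q + 1) i)) ℂ),
          Residue.IsHolSubbundleIso Y S T G ∧
          ∀ φ : Residue.Cn n → ℂ, AnalyticOnNhd ℂ φ Y →
            ∀ z ∈ Y \ Residue.zeroLocus J, ∀ v : Fin q → Residue.Cn n,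
              Residue.BundleComplex.uComponent h φ q i z v ∈ S z ∧
              Residue.BundleComplex.uComponent h' (fun w => g₀ w * φ w) q j z v ∈ T z ∧
              G z *ᵥ Residue.BundleComplex.uComponent h φ q i z v =
                Residue.BundleComplex.uComponent h' (fun w => g₀ w * φ w) q j z v) := by
  refine ⟨fun q ξ hξ hξf φ hφ => hE.exists_class hX q ξ hξ hξf φ hφ,
    fun F hF x _ i j hx hx' => ?_⟩
  obtain ⟨Y, hY, hxY, hYU, h, h', H⟩ := hE.exists_metrics hF hx hx'
  -- The comparison maps lift the identity of O_X and P is the identity in degree zero, so g₀ = 1.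
  refine ⟨Y, hY, hxY, hYU, h, h', fun _ => 1, analyticOnNhd_const, fun _ _ => one_ne_zero,
    fun q => ?_⟩
  simpa only [one_mul] using H q
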